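/- Let $N\ge 2$ and $0\le\tau<1$, and let $X$ be an $N\times N$ real random matrix with density (with respect to $\prod_{i,j}dX_{ij}$) $$C_N^{-1}\exp\Big[-\tfrac{1}{2(1-\tau^2)}\operatorname{Tr}(XX^T-\tau X^2)\Big],\qquad C_N=(2\pi)^{N^2/2}(1+\tau)^{N/2}(1-\tau^2)^{N(N-1)/4}.$$ For a (simple) real eigenvalue $\lambda$ of $X$ let $\kappa_\lambda=\sqrt{(l^Tl)(r^Tr)}$ be its condition number, where $Xr=\lambda r$, $X^Tl=\lambda l$, $l^Tr=1$, and put $q_\lambda=(\kappa_\lambda^2-1)/(1-\tau)$. (Almost surely all eigenvalues of $X$ are simple.) Then the joint density $\mathcal P_N^\tau(z,q)=\big\langle\sum_{\lambda\text{ real}}\delta(z-\lambda)\,\delta(q-q_\lambda)\big\rangle$ of a real eigenvalue and its rescaled condition number exists on $z\in\mathbb R$, $q>0$; that is, for every measurable $f:\mathbb R^2\to[0,\infty]$, $$\mathbb E\sum_{\lambda\text{ real eigenvalue of }X}f(\lambda,q_\lambda)=\int_{\mathbb R}\int_0^\infty f(z,q)\,\mathcal P_N^\tau(z,q)\,dq\,dz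 ,$$ where the sum on the left is an almost everywhere measurable function of $X$, and $\mathcal P_N^\tau\ge 0$ is given by $$\mathcal P_N^{\tau}(z,q)=\frac{1}{2(1+\tau)\sqrt{2\pi}\,\Gamma(N-1)}\,\frac{e^{-\frac{z^2}{2(1+\tau)}\left(1+\frac{q}{1+q}\right)}}{\sqrt{q(1+q)}}\left(\frac{q}{q+1+\tau}\right)^{\frac N2-1}\Bigg[\frac{(1+\tau-2z^2)P_{N-2}+2z[R_{N-2}+\tau(N-2)R_{N-3}]}{1+q}+\frac{P_{N-2}z^2}{(1+q)^2}$$ $$+\frac{\tau^2(1+\tau)^2N(N-2)P_{N-3}}{(1+\tau+q)^2}+\frac{(1+\tau)(1-\tau^2)(N-2)\big((N-2)P_{N-3}-T_{N-3}\big)}{1+\tau+q}-\frac{2\tau(1+\tau)(N-2)zR_{N-3}}{(1+q)(1+\tau+q)}\Bigg].$$ Here $P_m,R_m,T_m$ are evaluated at $z$ and, with $\mathrm{He}_k$ the monic (probabilists') Hermite polynomials at the argument $z/\sqrt\tau$, $$P_m(z)=m!\sum_{k=0}^m\frac{\tau^k}{k!}\big((k+1)\mathrm{He}_k^2-k\,\mathrm{He}_{k-1}\mathrm{He}_{k+1}\big),\qquad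 R_m(z)=\frac{m!}{2}\sum_{k=0}^m\frac{\tau^{k+1/2}}{k!}\big((k+2)\mathrm{He}_{k+1}\mathrm{He}_k-k\,\mathrm{He}_{k+2}\mathrm{He}_{k-1}\big),$$ $$T_m(z)=m!\sum_{k=0}^m\frac{k\,\tau^k}{k!}\big((k+1)\mathrm{He}_k^2-k\,\mathrm{He}_{k-1}\mathrm{He}_{k+1}\big).$$ For $\tau=0$ the product $\tau^{k/2}\mathrm{He}_k(z/\sqrt\tau)$ is read as its polynomial value $z^k$; for $N=2$ the terms with index $N-3$ carry the factor $N-2=0$ and are absent. -/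

import Mathlib

open MeasureTheory
open scoped ENNReal Nat

noncomputable section

namespace EllipticEnsemble

/-- Density `C_N⁻¹ exp (-(1 / (2 (1 - τ²))) Tr (X Xᵀ - τ X²))` of the real elliptic Gaussian
ensemble, with `C_N = (2π)^(N²/2) (1+τ)^(N/2) (1-τ²)^(N(N-1)/4)`. -/
def ellipticPDF (N : ℕ) (τ : ℝ) (X : Matrix (Fin N) (Fin N) ℝ) : ℝ :=
  ((2 * Real.pi) ^ ((N : ℝ) ^ 2 / 2) * (1 + τ) ^ ((N : ℝ) / 2) *
      (1 - τ ^ 2) ^ ((N : ℝ) * ((N : ℝ) - 1) / 4))⁻¹ *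
    Real.exp (-(1 / (2 * (1 - τ ^ 2))) *
      Matrix.trace (X * X.transpose - τ • (X * X)))

/-- Law of the real elliptic Gaussian ensemble: the measure with density `ellipticPDF` with
respect to the product Lebesgue measure `∏ dX_ij` on the entries. -/
def ellipticMeasure (N : ℕ) (τ : ℝ) : Measure (Fin N → Fin N → ℝ) :=
  volume.withDensity fun X => ENNReal.ofReal (ellipticPDF N τ (Matrix.of X))

/-- Condition number `κ = √((lᵀl)(rᵀr))` of a real eigenvalue `z` of `X`, where
`X r = z r`, `Xᵀ l = z l`, `lᵀ r = 1`. If `z` is a simple eigenvalue, the set below has exactly one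
element; the infimum only fixes a value in the degenerate cases. -/
def condNumber {N : ℕ} (X : Matrix (Fin N) (Fin N) ℝ) (z : ℝ) : ℝ :=
  sInf {κ : ℝ | ∃ l r : Fin N → ℝ,
    X.mulVec r = z • r ∧ X.transpose.mulVec l = z • l ∧ l ⬝ᵥ r = 1 ∧
    κ = √((l ⬝ᵥ l) * (r ⬝ᵥ r))}

/-- The rescaled variable `q = (κ² - 1) / (1 - τ)`. -/
def rescaledOverlap {N : ℕ} (τ : ℝ) (X : Matrix (Fin N) (Fin N) ℝ) (z : ℝ) : ℝ :=
  (condNumber X z ^ 2 - 1) / (1 - τ)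

/-- The sum `∑ f (λ, q)` over all real eigenvalues `λ` of `X` (roots of the characteristic
polynomial, with multiplicity), where `q` is the rescaled variable belonging to `λ`. -/
def realEigenvalueSum {N : ℕ} (τ : ℝ) (f : ℝ × ℝ → ℝ≥0∞) (X : Matrix (Fin N) (Fin N) ℝ) : ℝ≥0∞ :=
  (X.charpoly.roots.map fun z => f (z, rescaledOverlap τ X z)).sum

/-- The monic (probabilists') Hermite polynomial as a function on `ℝ`. -/
def He (k : ℕ) (x : ℝ) : ℝ := Polynomial.aeval x (Polynomial.hermite k)

/-- `τ^(k/2) He_k (z / √τ)`, written as a polynomial in `z` and `τ`, so that it also makes sense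
at `τ = 0` (where it is `z ^ k`). -/
def scaledHe (τ : ℝ) (k : ℕ) (z : ℝ) : ℝ :=
  ∑ j ∈ Finset.range (k + 1), ((Polynomial.hermite k).coeff j : ℝ) * τ ^ ((k - j) / 2) * z ^ j

/-- `P_m(z)`. -/
def polyP (τ : ℝ) (m : ℕ) (z : ℝ) : ℝ :=
  (m ! : ℝ) * ∑ k ∈ Finset.range (m + 1), 1 / (k ! : ℝ) *
    (((k : ℝ) + 1) * scaledHe τ k z ^ 2 - (k : ℝ) * (scaledHe τ (k - 1) z * scaledHe τ (k + 1) z))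

/-- `R_m(z)`. -/
def polyR (τ : ℝ) (m : ℕ) (z : ℝ) : ℝ :=
  (m ! : ℝ) / 2 * ∑ k ∈ Finset.range (m + 1), 1 / (k ! : ℝ) *
    (((k : ℝ) + 2) * (scaledHe τ (k + 1) z * scaledHe τ k z) -
      (k : ℝ) * (scaledHe τ (k + 2) z * scaledHe τ (k - 1) z))

/-- `T_m(z)`. -/
def polyT (τ : ℝ) (m : ℕ) (z : ℝ) : ℝ :=
  (m ! : ℝ) * ∑ k ∈ Finset.range (m + 1), (k : ℝ) / (k ! : ℝ) *
    (((k : ℝ) + 1) * scaledHe τ k z ^ 2 - (k : ℝ) * (scaledHe τ (k - 1) z * scaledHe τ (k + 1) z))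

/-- The joint density `𝒫_N^τ(z, q)`. For `N = 2` every term with index `N - 3` carries the
factor `N - 2 = 0`. -/
def jointDensity (N : ℕ) (τ z q : ℝ) : ℝ :=
  1 / (2 * (1 + τ) * √(2 * Real.pi) * Real.Gamma ((N : ℝ) - 1)) *
    (Real.exp (-(z ^ 2 / (2 * (1 + τ))) * (1 + q / (1 + q))) / √(q * (1 + q))) *
    (q / (q + 1 + τ)) ^ ((N : ℝ) / 2 - 1) *
    (((1 + τ - 2 * z ^ 2) * polyP τ (N - 2) z +
          2 * z * (polyR τ (N - 2) z + τ * ((N : ℝ) - 2) * polyR τ (N - 3) z)) / (1 + q) +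
      polyP τ (N - 2) z * z ^ 2 / (1 + q) ^ 2 +
      τ ^ 2 * (1 + τ) ^ 2 * (N : ℝ) * ((N : ℝ) - 2) * polyP τ (N - 3) z / (1 + τ + q) ^ 2 +
      (1 + τ) * (1 - τ ^ 2) * ((N : ℝ) - 2) *
          (((N : ℝ) - 2) * polyP τ (N - 3) z - polyT τ (N - 3) z) / (1 + τ + q) -
      2 * τ * (1 + τ) * ((N : ℝ) - 2) * z * polyR τ (N - 3) z / ((1 + q) * (1 + τ + q)))

theorem scaledHe_eq {τ : ℝ} (hτ : 0 < τ) (k : ℕ) (z : ℝ) :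
    scaledHe τ k z = √τ ^ k * He k (z / √τ) := by
  have hs : √τ ≠ 0 := (Real.sqrt_pos.mpr hτ).ne'
  unfold scaledHe He
  rw [Polynomial.aeval_eq_sum_range, Polynomial.natDegree_hermite, Finset.mul_sum]
  refine Finset.sum_congr rfl fun j hj => ?_
  have hjk : j ≤ k := Nat.lt_succ_iff.mp (Finset.mem_range.mp hj)
  rcases Nat.even_or_odd (k + j) with he | ho
  · obtain ⟨m, hm⟩ : ∃ m, k = j + 2 * m := by
      obtain ⟨a, ha⟩ := he
      exact ⟨a - j, by omega⟩
    have h2 : (k - j) / 2 = m := by omega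
    have h3 : √τ ^ k = √τ ^ j * τ ^ m := by
      rw [hm, pow_add, pow_mul, Real.sq_sqrt hτ.le]
    rw [h2, h3, zsmul_eq_mul, div_pow]
    field_simp
  · simp [Polynomial.coeff_hermite_of_odd_add ho]

theorem scaledHe_zero (k : ℕ) (z : ℝ) : scaledHe 0 k z = z ^ k := by
  unfold scaledHe
  rw [Finset.sum_eq_single k]
  · simp [Polynomial.coeff_hermite_self]
  · intro j hj hne
    have hjk : j < k := by have := Finset.mem_range.mp hj; omega
    rcases Nat.even_or_odd (k + j) with he | ho
    · have : (k - j) / 2 ≠ 0 := by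
        obtain ⟨a, ha⟩ := he
        omega
      simp [this]
    · simp [Polynomial.coeff_hermite_of_odd_add ho]
  · simp

theorem polyP_eq {τ : ℝ} (hτ : 0 < τ) (m : ℕ) (z : ℝ) :
    polyP τ m z = (m ! : ℝ) * ∑ k ∈ Finset.range (m + 1), τ ^ k / (k ! : ℝ) *
      (((k : ℝ) + 1) * He k (z / √τ) ^ 2 -
        (k : ℝ) * He (k - 1) (z / √τ) * He (k + 1) (z / √τ)) := by
  have h2 : √τ ^ 2 = τ := Real.sq_sqrt hτ.le
  unfold polyP
  congr 1
  refine Finset.sum_congr rfl fun k _ => ?_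
  rcases k with _ | k
  · simp [scaledHe_eq hτ]
  · simp only [scaledHe_eq hτ, Nat.add_sub_cancel]
    nth_rewrite 7 [← h2]
    ring

theorem polyT_eq {τ : ℝ} (hτ : 0 < τ) (m : ℕ) (z : ℝ) :
    polyT τ m z = (m ! : ℝ) * ∑ k ∈ Finset.range (m + 1), (k : ℝ) * τ ^ k / (k ! : ℝ) *
      (((k : ℝ) + 1) * He k (z / √τ) ^ 2 -
        (k : ℝ) * He (k - 1) (z / √τ) * He (k + 1) (z / √τ)) := by
  have h2 : √τ ^ 2 = τ := Real.sq_sqrt hτ.le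
  unfold polyT
  congr 1
  refine Finset.sum_congr rfl fun k _ => ?_
  rcases k with _ | k
  · simp
  · simp only [scaledHe_eq hτ, Nat.add_sub_cancel]
    nth_rewrite 7 [← h2]
    ring

theorem polyR_eq {τ : ℝ} (hτ : 0 < τ) (m : ℕ) (z : ℝ) :
    polyR τ m z = (m ! : ℝ) / 2 * ∑ k ∈ Finset.range (m + 1),
      τ ^ ((k : ℝ) + 1 / 2) / (k ! : ℝ) *
      (((k : ℝ) + 2) * He (k + 1) (z / √τ) * He k (z / √τ) -
        (k : ℝ) * He (k + 2) (z / √τ) * He (k - 1) (z / √τ)) := by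
  have h2 : √τ ^ 2 = τ := Real.sq_sqrt hτ.le
  unfold polyR
  congr 1
  refine Finset.sum_congr rfl fun k _ => ?_
  have h3 : τ ^ ((k : ℝ) + 1 / 2) = √τ ^ (2 * k + 1) := by
    rw [Real.rpow_add hτ, Real.rpow_natCast, ← Real.sqrt_eq_rpow, pow_succ, pow_mul, h2]
  rw [h3]
  rcases k with _ | k
  · simp [scaledHe_eq hτ]
    ring
  · simp only [scaledHe_eq hτ, Nat.add_sub_cancel]
    ring

end EllipticEnsemble

end

open MeasureTheory
open scoped ENNReal Nat

namespace EllipticEnsemble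

open Matrix ProbabilityTheory

/-! Split X into its corner a, first row b, first column c and lower block D. Off the spectrum of D,
the Schur complement gives det(z - X) = det(z - D)(h - a) with h = z - b(z - D)⁻¹c, so z is an
eigenvalue exactly when the corner equals h. The one-dimensional area formula with parameters
(`lintegral_fiberSum`) therefore trades the corner for a free eigenvalue z at the price of |∂h/∂z|
(`lintegral_realEigenvalueSum`). This requires that almost every matrix has only simple real
eigenvalues, with det(z - D) ≠ 0 and ∂h/∂z ≠ 0 at each; that follows by induction on the size
together with Sard's theorem in dimension one (`ae_eigenvalue_mem_regularSet`).

Substituting c = (z - D)y and translating D by y bᵀ makes (1, y) the right eigenvector and turns the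
Jacobian into |det(z - D)| (`setLIntegral_regularSet`). By orthogonal invariance (1, y) may be
rotated to a multiple of the first basis vector, so X becomes block triangular with corner z, row w
and block D. Then y enters only through (1 + |y|²)^(-N/2), whose integral is half the area of the
unit sphere (`lintegral_eigenvector_fiber`, `lintegral_inv_sqrt_one_add`). The substitution w = u(z
- D) supplies a second factor |det(z - D)| and makes the squared condition number 1 + |u|², so q =
|u|²/(1 - τ); polar coordinates in u produce the power of q.

What remains is the expectation of det(z - D)² exp(-q|r|²/(2(1+τ))), with r the first row of z - D
and D elliptic of size N - 1. The elliptic law splits recursively: the corner, the row b, the vector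
c - τb and the lower block are independent, and the block is again elliptic
(`ellipticMeasure_succ`). The exponential weight only tilts the Gaussian laws of corner and row
(`lintegral_det_sq_tilt`). The second moment of the bordered determinant is then a combination of
four moments of the block of size N - 2, which `momentFormulas` evaluates by a simultaneous
induction matched to Hermite recurrences (`polyR_add`, `polyP_recurrence`, `polyS_succ`). The
constants collapse by the duplication formula for Γ (`constants_mul_eq_jointDensity`). -/

/-- The matrix with top left entry `a`, first row `(a, b)`, first column `(a, c)` and lower right
block `D`. -/
def bordered {n : ℕ} (a : ℝ) (b c : Fin n → ℝ) (D : Matrix (Fin n) (Fin n) ℝ) :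
    Matrix (Fin (n + 1)) (Fin (n + 1)) ℝ :=
  Matrix.of (Fin.cons (Fin.cons a b) fun i => Fin.cons (c i) (D i))

/-! ### Determinant and adjugate of bordered matrices -/

section bordered

variable {n : ℕ} (a : ℝ) (b c : Fin n → ℝ) (D : Matrix (Fin n) (Fin n) ℝ)

@[simp] theorem bordered_zero_zero : bordered a b c D 0 0 = a := rfl

@[simp] theorem bordered_zero_succ (j : Fin n) : bordered a b c D 0 j.succ = b j := rfl

@[simp] theorem bordered_succ_zero (i : Fin n) : bordered a b c D i.succ 0 = c i := rfl

@[simp] theorem bordered_succ_succ (i j : Fin n) : bordered a b c D i.succ j.succ = D i j := rfl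

theorem eq_bordered (X : Matrix (Fin (n + 1)) (Fin (n + 1)) ℝ) :
    X = bordered (X 0 0) (fun j => X 0 j.succ) (fun i => X i.succ 0)
      (X.submatrix Fin.succ Fin.succ) := by
  ext i j
  refine Fin.cases ?_ (fun i => ?_) i <;> refine Fin.cases ?_ (fun j => ?_) j <;> simp

theorem transpose_bordered : (bordered a b c D)ᵀ = bordered a c b Dᵀ := by
  ext i j
  refine Fin.cases ?_ (fun i => ?_) i <;> refine Fin.cases ?_ (fun j => ?_) j <;> simp

theorem smul_one_sub_bordered (z : ℝ) :
    z • (1 : Matrix (Fin (n + 1)) (Fin (n + 1)) ℝ) - bordered a b c D =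
      bordered (z - a) (-b) (-c) (z • 1 - D) := by
  ext i j
  refine Fin.cases ?_ (fun i => ?_) i <;> refine Fin.cases ?_ (fun j => ?_) j <;>
    simp [Matrix.one_apply, Fin.succ_ne_zero, (Fin.succ_ne_zero _).symm]

theorem bordered_mul (a' : ℝ) (b' c' : Fin n → ℝ) (D' : Matrix (Fin n) (Fin n) ℝ) :
    bordered a b c D * bordered a' b' c' D' =
      bordered (a * a' + b ⬝ᵥ c') (a • b' + b ᵥ* D') (a' • c + D *ᵥ c')
        (vecMulVec c b' + D * D') := by
  ext i j
  refine Fin.cases ?_ (fun i => ?_) i <;> refine Fin.cases ?_ (fun j => ?_) j <;>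
    simp [Matrix.mul_apply, Fin.sum_univ_succ, dotProduct, vecMul, mulVec, vecMulVec_apply,
      mul_comm]

theorem trace_bordered : trace (bordered a b c D) = a + trace D := by
  simp [trace, Fin.sum_univ_succ]

theorem bordered_mulVec_cons (x : ℝ) (y : Fin n → ℝ) :
    bordered a b c D *ᵥ (Fin.cons x y : Fin (n + 1) → ℝ) =
      (Fin.cons (a * x + b ⬝ᵥ y) (x • c + D *ᵥ y) : Fin (n + 1) → ℝ) := by
  ext i
  refine Fin.cases ?_ (fun i => ?_) i <;>
    simp [mulVec, dotProduct, Fin.sum_univ_succ, mul_comm]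

/-- By Cramer's rule the right side is the determinant of D with row k replaced by b. The minor on
the left has the same rows with b moved to the top, so the Laplace expansions of both along b agree
term by term. -/
theorem minor_bordered (k : Fin n) :
    (-1) ^ (k : ℕ) * ((bordered a b c D).submatrix k.succ.succAbove Fin.succ).det =
      (b ᵥ* D.adjugate) k := by
  have h1 : (b ᵥ* D.adjugate) k = (D.updateRow k b).det := by
    rw [← cramer_transpose_apply, cramer_eq_adjugate_mulVec, ← adjugate_transpose,
      mulVec_transpose]
  rw [h1]
  cases n with
  | zero => exact k.elim0
  | succ m =>
    rw [det_succ_row_zero, det_succ_row _ k, Finset.mul_sum]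
    refine Finset.sum_congr rfl fun j _ => ?_
    have h2 : ((bordered a b c D).submatrix k.succ.succAbove Fin.succ).submatrix Fin.succ
        j.succAbove = (D.updateRow k b).submatrix k.succAbove j.succAbove := by
      ext p q
      simp [Fin.succ_succAbove_succ]
    rw [h2]
    simp [pow_add]
    ring

theorem adjugate_bordered_zero_zero : (bordered a b c D).adjugate 0 0 = D.det := by
  rw [adjugate_fin_succ_eq_det_submatrix]
  have : (bordered a b c D).submatrix Fin.succ Fin.succ = D := by
    ext; simp
  simp [this]

theorem adjugate_bordered_zero_succ (j : Fin n) :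
    (bordered a b c D).adjugate 0 j.succ = -(b ᵥ* D.adjugate) j := by
  rw [adjugate_fin_succ_eq_det_submatrix, ← minor_bordered a b c D j]
  have : (Fin.succAbove (0 : Fin (n + 1))) = Fin.succ := by ext; simp
  simp [pow_succ, this]

/-- The Schur complement formula with denominators cleared, so that D may be singular; expansion
along column 0. -/
theorem det_bordered :
    (bordered a b c D).det = a * D.det - b ⬝ᵥ (D.adjugate *ᵥ c) := by
  rw [det_eq_sum_mul_adjugate_col _ 0, Fin.sum_univ_succ, adjugate_bordered_zero_zero,
    dotProduct_mulVec]
  simp [adjugate_bordered_zero_succ, dotProduct, sub_eq_add_neg, mul_comm]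

end bordered

/-! ### Recursive block structure of the elliptic law -/

/-- The quadratic form in the exponent of the elliptic density. -/
theorem trace_quadratic_bordered {n : ℕ} (τ a : ℝ) (b c : Fin n → ℝ)
    (D : Matrix (Fin n) (Fin n) ℝ) :
    trace (bordered a b c D * (bordered a b c D)ᵀ - τ • (bordered a b c D * bordered a b c D)) =
      (1 - τ) * a ^ 2 + b ⬝ᵥ b + c ⬝ᵥ c - 2 * τ * (b ⬝ᵥ c) + trace (D * Dᵀ - τ • (D * D)) := by
  rw [transpose_bordered, bordered_mul, bordered_mul, trace_sub, trace_smul, trace_bordered,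
    trace_bordered]
  simp only [trace_add, trace_vecMulVec, trace_sub, trace_smul, smul_eq_mul]
  rw [dotProduct_comm c b]
  ring

/-- Assembles a matrix from its corner, first row, first column and lower block. -/
def ofBlocks {n : ℕ} (p : ℝ × (Fin n → ℝ) × (Fin n → ℝ) × (Fin n → Fin n → ℝ)) :
    Fin (n + 1) → Fin (n + 1) → ℝ :=
  bordered p.1 p.2.1 p.2.2.1 (Matrix.of p.2.2.2)

/-- Assembles a matrix from its corner, first row, lower block, and the difference between the first
column and `τ` times the first row. -/
def assemble {n : ℕ} (τ : ℝ) (p : ℝ × (Fin n → ℝ) × (Fin n → ℝ) × (Fin n → Fin n → ℝ)) :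
    Fin (n + 1) → Fin (n + 1) → ℝ :=
  ofBlocks (p.1, p.2.1, τ • p.2.1 + p.2.2.1, p.2.2.2)

theorem measurePreserving_ofBlocks (n : ℕ) : MeasurePreserving (ofBlocks (n := n)) := by
  have e1 := (volume_preserving_piFinSuccAbove (fun _ : Fin (n + 1) => Fin (n + 1) → ℝ) 0).symm
  have e2 := (volume_preserving_piFinSuccAbove (fun _ : Fin (n + 1) => ℝ) 0).symm
  have e3 := (volume_measurePreserving_arrowProdEquivProdArrow ℝ (Fin n → ℝ) (Fin n)).symm
  have e4 := volume_preserving_pi (fun _ : Fin n => e2)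
  have e5 := (measurePreserving_prodAssoc (volume : Measure ℝ) (volume : Measure (Fin n → ℝ))
    (volume : Measure ((Fin n → ℝ) × (Fin n → Fin n → ℝ)))).symm
  have h := (e1.comp (e2.prod (e4.comp e3))).comp e5
  refine (congrArg (fun g => MeasurePreserving g volume volume) ?_).mpr h
  funext p
  ext i j
  refine Fin.cases ?_ (fun i => ?_) i <;> refine Fin.cases ?_ (fun j => ?_) j <;>
    rfl

/-- For fixed b the column is a translate of e by τb, so the change of coordinates is a shear and
has no Jacobian. -/
theorem measurePreserving_assemble {n : ℕ} (τ : ℝ) :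
    MeasurePreserving (assemble (n := n) τ) := by
  have h1 : MeasurePreserving (fun p : (Fin n → ℝ) × (Fin n → ℝ) × (Fin n → Fin n → ℝ) =>
      (p.1, (τ • p.1 + p.2.1, p.2.2))) := by
    refine (MeasurePreserving.id (volume : Measure (Fin n → ℝ))).skew_product (μd := volume)
      (g := fun b (p : (Fin n → ℝ) × (Fin n → Fin n → ℝ)) => (τ • b + p.1, p.2)) (by fun_prop) (ae_of_all _ fun b => ?_)
    exact ((measurePreserving_add_left volume (τ • b)).prod (MeasurePreserving.id volume)).map_eq
  exact (measurePreserving_ofBlocks n).comp ((MeasurePreserving.id volume).prod h1)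

/-- The centred Gaussian measure with independent coordinates of variance `v`. -/
noncomputable def gaussVec (n : ℕ) (v : ℝ) : Measure (Fin n → ℝ) :=
  Measure.pi fun _ => gaussianReal 0 v.toNNReal

instance (n : ℕ) (v : ℝ) : IsProbabilityMeasure (gaussVec n v) := by
  unfold gaussVec; infer_instance

theorem gaussianPDFReal_toNNReal {v : ℝ} (hv : 0 < v) (x : ℝ) :
    gaussianPDFReal 0 v.toNNReal x = (√(2 * Real.pi * v))⁻¹ * Real.exp (-(x * x) / (2 * v)) := by
  simp [gaussianPDFReal, hv.le, sq]

theorem prod_gaussianPDFReal {n : ℕ} {v : ℝ} (hv : 0 < v) (x : Fin n → ℝ) :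
    ∏ i, gaussianPDFReal 0 v.toNNReal (x i) =
      (√(2 * Real.pi * v))⁻¹ ^ n * Real.exp (-(x ⬝ᵥ x) / (2 * v)) := by
  simp only [gaussianPDFReal_toNNReal hv, Finset.prod_mul_distrib, ← Real.exp_sum]
  simp only [dotProduct, ← Finset.sum_div, Finset.sum_neg_distrib, Finset.prod_const,
    Finset.card_univ, Fintype.card_fin]

theorem gaussVec_eq_withDensity (n : ℕ) {v : ℝ} (hv : 0 < v) :
    gaussVec n v = volume.withDensity fun x => ENNReal.ofReal
      ((√(2 * Real.pi * v))⁻¹ ^ n * Real.exp (-(x ⬝ᵥ x) / (2 * v))) := by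
  have hv0 : v.toNNReal ≠ 0 := by simpa using hv
  simp only [← prod_gaussianPDFReal hv]
  refine Measure.pi_eq fun s hs => ?_
  have hint : Integrable fun x : Fin n → ℝ => ∏ i, gaussianPDFReal 0 v.toNNReal (x i) :=
    Integrable.fintype_prod fun _ => integrable_gaussianPDFReal 0 _
  rw [withDensity_apply _ (MeasurableSet.univ_pi hs),
    ← ofReal_integral_eq_lintegral_ofReal hint.integrableOn
      (ae_of_all _ fun x => Finset.prod_nonneg fun i _ => gaussianPDFReal_nonneg _ _ _)]
  -- The indicator of a box is the product of the indicators of its sides, so the integral factors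
  -- over the coordinates.
  have h1 : ∫ x in Set.univ.pi s, ∏ i, gaussianPDFReal 0 v.toNNReal (x i) =
      ∏ i, ∫ x in s i, gaussianPDFReal 0 v.toNNReal x := by
    rw [← integral_indicator (MeasurableSet.univ_pi hs)]
    simp_rw [← integral_indicator (hs _)]
    rw [← integral_fintype_prod_volume_eq_prod]
    congr 1
    ext x
    by_cases hx : x ∈ Set.univ.pi s
    · rw [Set.indicator_of_mem hx]
      exact Finset.prod_congr rfl fun i _ => (Set.indicator_of_mem (hx i trivial) _).symm
    · rw [Set.indicator_of_notMem hx]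
      obtain ⟨i, hi⟩ : ∃ i, x i ∉ s i := by simpa [Set.mem_pi] using hx
      exact (Finset.prod_eq_zero (Finset.mem_univ i) (Set.indicator_of_notMem hi _)).symm
  rw [h1, ENNReal.ofReal_prod_of_nonneg fun i _ =>
    integral_nonneg fun x => gaussianPDFReal_nonneg _ _ _]
  exact Finset.prod_congr rfl fun i _ => (gaussianReal_apply_eq_integral 0 hv0 (s i)).symm

theorem gaussianReal_eq_withDensity {v : ℝ} (hv : 0 < v) :
    gaussianReal 0 v.toNNReal = volume.withDensity fun x => ENNReal.ofReal
      ((√(2 * Real.pi * v))⁻¹ * Real.exp (-(x * x) / (2 * v))) := by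
  rw [gaussianReal_of_var_ne_zero _ (by simpa using hv)]
  congr 1
  ext x
  rw [gaussianPDF, gaussianPDFReal_toNNReal hv]

theorem continuous_ellipticPDF (n : ℕ) (τ : ℝ) :
    Continuous fun X : Fin n → Fin n → ℝ => ellipticPDF n τ (Matrix.of X) := by
  unfold ellipticPDF
  have : Continuous fun X : Fin n → Fin n → ℝ => Matrix.of X := continuous_id
  fun_prop

/-- Completing the square: with c = τb + e one has |b|² + |c|² - 2τ b·c = (1 - τ²)|b|² + |e|². The
cross term disappears, so corner, row, e and lower block are independent, and the block has the
elliptic density of size n. -/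
theorem ellipticPDF_assemble {n : ℕ} {τ : ℝ} (h0 : 0 ≤ τ) (h1 : τ < 1) (a : ℝ)
    (b e : Fin n → ℝ) (D : Matrix (Fin n) (Fin n) ℝ) :
    ellipticPDF (n + 1) τ (bordered a b (τ • b + e) D) =
      (√(2 * Real.pi * (1 + τ)))⁻¹ * Real.exp (-(a * a) / (2 * (1 + τ))) *
      ((√(2 * Real.pi * 1))⁻¹ ^ n * Real.exp (-(b ⬝ᵥ b) / (2 * 1)) *
      ((√(2 * Real.pi * (1 - τ ^ 2)))⁻¹ ^ n * Real.exp (-(e ⬝ᵥ e) / (2 * (1 - τ ^ 2))) *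
        ellipticPDF n τ D)) := by
  have hp : 0 < 1 - τ ^ 2 := by nlinarith
  have hq : 0 < 1 + τ := by linarith
  unfold ellipticPDF
  rw [trace_quadratic_bordered]
  set T := trace (D * Dᵀ - τ • (D * D))
  have hdot : (τ • b + e) ⬝ᵥ (τ • b + e) - 2 * τ * (b ⬝ᵥ (τ • b + e)) =
      e ⬝ᵥ e - τ ^ 2 * (b ⬝ᵥ b) := by
    simp only [dotProduct_add, add_dotProduct, smul_dotProduct, dotProduct_smul, smul_eq_mul]
    rw [dotProduct_comm e b]
    ring
  have hexp : Real.exp (-(1 / (2 * (1 - τ ^ 2))) * ((1 - τ) * a ^ 2 + b ⬝ᵥ b +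
      (τ • b + e) ⬝ᵥ (τ • b + e) - 2 * τ * (b ⬝ᵥ (τ • b + e)) + T)) =
      Real.exp (-(a * a) / (2 * (1 + τ))) * (Real.exp (-(b ⬝ᵥ b) / (2 * 1)) *
      (Real.exp (-(e ⬝ᵥ e) / (2 * (1 - τ ^ 2))) * Real.exp (-(1 / (2 * (1 - τ ^ 2))) * T))) := by
    rw [← Real.exp_add, ← Real.exp_add, ← Real.exp_add]
    congr 1
    have : (1 - τ) * a ^ 2 + b ⬝ᵥ b + (τ • b + e) ⬝ᵥ (τ • b + e) -
        2 * τ * (b ⬝ᵥ (τ • b + e)) + T =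
        (1 - τ) * a ^ 2 + b ⬝ᵥ b + (e ⬝ᵥ e - τ ^ 2 * (b ⬝ᵥ b)) + T := by rw [← hdot]; ring
    rw [this]
    have h3 : 1 - τ ^ 2 = (1 - τ) * (1 + τ) := by ring
    have h4 : (1 - τ) ≠ 0 := by linarith
    rw [h3]
    field_simp
    ring
  -- The normalising constants multiply because their exponents telescope, e.g. (n+1)²/2 = 1/2 + n/2
  -- + n/2 + n²/2.
  have hconst : (2 * Real.pi) ^ (((n + 1 : ℕ) : ℝ) ^ 2 / 2) * (1 + τ) ^ (((n + 1 : ℕ) : ℝ) / 2) *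
      (1 - τ ^ 2) ^ (((n + 1 : ℕ) : ℝ) * (((n + 1 : ℕ) : ℝ) - 1) / 4) =
      √(2 * Real.pi * (1 + τ)) * (√(2 * Real.pi * 1) ^ n * (√(2 * Real.pi * (1 - τ ^ 2)) ^ n *
      ((2 * Real.pi) ^ ((n : ℝ) ^ 2 / 2) * (1 + τ) ^ ((n : ℝ) / 2) *
      (1 - τ ^ 2) ^ ((n : ℝ) * ((n : ℝ) - 1) / 4)))) := by
    have hpi : 0 < 2 * Real.pi := by positivity
    rw [mul_one, Real.sqrt_mul hpi.le, Real.sqrt_mul hpi.le, mul_pow]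
    have hs : ∀ x : ℝ, 0 < x → √x ^ n = x ^ (1 / 2 * (n : ℝ)) := fun x hx => by
      rw [Real.sqrt_eq_rpow, ← Real.rpow_natCast, ← Real.rpow_mul hx.le]
    rw [hs _ hpi, hs _ hp, Real.sqrt_eq_rpow, Real.sqrt_eq_rpow]
    have e1 : (((n + 1 : ℕ) : ℝ) ^ 2 / 2) = 1 / 2 + (1 / 2 * (n : ℝ) + (1 / 2 * (n : ℝ) +
        (n : ℝ) ^ 2 / 2)) := by push_cast; ring
    have e2 : (((n + 1 : ℕ) : ℝ) / 2) = 1 / 2 + (n : ℝ) / 2 := by push_cast; ring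
    have e3 : ((n + 1 : ℕ) : ℝ) * (((n + 1 : ℕ) : ℝ) - 1) / 4 =
        1 / 2 * (n : ℝ) + (n : ℝ) * ((n : ℝ) - 1) / 4 := by push_cast; ring
    rw [e1, e2, e3]
    simp only [Real.rpow_add hpi, Real.rpow_add hp, Real.rpow_add hq]
    ring
  rw [hexp, hconst]
  simp only [mul_inv, inv_pow]
  ring

theorem ellipticMeasure_succ (n : ℕ) {τ : ℝ} (h0 : 0 ≤ τ) (h1 : τ < 1) :
    ellipticMeasure (n + 1) τ =
      ((gaussianReal 0 (1 + τ).toNNReal).prod ((gaussVec n 1).prod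
        ((gaussVec n (1 - τ ^ 2)).prod (ellipticMeasure n τ)))).map (assemble τ) := by
  have hp : 0 < 1 - τ ^ 2 := by nlinarith
  have hq : 0 < 1 + τ := by linarith
  have hm : Measurable fun X : Fin n → Fin n → ℝ =>
      ENNReal.ofReal (ellipticPDF n τ (Matrix.of X)) :=
    (continuous_ellipticPDF n τ).measurable.ennreal_ofReal
  have hg : ∀ (c v : ℝ), Measurable fun x : Fin n → ℝ =>
      ENNReal.ofReal (c * Real.exp (-(x ⬝ᵥ x) / (2 * v))) := by
    intro c v
    simp only [dotProduct]
    fun_prop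
  have hm2 : Measurable fun z : (Fin n → ℝ) × (Fin n → Fin n → ℝ) =>
      ENNReal.ofReal ((√(2 * Real.pi * (1 - τ ^ 2)))⁻¹ ^ n *
        Real.exp (-(z.1 ⬝ᵥ z.1) / (2 * (1 - τ ^ 2)))) *
      ENNReal.ofReal (ellipticPDF n τ (Matrix.of z.2)) :=
    ((hg _ _).comp measurable_fst).mul (hm.comp measurable_snd)
  have hm3 : Measurable fun z : (Fin n → ℝ) × (Fin n → ℝ) × (Fin n → Fin n → ℝ) =>
      ENNReal.ofReal ((√(2 * Real.pi * 1))⁻¹ ^ n * Real.exp (-(z.1 ⬝ᵥ z.1) / (2 * 1))) *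
      (ENNReal.ofReal ((√(2 * Real.pi * (1 - τ ^ 2)))⁻¹ ^ n *
        Real.exp (-(z.2.1 ⬝ᵥ z.2.1) / (2 * (1 - τ ^ 2)))) *
      ENNReal.ofReal (ellipticPDF n τ (Matrix.of z.2.2))) :=
    ((hg _ _).comp measurable_fst).mul (hm2.comp measurable_snd)
  rw [gaussianReal_eq_withDensity hq, gaussVec_eq_withDensity n one_pos,
    gaussVec_eq_withDensity n hp]
  simp only [ellipticMeasure]
  rw [prod_withDensity (hg _ _) hm, prod_withDensity (hg _ _) hm2,
    prod_withDensity (by fun_prop) hm3]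
  have hdens : (fun z : ℝ × (Fin n → ℝ) × (Fin n → ℝ) × (Fin n → Fin n → ℝ) =>
      ENNReal.ofReal ((√(2 * Real.pi * (1 + τ)))⁻¹ * Real.exp (-(z.1 * z.1) / (2 * (1 + τ)))) *
      (ENNReal.ofReal ((√(2 * Real.pi * 1))⁻¹ ^ n * Real.exp (-(z.2.1 ⬝ᵥ z.2.1) / (2 * 1))) *
      (ENNReal.ofReal ((√(2 * Real.pi * (1 - τ ^ 2)))⁻¹ ^ n *
        Real.exp (-(z.2.2.1 ⬝ᵥ z.2.2.1) / (2 * (1 - τ ^ 2)))) *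
        ENNReal.ofReal (ellipticPDF n τ (Matrix.of z.2.2.2))))) =
      fun z => ENNReal.ofReal (ellipticPDF (n + 1) τ (Matrix.of (assemble τ z))) := by
    funext z
    rw [← ENNReal.ofReal_mul (by positivity), ← ENNReal.ofReal_mul (by positivity),
      ← ENNReal.ofReal_mul (by positivity)]
    congr 1
    exact (ellipticPDF_assemble h0 h1 _ _ _ _).symm
  rw [hdens]
  ext s hs
  have hA := measurePreserving_assemble (n := n) τ
  rw [Measure.map_apply hA.measurable hs, withDensity_apply _ hs,
    withDensity_apply _ (hA.measurable hs), ← hA.map_eq,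
    setLIntegral_map hs (continuous_ellipticPDF (n + 1) τ).measurable.ennreal_ofReal hA.measurable]
  rfl

theorem ellipticMeasure_zero (τ : ℝ) : ellipticMeasure 0 τ = Measure.dirac 0 := by
  have : (fun X : Fin 0 → Fin 0 → ℝ => ENNReal.ofReal (ellipticPDF 0 τ (Matrix.of X))) = 1 := by
    funext X
    simp [ellipticPDF]
  rw [ellipticMeasure, this, withDensity_one, volume_pi, Measure.pi_of_empty _ 0]

/-- The recursion exhibits the law as an image of a product of probability measures, so the constant
C_N is correct without evaluating any matrix integral. -/
theorem isProbabilityMeasure_ellipticMeasure (n : ℕ) {τ : ℝ} (h0 : 0 ≤ τ) (h1 : τ < 1) :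
    IsProbabilityMeasure (ellipticMeasure n τ) := by
  induction n with
  | zero => rw [ellipticMeasure_zero]; infer_instance
  | succ n ih =>
    rw [ellipticMeasure_succ n h0 h1]
    exact Measure.isProbabilityMeasure_map (measurePreserving_assemble τ).measurable.aemeasurable

/-! ### Random variables with all moments -/

/-- All absolute moments of `f` under `μ` are finite. -/
def HasMoments {α : Type*} [MeasurableSpace α] (μ : Measure α) (f : α → ℝ) : Prop :=
  ∀ p : ℕ, MemLp f p μ

namespace HasMoments

variable {α β : Type*} [MeasurableSpace α] [MeasurableSpace β] {μ : Measure α} {ν : Measure β}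
  {f g : α → ℝ}

theorem integrable (hf : HasMoments μ f) : Integrable f μ :=
  memLp_one_iff_integrable.mp (by simpa using hf 1)

theorem const [IsFiniteMeasure μ] (c : ℝ) : HasMoments μ fun _ => c :=
  fun _ => memLp_const c

theorem add (hf : HasMoments μ f) (hg : HasMoments μ g) : HasMoments μ fun x => f x + g x :=
  fun p => (hf p).add (hg p)

theorem sub (hf : HasMoments μ f) (hg : HasMoments μ g) : HasMoments μ fun x => f x - g x :=
  fun p => (hf p).sub (hg p)

theorem const_mul (c : ℝ) (hf : HasMoments μ f) : HasMoments μ fun x => c * f x :=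
  fun p => (hf p).const_mul c

/-- Hölder's inequality with exponents 2p and 2p. Asking for every p at once makes the class an
algebra; it therefore contains determinants and adjugates of Gaussian matrices, which settles the
integrability conditions of the moment computations. -/
theorem mul (hf : HasMoments μ f) (hg : HasMoments μ g) : HasMoments μ fun x => f x * g x := by
  intro p
  have h : ENNReal.HolderTriple ((2 * p : ℕ) : ℝ≥0∞) ((2 * p : ℕ) : ℝ≥0∞) (p : ℝ≥0∞) := by
    constructor
    rcases eq_or_ne p 0 with rfl | hp
    · simp
    · push_cast
      rw [ENNReal.mul_inv (by simp) (by simp), ← add_mul, ENNReal.inv_two_add_inv_two, one_mul]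
  exact (hg (2 * p)).mul' (hf (2 * p))

theorem pow [IsFiniteMeasure μ] (hf : HasMoments μ f) (k : ℕ) :
    HasMoments μ fun x => f x ^ k := by
  induction k with
  | zero => simpa using const (μ := μ) 1
  | succ k ih => simpa only [pow_succ] using ih.mul hf

theorem sum {ι : Type*} (s : Finset ι) {F : ι → α → ℝ} (h : ∀ i ∈ s, HasMoments μ (F i)) :
    HasMoments μ fun x => ∑ i ∈ s, F i x :=
  fun p => memLp_finsetSum s fun i hi => h i hi p

theorem prod [IsFiniteMeasure μ] {ι : Type*} (s : Finset ι) {F : ι → α → ℝ}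
    (h : ∀ i ∈ s, HasMoments μ (F i)) : HasMoments μ fun x => ∏ i ∈ s, F i x := by
  classical
  induction s using Finset.induction_on with
  | empty => simpa using const (μ := μ) 1
  | insert i s hi ih =>
    simp only [Finset.prod_insert hi]
    exact (h i (Finset.mem_insert_self i s)).mul
      (ih fun j hj => h j (Finset.mem_insert_of_mem hj))

theorem comp_fst [IsFiniteMeasure ν] (hf : HasMoments μ f) :
    HasMoments (μ.prod ν) fun p => f p.1 :=
  fun p => (hf p).comp_fst ν

theorem comp_snd [SFinite ν] [IsFiniteMeasure μ] {f : β → ℝ} (hf : HasMoments ν f) :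
    HasMoments (μ.prod ν) fun p => f p.2 :=
  fun p => (hf p).comp_snd μ

theorem dotProduct {n : ℕ} {F G : α → Fin n → ℝ} (hF : ∀ i, HasMoments μ fun x => F x i)
    (hG : ∀ i, HasMoments μ fun x => G x i) : HasMoments μ fun x => F x ⬝ᵥ G x :=
  HasMoments.sum _ fun i _ => (hF i).mul (hG i)

theorem det [IsFiniteMeasure μ] {n : ℕ} {A : α → Matrix (Fin n) (Fin n) ℝ}
    (hA : ∀ i j, HasMoments μ fun x => A x i j) : HasMoments μ fun x => (A x).det := by
  simp only [det_apply']
  exact HasMoments.sum _ fun σ _ => (HasMoments.const _).mul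
    (HasMoments.prod _ fun i _ => hA _ _)

theorem adjugate [IsFiniteMeasure μ] {n : ℕ} {A : α → Matrix (Fin n) (Fin n) ℝ}
    (hA : ∀ i j, HasMoments μ fun x => A x i j) (i j : Fin n) :
    HasMoments μ fun x => (A x).adjugate i j := by
  simp only [adjugate_apply]
  refine HasMoments.det fun k l => ?_
  by_cases hk : k = j
  · subst hk
    simpa using HasMoments.const (μ := μ) _
  · simpa [updateRow_ne hk] using hA k l

theorem of_map {t : α → β} (ht : Measurable t) {f : β → ℝ} (hf : Measurable f)
    (h : HasMoments μ fun x => f (t x)) : HasMoments (μ.map t) f :=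
  fun p => (memLp_map_measure_iff hf.aestronglyMeasurable ht.aemeasurable).mpr (h p)

end HasMoments

theorem hasMoments_gaussianReal (m : ℝ) (v : NNReal) : HasMoments (gaussianReal m v) fun x => x :=
  fun p => memLp_id_gaussianReal' p (by simp)

theorem hasMoments_gaussVec (n : ℕ) (v : ℝ) (i : Fin n) :
    HasMoments (gaussVec n v) fun x => x i := fun p =>
  (hasMoments_gaussianReal 0 v.toNNReal p).comp_measurePreserving
    (measurePreserving_eval (fun _ : Fin n => gaussianReal 0 v.toNNReal) i)

theorem hasMoments_ellipticMeasure (n : ℕ) {τ : ℝ} (h0 : 0 ≤ τ) (h1 : τ < 1) (i j : Fin n) :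
    HasMoments (ellipticMeasure n τ) fun X => X i j := by
  induction n with
  | zero => exact i.elim0
  | succ n ih =>
    have := isProbabilityMeasure_ellipticMeasure n h0 h1
    rw [ellipticMeasure_succ n h0 h1]
    refine HasMoments.of_map (measurePreserving_assemble τ).measurable (by fun_prop) ?_
    refine Fin.cases ?_ (fun i => ?_) i <;> refine Fin.cases ?_ (fun j => ?_) j
    · exact (hasMoments_gaussianReal _ _).comp_fst
    · exact ((hasMoments_gaussVec n 1 j).comp_fst).comp_snd
    · exact (((hasMoments_gaussVec n 1 i).comp_fst).const_mul τ |>.add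
        (((hasMoments_gaussVec n _ i).comp_fst).comp_snd)).comp_snd
    · exact ((ih i j).comp_snd.comp_snd).comp_snd

/-! ### Second and fourth moments of Gaussian vectors -/

section gaussVec

variable (n : ℕ) {v : ℝ}

theorem integral_sq_gaussianReal (hv : 0 ≤ v) :
    ∫ x, x ^ 2 ∂gaussianReal 0 v.toNNReal = v := by
  have h := variance_id_gaussianReal (μ := 0) (v := v.toNNReal)
  rw [variance_eq_integral (by fun_prop)] at h
  simpa [hv] using h

theorem integral_pow_four_gaussianReal (hv : 0 < v) :
    ∫ x, x ^ 4 ∂gaussianReal 0 v.toNNReal = 3 * v ^ 2 := by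
  rw [integral_gaussianReal_eq_integral_smul (by simpa using hv)]
  simp only [gaussianPDFReal_toNNReal hv, smul_eq_mul]
  have h1 := integral_comp_abs (f := fun x : ℝ => x ^ (4 : ℝ) *
    Real.exp (-(1 / (2 * v)) * x ^ (2 : ℝ)))
  rw [integral_rpow_mul_exp_neg_mul_rpow (by norm_num) (by norm_num) (by positivity)] at h1
  -- The integrand is written as a function of |x|, so the integral over the line is twice a
  -- Γ-integral over the half line, here with Γ(5/2).
  have h2 : ∀ x : ℝ, (√(2 * Real.pi * v))⁻¹ * Real.exp (-(x * x) / (2 * v)) * x ^ 4 =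
      (√(2 * Real.pi * v))⁻¹ *
        (|x| ^ (4 : ℝ) * Real.exp (-(1 / (2 * v)) * |x| ^ (2 : ℝ))) := by
    intro x
    have e4 : |x| ^ (4 : ℝ) = x ^ 4 := by
      rw [show (4 : ℝ) = ((4 : ℕ) : ℝ) by norm_num, Real.rpow_natCast]
      exact (by decide : Even 4).pow_abs x
    have e2 : |x| ^ (2 : ℝ) = x * x := by
      rw [show (2 : ℝ) = ((2 : ℕ) : ℝ) by norm_num, Real.rpow_natCast, sq_abs, sq]
    rw [e4, e2]
    have : -(x * x) / (2 * v) = -(1 / (2 * v)) * (x * x) := by ring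
    rw [this]
    ring
  simp only [h2]
  rw [integral_const_mul, h1]
  have hG : Real.Gamma ((4 + 1) / 2) = 3 / 4 * √Real.pi := by
    rw [show ((4 : ℝ) + 1) / 2 = 3 / 2 + 1 by norm_num, Real.Gamma_add_one (by norm_num),
      show (3 : ℝ) / 2 = 1 / 2 + 1 by norm_num, Real.Gamma_add_one (by norm_num),
      Real.Gamma_one_half_eq]
    ring
  rw [hG]
  have hr : (1 / (2 * v)) ^ (-(4 + 1) / 2 : ℝ) = (2 * v) ^ 2 * √(2 * v) := by
    rw [one_div, Real.inv_rpow (by positivity), ← Real.rpow_neg (by positivity),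
      show -(-(4 + 1) / 2 : ℝ) = ((2 : ℕ) : ℝ) + 1 / 2 by norm_num, Real.rpow_add (by positivity),
      Real.rpow_natCast, ← Real.sqrt_eq_rpow]
  rw [hr, show 2 * Real.pi * v = Real.pi * (2 * v) by ring, Real.sqrt_mul Real.pi_pos.le]
  have : √Real.pi ≠ 0 := by positivity
  have : √(2 * v) ≠ 0 := by positivity
  field_simp
  ring

theorem integral_eval_gaussVec {f : ℝ → ℝ} (hf : Measurable f) (i : Fin n) :
    ∫ x, f (x i) ∂gaussVec n v = ∫ x, f x ∂gaussianReal 0 v.toNNReal :=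
  integral_comp_eval (μ := fun _ : Fin n => gaussianReal 0 v.toNNReal) hf.aestronglyMeasurable

theorem integral_eval_mul_gaussVec {f : ℝ → ℝ} (hf : Measurable f) {i j : Fin n} (hij : i ≠ j) :
    ∫ x, f (x i) * f (x j) ∂gaussVec n v = (∫ x, f x ∂gaussianReal 0 v.toNNReal) ^ 2 := by
  have h := (iIndepFun_pi (μ := fun _ : Fin n => gaussianReal 0 v.toNNReal)
    (X := fun _ => f) fun _ => hf.aemeasurable).indepFun hij
  have := h.integral_fun_mul_eq_mul_integral
    (hf.comp (measurable_pi_apply i)).aestronglyMeasurable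
    (hf.comp (measurable_pi_apply j)).aestronglyMeasurable
  calc _ = (∫ x, f (x i) ∂gaussVec n v) * ∫ x, f (x j) ∂gaussVec n v := this
    _ = _ := by rw [integral_eval_gaussVec n hf i, integral_eval_gaussVec n hf j, sq]

theorem integral_dotProduct_gaussVec (w : Fin n → ℝ) : ∫ x, w ⬝ᵥ x ∂gaussVec n v = 0 := by
  simp only [dotProduct]
  rw [integral_finsetSum _ fun i _ => ((hasMoments_gaussVec n v i).const_mul _).integrable]
  refine Finset.sum_eq_zero fun i _ => ?_
  rw [integral_const_mul, integral_eval_gaussVec n measurable_id' i]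
  simp

theorem integral_coord_mul_coord_gaussVec (hv : 0 ≤ v) (i j : Fin n) :
    ∫ x, x i * x j ∂gaussVec n v = if i = j then v else 0 := by
  split_ifs with h
  · subst h
    simp only [← sq]
    rw [integral_eval_gaussVec n (f := fun x => x ^ 2) (by fun_prop), integral_sq_gaussianReal hv]
  · rw [integral_eval_mul_gaussVec n measurable_id' h]
    simp

theorem integral_dotProduct_sq_gaussVec (hv : 0 ≤ v) (w : Fin n → ℝ) :
    ∫ x, (w ⬝ᵥ x) ^ 2 ∂gaussVec n v = v * (w ⬝ᵥ w) := by
  have h : ∀ x : Fin n → ℝ, (w ⬝ᵥ x) ^ 2 = ∑ i, ∑ j, w i * w j * (x i * x j) := fun x => by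
    simp only [dotProduct, sq, Finset.sum_mul_sum]
    exact Finset.sum_congr rfl fun i _ => Finset.sum_congr rfl fun j _ => by ring
  have hm : ∀ i j, HasMoments (gaussVec n v) fun x => w i * w j * (x i * x j) := fun i j =>
    ((hasMoments_gaussVec n v i).mul (hasMoments_gaussVec n v j)).const_mul _
  simp only [h]
  rw [integral_finsetSum _ fun i _ => (HasMoments.sum _ fun j _ => hm i j).integrable,
    dotProduct, Finset.mul_sum]
  refine Finset.sum_congr rfl fun i _ => ?_
  rw [integral_finsetSum _ fun j _ => (hm i j).integrable]
  simp only [integral_const_mul, integral_coord_mul_coord_gaussVec n hv]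
  simp
  ring

theorem integral_normSq_gaussVec (hv : 0 ≤ v) : ∫ x, x ⬝ᵥ x ∂gaussVec n v = n * v := by
  simp only [dotProduct]
  rw [integral_finsetSum _ fun i _ =>
    ((hasMoments_gaussVec n v i).mul (hasMoments_gaussVec n v i)).integrable]
  simp [integral_coord_mul_coord_gaussVec n hv]

theorem integral_normSq_sq_gaussVec (hv : 0 < v) :
    ∫ x, (x ⬝ᵥ x) ^ 2 ∂gaussVec n v = n * (n + 2) * v ^ 2 := by
  have h : ∀ x : Fin n → ℝ, (x ⬝ᵥ x) ^ 2 = ∑ i, ∑ j, x i ^ 2 * x j ^ 2 := fun x => by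
    simp only [dotProduct, ← sq]
    rw [sq, Finset.sum_mul_sum]
  have hm : ∀ i j, HasMoments (gaussVec n v) fun x => x i ^ 2 * x j ^ 2 := fun i j =>
    ((hasMoments_gaussVec n v i).pow 2).mul ((hasMoments_gaussVec n v j).pow 2)
  -- The diagonal value 3v² is split as v² + 2v², so the double sum is n²v² + 2nv².
  have hI : ∀ i j, ∫ x, x i ^ 2 * x j ^ 2 ∂gaussVec n v =
      v ^ 2 + if i = j then 2 * v ^ 2 else 0 := by
    intro i j
    split_ifs with hij
    · subst hij
      simp only [← pow_add]
      rw [integral_eval_gaussVec n (f := fun x => x ^ (2 + 2)) (by fun_prop),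
        integral_pow_four_gaussianReal hv]
      ring
    · rw [integral_eval_mul_gaussVec n (f := fun x => x ^ 2) (by fun_prop) hij,
        integral_sq_gaussianReal hv.le, add_zero]
  simp only [h]
  rw [integral_finsetSum _ fun i _ => (HasMoments.sum _ fun j _ => hm i j).integrable]
  simp_rw [integral_finsetSum _ fun j _ => (hm _ j).integrable, hI]
  simp [Finset.sum_add_distrib]
  ring

end gaussVec

/-! ### Invariance under conjugation, and reflections -/

/-- Conjugation of matrices by `K`, on the space of arrays. -/
noncomputable def conjBy {n : ℕ} (K : Matrix (Fin n) (Fin n) ℝ) (Y : Fin n → Fin n → ℝ) :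
    Fin n → Fin n → ℝ :=
  K * Matrix.of Y * K⁻¹

/-- Right multiplication as a linear map on arrays. -/
noncomputable def mulRightArray {n : ℕ} (K : Matrix (Fin n) (Fin n) ℝ) :
    (Fin n → Fin n → ℝ) →ₗ[ℝ] (Fin n → Fin n → ℝ) :=
  LinearMap.pi fun i => (Matrix.toLin' Kᵀ).comp (LinearMap.proj i)

theorem mulRightArray_apply {n : ℕ} (K : Matrix (Fin n) (Fin n) ℝ) (Y : Fin n → Fin n → ℝ) :
    mulRightArray K Y = (Matrix.of Y * K : Matrix _ _ ℝ) := by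
  ext i j
  simp [mulRightArray, Matrix.mul_apply, Matrix.mulVec, dotProduct, mul_comm]

theorem det_mulRightArray {n : ℕ} (K : Matrix (Fin n) (Fin n) ℝ) :
    LinearMap.det (mulRightArray K) = K.det ^ n := by
  rw [mulRightArray, LinearMap.det_pi]
  simp

/-- Transposition of arrays. -/
def transposeArray (n : ℕ) : (Fin n → Fin n → ℝ) ≃ₗ[ℝ] (Fin n → Fin n → ℝ) where
  toFun Y i j := Y j i
  invFun Y i j := Y j i
  map_add' _ _ := rfl
  map_smul' _ _ := rfl

/-- Right multiplication acts separately on the n rows and has determinant det(K⁻¹)^n; left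
multiplication is the same after transposition, with determinant det(K)^n. The two cancel. -/
theorem measurePreserving_conjBy {n : ℕ} {K : Matrix (Fin n) (Fin n) ℝ} (hK : K.det ≠ 0) :
    MeasurePreserving (conjBy K) := by
  let f : (Fin n → Fin n → ℝ) →ₗ[ℝ] (Fin n → Fin n → ℝ) :=
    (((transposeArray n : (Fin n → Fin n → ℝ) →ₗ[ℝ] (Fin n → Fin n → ℝ)) ∘ₗ mulRightArray Kᵀ ∘ₗ
      ((transposeArray n).symm : (Fin n → Fin n → ℝ) →ₗ[ℝ] (Fin n → Fin n → ℝ)))) ∘ₗ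
      mulRightArray K⁻¹
  have hf : ⇑f = conjBy K := by
    funext Y
    have : f Y = (((Matrix.of Y * K⁻¹)ᵀ * Kᵀ)ᵀ : Matrix _ _ ℝ) := by
      change transposeArray n (mulRightArray Kᵀ ((transposeArray n).symm (mulRightArray K⁻¹ Y))) = _
      rw [mulRightArray_apply, mulRightArray_apply]
      rfl
    rw [this, Matrix.transpose_mul, Matrix.transpose_transpose, Matrix.transpose_transpose,
      conjBy, Matrix.mul_assoc]
  have hdet : LinearMap.det f = 1 := by
    simp only [f]
    rw [LinearMap.det_comp, LinearMap.det_conj, det_mulRightArray, det_mulRightArray, det_transpose,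
      ← mul_pow, det_nonsing_inv, Ring.mul_inverse_cancel _ (Ne.isUnit hK), one_pow]
  refine ⟨?_, ?_⟩
  · rw [← hf]
    exact f.continuous_of_finiteDimensional.measurable
  · rw [← hf, Measure.map_linearMap_addHaar_eq_smul_addHaar _ (by rw [hdet]; exact one_ne_zero),
      hdet]
    simp

section orthogonal

variable {n : ℕ} {O : Matrix (Fin n) (Fin n) ℝ}

theorem inv_eq_transpose_of_orthogonal (hO : O * Oᵀ = 1) : O⁻¹ = Oᵀ :=
  Matrix.inv_eq_right_inv hO

theorem det_ne_zero_of_orthogonal (hO : O * Oᵀ = 1) : O.det ≠ 0 := by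
  intro h
  have := congrArg Matrix.det hO
  simp [h] at this

theorem abs_det_of_orthogonal (hO : O * Oᵀ = 1) : |O.det| = 1 := by
  have := congrArg Matrix.det hO
  rw [det_mul, det_transpose, det_one, ← sq] at this
  rw [← abs_one, ← sq_eq_sq_iff_abs_eq_abs, this, one_pow]

theorem ellipticPDF_conj (τ : ℝ) (hO : O * Oᵀ = 1) (X : Matrix (Fin n) (Fin n) ℝ) :
    ellipticPDF n τ (O * X * Oᵀ) = ellipticPDF n τ X := by
  have hO' : Oᵀ * O = 1 := mul_eq_one_comm.mp hO
  have key : ∀ Z : Matrix (Fin n) (Fin n) ℝ, O * X * Oᵀ * (O * Z * Oᵀ) = O * (X * Z) * Oᵀ := by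
    intro Z
    calc O * X * Oᵀ * (O * Z * Oᵀ) = O * X * (Oᵀ * O) * Z * Oᵀ := by simp only [Matrix.mul_assoc]
      _ = _ := by rw [hO', Matrix.mul_one, Matrix.mul_assoc O X Z]
  have ht : ∀ Z : Matrix (Fin n) (Fin n) ℝ, trace (O * Z * Oᵀ) = trace Z := by
    intro Z
    rw [trace_mul_comm, ← Matrix.mul_assoc, hO', Matrix.one_mul]
  have h1 : (O * X * Oᵀ)ᵀ = O * Xᵀ * Oᵀ := by
    simp only [transpose_mul, transpose_transpose, Matrix.mul_assoc]
  unfold ellipticPDF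
  rw [h1, key, key, trace_sub, trace_smul, ht, ht, ← trace_smul, ← trace_sub]

theorem measurePreserving_conjBy_ellipticMeasure (τ : ℝ) (hO : O * Oᵀ = 1) :
    MeasurePreserving (conjBy O) (ellipticMeasure n τ) (ellipticMeasure n τ) := by
  have hV := measurePreserving_conjBy (det_ne_zero_of_orthogonal hO)
  refine ⟨hV.measurable, ?_⟩
  ext s hs
  have hm := (continuous_ellipticPDF n τ).measurable.ennreal_ofReal
  rw [Measure.map_apply hV.measurable hs, ellipticMeasure, withDensity_apply _ hs,
    withDensity_apply _ (hV.measurable hs)]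
  nth_rewrite 2 [← hV.map_eq]
  rw [setLIntegral_map hs hm hV.measurable]
  refine lintegral_congr fun X => ?_
  congr 1
  have : Matrix.of (conjBy O X) = O * Matrix.of X * Oᵀ := by
    rw [← inv_eq_transpose_of_orthogonal hO]; rfl
  rw [this, ellipticPDF_conj τ hO]

theorem smul_one_sub_conj (hO : O * Oᵀ = 1) (z : ℝ) (X : Matrix (Fin n) (Fin n) ℝ) :
    z • 1 - O * X * Oᵀ = O * (z • 1 - X) * Oᵀ := by
  rw [Matrix.mul_sub, Matrix.sub_mul, Matrix.mul_smul, Matrix.smul_mul, Matrix.mul_one, hO]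

theorem det_conj_orthogonal (hO : O * Oᵀ = 1) (X : Matrix (Fin n) (Fin n) ℝ) :
    (O * X * Oᵀ).det = X.det := by
  have := congrArg Matrix.det hO
  rw [det_mul, det_one] at this
  rw [det_mul, det_mul, mul_right_comm, this, one_mul]

theorem adjugate_orthogonal (hO : O * Oᵀ = 1) : O.adjugate = O.det • Oᵀ := by
  have h := O.adjugate_mul
  calc O.adjugate = O.adjugate * (O * Oᵀ) := by rw [hO, Matrix.mul_one]
    _ = _ := by rw [← Matrix.mul_assoc, h, Matrix.smul_mul, Matrix.one_mul]

theorem adjugate_conj_orthogonal (hO : O * Oᵀ = 1) (X : Matrix (Fin n) (Fin n) ℝ) :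
    (O * X * Oᵀ).adjugate = O * X.adjugate * Oᵀ := by
  have hO' : Oᵀ * Oᵀᵀ = 1 := by rw [transpose_transpose]; exact mul_eq_one_comm.mp hO
  have hd : O.det * O.det = 1 := by
    have := congrArg Matrix.det hO
    rwa [det_mul, det_transpose, det_one] at this
  rw [adjugate_mul_distrib, adjugate_mul_distrib, adjugate_orthogonal hO, adjugate_orthogonal hO',
    det_transpose, transpose_transpose]
  simp only [Matrix.smul_mul, Matrix.mul_smul, smul_smul, hd, one_smul, Matrix.mul_assoc]

end orthogonal

/-- Every vector is mapped to a multiple of the first basis vector by some symmetric orthogonal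
matrix. -/
theorem exists_orthogonal_mulVec_eq {n : ℕ} (u : Fin (n + 1) → ℝ) :
    ∃ O : Matrix (Fin (n + 1)) (Fin (n + 1)) ℝ, O * Oᵀ = 1 ∧ Oᵀ = O ∧
      O *ᵥ u = √(u ⬝ᵥ u) • Pi.single 0 1 := by
  set s := √(u ⬝ᵥ u) with hs
  have huu : s * s = u ⬝ᵥ u := Real.mul_self_sqrt (by
    simp only [dotProduct]; exact Finset.sum_nonneg fun i _ => mul_self_nonneg _)
  set w : Fin (n + 1) → ℝ := u - s • Pi.single 0 1 with hw
  have hww : w ⬝ᵥ w = 2 * (w ⬝ᵥ u) := by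
    simp only [hw, sub_dotProduct, dotProduct_sub, smul_dotProduct, dotProduct_smul, smul_eq_mul,
      single_dotProduct, dotProduct_single, one_mul, mul_one, Pi.sub_apply, Pi.smul_apply,
      Pi.single_eq_same]
    linear_combination huu
  -- The Householder reflection exchanging u and s·e₀, two vectors of equal length; this equality is
  -- what `hww` expresses. If w = 0 then 2/0 = 0 and the matrix is the identity, as it should be,
  -- since then u = s·e₀.
  refine ⟨1 - (2 / (w ⬝ᵥ w)) • vecMulVec w w, ?_, ?_, ?_⟩
  · have ht : (vecMulVec w w)ᵀ = vecMulVec w w := by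
      ext; simp [vecMulVec_apply, mul_comm]
    have hsq : vecMulVec w w * vecMulVec w w = (w ⬝ᵥ w) • vecMulVec w w := by
      ext i j
      simp only [mul_apply, vecMulVec_apply, Matrix.smul_apply, smul_eq_mul, dotProduct, Finset.sum_mul]
      exact Finset.sum_congr rfl fun k _ => by ring
    rw [transpose_sub, transpose_smul, transpose_one, ht, Matrix.sub_mul, Matrix.mul_sub,
      Matrix.mul_sub, Matrix.one_mul, Matrix.mul_one, Matrix.smul_mul, Matrix.mul_smul, Matrix.mul_smul, hsq,
      Matrix.one_mul]
    rcases eq_or_ne (w ⬝ᵥ w) 0 with h | h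
    · simp [h]
    · rw [smul_smul, smul_smul]
      have : 2 / (w ⬝ᵥ w) * (2 / (w ⬝ᵥ w)) * (w ⬝ᵥ w) = 2 / (w ⬝ᵥ w) + 2 / (w ⬝ᵥ w) := by
        field_simp; ring
      rw [this, add_smul]
      abel
  · ext i j
    simp [vecMulVec_apply, mul_comm, Matrix.one_apply, eq_comm]
  · rw [sub_mulVec, one_mulVec, smul_mulVec, vecMulVec_mulVec]
    rcases eq_or_ne (w ⬝ᵥ w) 0 with h | h
    · have hw0 : w = 0 := dotProduct_self_eq_zero.mp h
      have : u = s • Pi.single 0 1 := sub_eq_zero.mp (hw ▸ hw0)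
      rw [hw0]
      simpa using this
    · have hu : w ⬝ᵥ u ≠ 0 := by
        intro h'
        rw [h', mul_zero] at hww
        exact h hww
      have h2 : (2 / (w ⬝ᵥ w)) • (MulOpposite.op (w ⬝ᵥ u) • w) = w := by
        ext i
        simp only [Pi.smul_apply, MulOpposite.smul_eq_mul_unop, MulOpposite.unop_op, smul_eq_mul,
          hww]
        field_simp
      rw [h2, hw, sub_sub_cancel]

/-! ### Recurrences for the polynomials P, R, T and S -/

section hermite

open Polynomial in
theorem derivative_hermite_succ (n : ℕ) :
    derivative (hermite (n + 1)) = (n + 1 : ℤ[X]) * hermite n := by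
  induction n with
  | zero => simp
  | succ n ih =>
    rw [hermite_succ (n + 1), derivative_sub, derivative_mul, ih, derivative_mul,
      show ((n : ℤ[X]) + 1) = C ((n : ℤ) + 1) by simp, derivative_C, derivative_X,
      hermite_succ n]
    simp
    ring

open Polynomial in
theorem hermite_succ_succ (n : ℕ) :
    hermite (n + 2) = X * hermite (n + 1) - (n + 1 : ℤ[X]) * hermite n := by
  rw [hermite_succ (n + 1), derivative_hermite_succ]

theorem scaledHe_zero_index (τ z : ℝ) : scaledHe τ 0 z = 1 := by
  simp [scaledHe]

theorem scaledHe_one (τ z : ℝ) : scaledHe τ 1 z = z := by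
  simp [scaledHe, Finset.sum_range_succ]

theorem scaledHe_succ_succ {τ : ℝ} (hτ : 0 ≤ τ) (k : ℕ) (z : ℝ) :
    scaledHe τ (k + 2) z = z * scaledHe τ (k + 1) z - τ * (k + 1) * scaledHe τ k z := by
  rcases hτ.eq_or_lt with rfl | hτ
  · simp only [scaledHe_zero]; ring
  · have hs : √τ ≠ 0 := (Real.sqrt_pos.mpr hτ).ne'
    have h2 : √τ ^ 2 = τ := Real.sq_sqrt hτ.le
    have hH : He (k + 2) (z / √τ) = z / √τ * He (k + 1) (z / √τ) - (k + 1) * He k (z / √τ) := by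
      simp only [He]
      rw [hermite_succ_succ]
      simp only [map_sub, map_mul, map_add, map_natCast, map_one, Polynomial.aeval_X]
    have hz : √τ * (z / √τ) = z := by field_simp
    rw [scaledHe_eq hτ, scaledHe_eq hτ, scaledHe_eq hτ, hH]
    linear_combination √τ ^ (k + 1) * He (k + 1) (z / √τ) * hz -
      (k + 1) * √τ ^ k * He k (z / √τ) * h2

/-- The three-term recurrence solved for its lowest term, in a form valid also at k = 0: the factor
k removes the meaningless index `k - 1`. -/
theorem scaledHe_pred {τ : ℝ} (hτ : 0 ≤ τ) (k : ℕ) (z : ℝ) :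
    τ * (k * scaledHe τ (k - 1) z) = z * scaledHe τ k z - scaledHe τ (k + 1) z := by
  cases k with
  | zero => simp [scaledHe_zero_index, scaledHe_one]
  | succ k =>
    rw [scaledHe_succ_succ hτ]
    push_cast
    simp
    ring

/-- The summand of `polyP`. -/
noncomputable def incP (τ : ℝ) (k : ℕ) (z : ℝ) : ℝ :=
  ((k : ℝ) + 1) * scaledHe τ k z ^ 2 - (k : ℝ) * (scaledHe τ (k - 1) z * scaledHe τ (k + 1) z)

/-- The summand of `polyR`. -/
noncomputable def incR (τ : ℝ) (k : ℕ) (z : ℝ) : ℝ :=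
  1 / 2 * (((k : ℝ) + 2) * (scaledHe τ (k + 1) z * scaledHe τ k z) -
      (k : ℝ) * (scaledHe τ (k + 2) z * scaledHe τ (k - 1) z))

variable {τ : ℝ} (z : ℝ)

/-- Both sides become polynomials in scaled Hermite functions of index k and k + 1 once the
three-term recurrence is used. This and `mul_incP_succ` are the only facts about Hermite polynomials
needed for the recurrences of the sums. -/
theorem incP_succ_succ (hτ : 0 ≤ τ) (k : ℕ) :
    incP τ (k + 2) z = (z ^ 2 + τ) * incP τ (k + 1) z - 2 * z * τ * (k + 1) * incR τ k z +
      τ ^ 2 * (k + 1) * (k + 2) * incP τ k z := by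
  have h := scaledHe_pred hτ k z
  have h2 := scaledHe_succ_succ hτ k z
  have h3 := scaledHe_succ_succ hτ (k + 1) z
  simp only [incP, incR, Nat.add_sub_cancel, show k + 2 - 1 = k + 1 from rfl] at *
  push_cast at *
  rw [show k + 1 + 2 = k + 2 + 1 from rfl, show k + 1 + 1 = k + 2 from rfl] at *
  rw [h3, h2]
  rw [h2] at h3
  linear_combination -(z * (k + 1) * (z * scaledHe τ (k + 1) z - τ * (k + 1) * scaledHe τ k z) -
    τ * (k + 1) * (k + 2) * scaledHe τ (k + 1) z) * h

theorem mul_incP_succ (hτ : 0 ≤ τ) (k : ℕ) :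
    z * incP τ (k + 1) z = incR τ (k + 1) z + τ * (k + 1) * incR τ k z := by
  have h := scaledHe_pred hτ k z
  have h2 := scaledHe_succ_succ hτ k z
  have h3 := scaledHe_succ_succ hτ (k + 1) z
  simp only [incP, incR, Nat.add_sub_cancel] at *
  push_cast at *
  rw [show k + 1 + 2 = k + 2 + 1 from rfl, show k + 1 + 1 = k + 2 from rfl] at *
  rw [h3, h2]
  linear_combination (1 / 2 * (k + 1) *
    (z * scaledHe τ (k + 1) z - τ * (k + 1) * scaledHe τ k z)) * h

theorem factorial_mul_sum_succ (F : ℕ → ℝ) (m : ℕ) :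
    ((m + 1)! : ℝ) * ∑ k ∈ Finset.range (m + 1 + 1), 1 / (k ! : ℝ) * F k =
      (m + 1) * ((m ! : ℝ) * ∑ k ∈ Finset.range (m + 1), 1 / (k ! : ℝ) * F k) + F (m + 1) := by
  have h : ((m + 1)! : ℝ) ≠ 0 := by positivity
  rw [Finset.sum_range_succ, mul_add, Nat.factorial_succ]
  rw [Nat.factorial_succ] at h
  push_cast at h ⊢
  field_simp

theorem polyP_zero : polyP τ 0 z = 1 := by
  simp [polyP, scaledHe_zero_index]

theorem polyR_zero : polyR τ 0 z = z := by
  simp [polyR, scaledHe_zero_index, scaledHe_one]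

theorem polyT_zero : polyT τ 0 z = 0 := by
  simp [polyT]

theorem polyP_succ (m : ℕ) : polyP τ (m + 1) z = (m + 1) * polyP τ m z + incP τ (m + 1) z :=
  factorial_mul_sum_succ (fun k => incP τ k z) m

theorem polyR_succ (m : ℕ) : polyR τ (m + 1) z = (m + 1) * polyR τ m z + incR τ (m + 1) z := by
  have h : ∀ m, polyR τ m z =
      (m ! : ℝ) * ∑ k ∈ Finset.range (m + 1), 1 / (k ! : ℝ) * incR τ k z := by
    intro m
    simp only [polyR, incR, Finset.mul_sum]
    exact Finset.sum_congr rfl fun k _ => by ring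
  rw [h, h]
  exact factorial_mul_sum_succ (fun k => incR τ k z) m

theorem polyT_succ (m : ℕ) :
    polyT τ (m + 1) z = (m + 1) * polyT τ m z + (m + 1) * incP τ (m + 1) z := by
  have h : ∀ m, polyT τ m z =
      (m ! : ℝ) * ∑ k ∈ Finset.range (m + 1), 1 / (k ! : ℝ) * (k * incP τ k z) := by
    intro m
    simp only [polyT, incP, Finset.mul_sum]
    exact Finset.sum_congr rfl fun k _ => by ring
  rw [h, h]
  simpa using factorial_mul_sum_succ (fun k => k * incP τ k z) m

/-- The combination `(m + 1) P_m - T_m = m! ∑_{k ≤ m} P_k / k!`. -/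
noncomputable def polyS (τ : ℝ) (m : ℕ) (z : ℝ) : ℝ := ((m : ℝ) + 1) * polyP τ m z - polyT τ m z

theorem polyS_zero : polyS τ 0 z = 1 := by
  simp [polyS, polyP_zero, polyT_zero]

theorem polyS_succ (m : ℕ) : polyS τ (m + 1) z = polyP τ (m + 1) z + (m + 1) * polyS τ m z := by
  simp only [polyS, polyT_succ]
  have := polyP_succ (τ := τ) z m
  push_cast
  linear_combination (m + 1) * this

/-- Partial summation of `mul_incP_succ`. The relation matches the recursion for the mixed moment of
determinant and adjugate, and later simplifies the combination of R's in the stated density. -/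
theorem polyR_add (hτ : 0 ≤ τ) (m : ℕ) :
    polyR τ m z = z * polyP τ m z - τ * m * polyR τ (m - 1) z := by
  cases m with
  | zero => simp [polyR_zero, polyP_zero]
  | succ m =>
    simp only [Nat.add_sub_cancel]
    push_cast
    induction m with
    | zero =>
      have h := mul_incP_succ z hτ 0
      simp only [polyR_succ, polyP_succ, polyR_zero, polyP_zero]
      have : incR τ 0 z = z := by simp [incR, scaledHe_zero_index, scaledHe_one]
      simp only [this] at h
      push_cast at h ⊢
      linear_combination -h
    | succ m ih =>
      have h := mul_incP_succ z hτ (m + 1)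
      have h1 := polyR_succ (τ := τ) z (m + 1)
      have h2 := polyP_succ (τ := τ) z (m + 1)
      have h3 := polyR_succ (τ := τ) z m
      push_cast at *
      linear_combination h1 - z * h2 + (m + 1 + 1) * ih - h + τ * (m + 1 + 1) * h3

/-- This is the relation forced on the second moment of det(z - X) by integrating out corner, row
and column: z² + 1 + τ is the mean of (z - a)², while m and m(m + 2) are the second and fourth
moments of |b|. It follows from `incP_succ_succ` by summation over the index, S arising as the
weighted partial sum of the P's. -/
theorem polyP_recurrence (hτ : 0 ≤ τ) (m : ℕ) :
    polyP τ (m + 1) z = (z ^ 2 + 1 + τ) * polyP τ m z - 2 * z * τ * m * polyR τ (m - 1) z +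
      (1 - τ ^ 2) * m * polyS τ (m - 1) z + τ ^ 2 * m * (m + 2) * polyP τ (m - 1) z := by
  have base : polyP τ 1 z = z ^ 2 + 1 + τ := by
    rw [polyP_succ, polyP_zero]
    have := scaledHe_succ_succ hτ 0 z
    simp [incP, scaledHe_zero_index, scaledHe_one, this]
    ring
  cases m with
  | zero => simp [base, polyP_zero]
  | succ m =>
    simp only [Nat.add_sub_cancel]
    push_cast
    induction m with
    | zero =>
      have h := incP_succ_succ z hτ 0
      have h1 := polyP_succ (τ := τ) z 1
      have hR : incR τ 0 z = z := by simp [incR, scaledHe_zero_index, scaledHe_one]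
      have hP : incP τ 0 z = 1 := by simp [incP, scaledHe_zero_index]
      have hP1 := polyP_succ (τ := τ) z 0
      simp only [polyS_zero, polyR_zero, polyP_zero, hR, hP] at *
      push_cast at *
      rw [base] at hP1 ⊢
      norm_num at *
      rw [h1, base, h]
      linear_combination - (z ^ 2 + τ) * hP1
    | succ m ih =>
      have h := incP_succ_succ z hτ (m + 1)
      have h1 := polyP_succ (τ := τ) z (m + 2)
      have h2 := polyP_succ (τ := τ) z (m + 1)
      have h3 := polyP_succ (τ := τ) z m
      have h4 := polyR_succ (τ := τ) z m
      have h5 := polyS_succ (τ := τ) z m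
      push_cast at *
      linear_combination h1 + h + (m + 2) * ih - (z ^ 2 + τ) * h2 +
        2 * z * τ * (m + 2) * h4 - (1 - τ ^ 2) * (m + 2) * h5 - τ ^ 2 * (m + 2) * (m + 3) * h3

end hermite

/-! ### Moments of the determinant and adjugate of an elliptic matrix -/

section

variable {n : ℕ} {τ : ℝ} (h0 : 0 ≤ τ) (h1 : τ < 1) (z : ℝ)
include h0 h1

theorem hasMoments_resolvent (i j : Fin n) :
    HasMoments (ellipticMeasure n τ) fun Y => (z • 1 - Matrix.of Y : Matrix _ _ ℝ) i j := by
  have := isProbabilityMeasure_ellipticMeasure n h0 h1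
  exact (HasMoments.const _).sub (hasMoments_ellipticMeasure n h0 h1 i j)

theorem hasMoments_det : HasMoments (ellipticMeasure n τ) fun Y => (z • 1 - Matrix.of Y).det := by
  have := isProbabilityMeasure_ellipticMeasure n h0 h1
  exact HasMoments.det (hasMoments_resolvent h0 h1 z)

theorem hasMoments_adjugate (i j : Fin n) :
    HasMoments (ellipticMeasure n τ) fun Y => (z • 1 - Matrix.of Y).adjugate i j := by
  have := isProbabilityMeasure_ellipticMeasure n h0 h1
  exact HasMoments.adjugate (hasMoments_resolvent h0 h1 z) i j

theorem hasMoments_vecMul_adjugate (b : Fin n → ℝ) (j : Fin n) :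
    HasMoments (ellipticMeasure n τ) fun Y => (b ᵥ* (z • 1 - Matrix.of Y).adjugate) j := by
  have := isProbabilityMeasure_ellipticMeasure n h0 h1
  exact HasMoments.dotProduct (fun i => HasMoments.const _)
    (fun i => hasMoments_adjugate h0 h1 z i j)

theorem hasMoments_quadratic_adjugate (b c : Fin n → ℝ) :
    HasMoments (ellipticMeasure n τ) fun Y => b ⬝ᵥ ((z • 1 - Matrix.of Y).adjugate *ᵥ c) := by
  have := isProbabilityMeasure_ellipticMeasure n h0 h1
  simp only [dotProduct_mulVec]
  exact HasMoments.dotProduct (hasMoments_vecMul_adjugate h0 h1 z b) (fun i => HasMoments.const _)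

end

/-- The moment formulas for the determinant and the adjugate of `z - Y` for elliptic `Y`. -/
structure MomentFormulas (n : ℕ) (τ z : ℝ) : Prop where
  det_sq : ∫ Y, (z • 1 - Matrix.of Y).det ^ 2 ∂ellipticMeasure n τ = polyP τ n z
  det_mul : ∀ b : Fin n → ℝ, ∫ Y, (z • 1 - Matrix.of Y).det *
    (b ⬝ᵥ ((z • 1 - Matrix.of Y).adjugate *ᵥ b)) ∂ellipticMeasure n τ =
      (b ⬝ᵥ b) * polyR τ (n - 1) z
  quad_sq : ∀ b : Fin n → ℝ, ∫ Y, (b ⬝ᵥ ((z • 1 - Matrix.of Y).adjugate *ᵥ b)) ^ 2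
    ∂ellipticMeasure n τ = (b ⬝ᵥ b) ^ 2 * polyP τ (n - 1) z
  normSq : ∀ b : Fin n → ℝ, ∫ Y, (b ᵥ* (z • 1 - Matrix.of Y).adjugate) ⬝ᵥ
    (b ᵥ* (z • 1 - Matrix.of Y).adjugate) ∂ellipticMeasure n τ =
      (b ⬝ᵥ b) * polyS τ (n - 1) z

theorem of_assemble {n : ℕ} (τ : ℝ) (p : ℝ × (Fin n → ℝ) × (Fin n → ℝ) × (Fin n → Fin n → ℝ)) :
    Matrix.of (assemble τ p) = bordered p.1 p.2.1 (τ • p.2.1 + p.2.2.1) (Matrix.of p.2.2.2) := rfl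

theorem det_sub_assemble {n : ℕ} (τ z : ℝ)
    (p : ℝ × (Fin n → ℝ) × (Fin n → ℝ) × (Fin n → Fin n → ℝ)) :
    (z • 1 - Matrix.of (assemble τ p)).det =
      (z - p.1) * (z • 1 - Matrix.of p.2.2.2).det -
        τ * (p.2.1 ⬝ᵥ ((z • 1 - Matrix.of p.2.2.2).adjugate *ᵥ p.2.1)) -
        (p.2.1 ᵥ* (z • 1 - Matrix.of p.2.2.2).adjugate) ⬝ᵥ p.2.2.1 := by
  rw [of_assemble, smul_one_sub_bordered, det_bordered]
  simp only [mulVec_neg, neg_dotProduct_neg, mulVec_add, mulVec_smul, dotProduct_add,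
    dotProduct_smul, smul_eq_mul, dotProduct_mulVec]
  ring

section

variable {n : ℕ} {τ : ℝ} (h0 : 0 ≤ τ) (h1 : τ < 1) {z : ℝ} (hF : MomentFormulas n τ z)
include h0 h1 hF

/-- With b and the block fixed, the determinant is affine in the centred Gaussian e; α stands for z
- a. Integrating over e leaves the square of the mean plus (1 - τ²) times |b adj(z - Y)|², and
exactly the four moments of `MomentFormulas` occur. -/
theorem integral_det_sq_inner (α : ℝ) (b : Fin n → ℝ) :
    ∫ p, (α * (z • 1 - Matrix.of p.2).det -
        τ * (b ⬝ᵥ ((z • 1 - Matrix.of p.2).adjugate *ᵥ b)) -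
        (b ᵥ* (z • 1 - Matrix.of p.2).adjugate) ⬝ᵥ p.1) ^ 2
      ∂((gaussVec n (1 - τ ^ 2)).prod (ellipticMeasure n τ)) =
    α ^ 2 * polyP τ n z - 2 * τ * α * (b ⬝ᵥ b) * polyR τ (n - 1) z +
      τ ^ 2 * (b ⬝ᵥ b) ^ 2 * polyP τ (n - 1) z +
      (1 - τ ^ 2) * (b ⬝ᵥ b) * polyS τ (n - 1) z := by
  have := isProbabilityMeasure_ellipticMeasure n h0 h1
  have hp : 0 < 1 - τ ^ 2 := by nlinarith
  have md := hasMoments_det (n := n) h0 h1 z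
  have mq := hasMoments_quadratic_adjugate h0 h1 z b b
  have mv := hasMoments_vecMul_adjugate h0 h1 z b
  have mint : HasMoments ((gaussVec n (1 - τ ^ 2)).prod (ellipticMeasure n τ)) fun p =>
      (α * (z • 1 - Matrix.of p.2).det - τ * (b ⬝ᵥ ((z • 1 - Matrix.of p.2).adjugate *ᵥ b)) -
        (b ᵥ* (z • 1 - Matrix.of p.2).adjugate) ⬝ᵥ p.1) ^ 2 :=
    (((md.comp_snd.const_mul α).sub (mq.comp_snd.const_mul τ)).sub (HasMoments.dotProduct
      (fun i => (mv i).comp_snd) (fun i => (hasMoments_gaussVec n _ i).comp_fst))).pow 2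
  rw [integral_prod_symm _ mint.integrable]
  have inner : ∀ Y : Fin n → Fin n → ℝ, ∫ e, (α * (z • 1 - Matrix.of Y).det -
        τ * (b ⬝ᵥ ((z • 1 - Matrix.of Y).adjugate *ᵥ b)) -
        (b ᵥ* (z • 1 - Matrix.of Y).adjugate) ⬝ᵥ e) ^ 2 ∂gaussVec n (1 - τ ^ 2) =
      α ^ 2 * (z • 1 - Matrix.of Y).det ^ 2 - 2 * τ * α * ((z • 1 - Matrix.of Y).det *
        (b ⬝ᵥ ((z • 1 - Matrix.of Y).adjugate *ᵥ b))) +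
      τ ^ 2 * (b ⬝ᵥ ((z • 1 - Matrix.of Y).adjugate *ᵥ b)) ^ 2 +
      (1 - τ ^ 2) * ((b ᵥ* (z • 1 - Matrix.of Y).adjugate) ⬝ᵥ
        (b ᵥ* (z • 1 - Matrix.of Y).adjugate)) := by
    intro Y
    set d := (z • 1 - Matrix.of Y).det
    set Q := b ⬝ᵥ ((z • 1 - Matrix.of Y).adjugate *ᵥ b)
    set w := b ᵥ* (z • 1 - Matrix.of Y).adjugate
    have mw : HasMoments (gaussVec n (1 - τ ^ 2)) fun e => w ⬝ᵥ e :=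
      HasMoments.dotProduct (fun i => HasMoments.const _) (hasMoments_gaussVec n _)
    have : ∀ e, (α * d - τ * Q - w ⬝ᵥ e) ^ 2 =
        ((α * d - τ * Q) ^ 2 - 2 * (α * d - τ * Q) * (w ⬝ᵥ e)) + (w ⬝ᵥ e) ^ 2 := fun e => by ring
    simp only [this]
    rw [integral_add ((HasMoments.const _).sub (mw.const_mul _)).integrable (mw.pow 2).integrable,
      integral_sub (HasMoments.const _).integrable (mw.const_mul _).integrable, integral_const_mul,
      integral_dotProduct_gaussVec, integral_dotProduct_sq_gaussVec n hp.le]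
    simp
    ring
  simp only [inner]
  have m1 := (md.pow 2).const_mul (α ^ 2)
  have m2 := (md.mul mq).const_mul (2 * τ * α)
  have m3 := (mq.pow 2).const_mul (τ ^ 2)
  have m4 := (HasMoments.dotProduct mv mv).const_mul (1 - τ ^ 2)
  rw [integral_add ((m1.sub m2).add m3).integrable m4.integrable,
    integral_add (m1.sub m2).integrable m3.integrable, integral_sub m1.integrable m2.integrable,
    integral_const_mul, integral_const_mul, integral_const_mul, integral_const_mul,
    hF.det_sq, hF.det_mul, hF.quad_sq, hF.normSq]
  ring

theorem integral_det_mul_det_inner (α : ℝ) (b : Fin n → ℝ) :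
    ∫ p, (α * (z • 1 - Matrix.of p.2).det -
        τ * (b ⬝ᵥ ((z • 1 - Matrix.of p.2).adjugate *ᵥ b)) -
        (b ᵥ* (z • 1 - Matrix.of p.2).adjugate) ⬝ᵥ p.1) * (z • 1 - Matrix.of p.2).det
      ∂((gaussVec n (1 - τ ^ 2)).prod (ellipticMeasure n τ)) =
    α * polyP τ n z - τ * (b ⬝ᵥ b) * polyR τ (n - 1) z := by
  have := isProbabilityMeasure_ellipticMeasure n h0 h1
  have md := hasMoments_det (n := n) h0 h1 z
  have mq := hasMoments_quadratic_adjugate h0 h1 z b b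
  have mv := hasMoments_vecMul_adjugate h0 h1 z b
  have mint : HasMoments ((gaussVec n (1 - τ ^ 2)).prod (ellipticMeasure n τ)) fun p =>
      (α * (z • 1 - Matrix.of p.2).det - τ * (b ⬝ᵥ ((z • 1 - Matrix.of p.2).adjugate *ᵥ b)) -
        (b ᵥ* (z • 1 - Matrix.of p.2).adjugate) ⬝ᵥ p.1) * (z • 1 - Matrix.of p.2).det :=
    (((md.comp_snd.const_mul α).sub (mq.comp_snd.const_mul τ)).sub (HasMoments.dotProduct
      (fun i => (mv i).comp_snd) (fun i => (hasMoments_gaussVec n _ i).comp_fst))).mul md.comp_snd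
  rw [integral_prod_symm _ mint.integrable]
  have inner : ∀ Y : Fin n → Fin n → ℝ, ∫ e, (α * (z • 1 - Matrix.of Y).det -
        τ * (b ⬝ᵥ ((z • 1 - Matrix.of Y).adjugate *ᵥ b)) -
        (b ᵥ* (z • 1 - Matrix.of Y).adjugate) ⬝ᵥ e) * (z • 1 - Matrix.of Y).det
          ∂gaussVec n (1 - τ ^ 2) =
      α * (z • 1 - Matrix.of Y).det ^ 2 - τ * ((z • 1 - Matrix.of Y).det *
        (b ⬝ᵥ ((z • 1 - Matrix.of Y).adjugate *ᵥ b))) := by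
    intro Y
    have mw : HasMoments (gaussVec n (1 - τ ^ 2)) fun e =>
        (b ᵥ* (z • 1 - Matrix.of Y).adjugate) ⬝ᵥ e :=
      HasMoments.dotProduct (fun i => HasMoments.const _) (hasMoments_gaussVec n _)
    rw [integral_mul_const, integral_sub (HasMoments.const _).integrable mw.integrable,
      integral_dotProduct_gaussVec]
    simp
    ring
  simp only [inner]
  have m1 := (md.pow 2).const_mul α
  have m2 := (md.mul mq).const_mul τ
  rw [integral_sub m1.integrable m2.integrable, integral_const_mul, integral_const_mul,
    hF.det_sq, hF.det_mul]
  ring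

variable (ν : Measure ℝ) [IsProbabilityMeasure ν] (hν : HasMoments ν fun a => a)
include hν

/-- Second moment of the determinant of `z - X` where `X` has corner distributed as `ν` and first
row of variance `v`. -/
theorem integral_det_sq_assemble {v : ℝ} (hv : 0 < v) :
    ∫ p, (z • 1 - Matrix.of (assemble τ p)).det ^ 2 ∂(ν.prod ((gaussVec n v).prod
      ((gaussVec n (1 - τ ^ 2)).prod (ellipticMeasure n τ)))) =
    (∫ a, (z - a) ^ 2 ∂ν) * polyP τ n z -
      2 * τ * (∫ a, (z - a) ∂ν) * (n * v) * polyR τ (n - 1) z +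
      τ ^ 2 * (n * (n + 2) * v ^ 2) * polyP τ (n - 1) z +
      (1 - τ ^ 2) * (n * v) * polyS τ (n - 1) z := by
  have := isProbabilityMeasure_ellipticMeasure n h0 h1
  have md := hasMoments_det (n := n) h0 h1 z
  have ma := hasMoments_adjugate (n := n) h0 h1 z
  have mb := hasMoments_gaussVec n v
  have mz : HasMoments ν fun a => z - a := (HasMoments.const _).sub hν
  have mvec : ∀ j, HasMoments ((gaussVec n v).prod
      ((gaussVec n (1 - τ ^ 2)).prod (ellipticMeasure n τ))) fun p =>
      (p.1 ᵥ* (z • 1 - Matrix.of p.2.2).adjugate) j := fun j =>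
    HasMoments.dotProduct (fun i => (mb i).comp_fst) (fun i => ((ma i j).comp_snd).comp_snd)
  have mquad : HasMoments ((gaussVec n v).prod
      ((gaussVec n (1 - τ ^ 2)).prod (ellipticMeasure n τ))) fun p =>
      p.1 ⬝ᵥ ((z • 1 - Matrix.of p.2.2).adjugate *ᵥ p.1) := by
    simp only [dotProduct_mulVec]
    exact HasMoments.dotProduct mvec (fun i => (mb i).comp_fst)
  have me : ∀ i, HasMoments ((gaussVec n v).prod
      ((gaussVec n (1 - τ ^ 2)).prod (ellipticMeasure n τ))) fun p => p.2.1 i := fun i =>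
    ((hasMoments_gaussVec n _ i).comp_fst).comp_snd
  simp only [det_sub_assemble]
  have mfull : ∀ α, HasMoments ((gaussVec n v).prod
      ((gaussVec n (1 - τ ^ 2)).prod (ellipticMeasure n τ))) fun p =>
      (α * (z • 1 - Matrix.of p.2.2).det -
        τ * (p.1 ⬝ᵥ ((z • 1 - Matrix.of p.2.2).adjugate *ᵥ p.1)) -
        (p.1 ᵥ* (z • 1 - Matrix.of p.2.2).adjugate) ⬝ᵥ p.2.1) ^ 2 := fun α =>
    (((md.comp_snd.comp_snd.const_mul α).sub (mquad.const_mul τ)).sub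
      (HasMoments.dotProduct mvec me)).pow 2
  rw [integral_prod _ (((((mz.comp_fst.mul md.comp_snd.comp_snd.comp_snd).sub
    (mquad.comp_snd.const_mul τ)).sub (HasMoments.dotProduct mvec me).comp_snd)).pow 2).integrable]
  have mn : HasMoments (gaussVec n v) fun b => b ⬝ᵥ b := HasMoments.dotProduct mb mb
  -- Arranged as a quadratic polynomial in α = z - a, so that only the first two moments of the
  -- corner matter.
  have inner : ∀ α : ℝ, ∫ p, (α * (z • 1 - Matrix.of p.2.2).det -
        τ * (p.1 ⬝ᵥ ((z • 1 - Matrix.of p.2.2).adjugate *ᵥ p.1)) -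
        (p.1 ᵥ* (z • 1 - Matrix.of p.2.2).adjugate) ⬝ᵥ p.2.1) ^ 2 ∂((gaussVec n v).prod
      ((gaussVec n (1 - τ ^ 2)).prod (ellipticMeasure n τ))) =
      polyP τ n z * α ^ 2 - (2 * τ * (n * v) * polyR τ (n - 1) z) * α +
      (τ ^ 2 * (n * (n + 2) * v ^ 2) * polyP τ (n - 1) z +
      (1 - τ ^ 2) * (n * v) * polyS τ (n - 1) z) := by
    intro α
    rw [integral_prod _ (mfull α).integrable]
    simp only [integral_det_sq_inner h0 h1 hF]
    have e : ∀ b : Fin n → ℝ, α ^ 2 * polyP τ n z - 2 * τ * α * (b ⬝ᵥ b) * polyR τ (n - 1) z +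
        τ ^ 2 * (b ⬝ᵥ b) ^ 2 * polyP τ (n - 1) z + (1 - τ ^ 2) * (b ⬝ᵥ b) * polyS τ (n - 1) z =
        α ^ 2 * polyP τ n z + ((1 - τ ^ 2) * polyS τ (n - 1) z - 2 * τ * α * polyR τ (n - 1) z) *
          (b ⬝ᵥ b) + (τ ^ 2 * polyP τ (n - 1) z) * (b ⬝ᵥ b) ^ 2 := fun b => by ring
    simp only [e]
    rw [integral_add ((HasMoments.const _).add (mn.const_mul _)).integrable
        ((mn.pow 2).const_mul _).integrable,
      integral_add (HasMoments.const _).integrable (mn.const_mul _).integrable,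
      integral_const_mul, integral_const_mul, integral_const_mul,
      integral_normSq_gaussVec n hv.le, integral_normSq_sq_gaussVec n hv]
    simp
    ring
  simp only [inner]
  rw [integral_add (((mz.pow 2).const_mul _).sub (mz.const_mul _)).integrable
      (HasMoments.const _).integrable,
    integral_sub ((mz.pow 2).const_mul _).integrable (mz.const_mul _).integrable,
    integral_const_mul, integral_const_mul]
  simp
  ring

end

theorem adjugate_sub_assemble_zero_zero {n : ℕ} (τ z : ℝ)
    (p : ℝ × (Fin n → ℝ) × (Fin n → ℝ) × (Fin n → Fin n → ℝ)) :
    (z • 1 - Matrix.of (assemble τ p)).adjugate 0 0 = (z • 1 - Matrix.of p.2.2.2).det := by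
  rw [of_assemble, smul_one_sub_bordered, adjugate_bordered_zero_zero]

theorem normSq_adjugate_sub_assemble {n : ℕ} (τ z : ℝ)
    (p : ℝ × (Fin n → ℝ) × (Fin n → ℝ) × (Fin n → Fin n → ℝ)) :
    (z • 1 - Matrix.of (assemble τ p)).adjugate 0 ⬝ᵥ
        (z • 1 - Matrix.of (assemble τ p)).adjugate 0 =
      (z • 1 - Matrix.of p.2.2.2).det ^ 2 + (p.2.1 ᵥ* (z • 1 - Matrix.of p.2.2.2).adjugate) ⬝ᵥ
        (p.2.1 ᵥ* (z • 1 - Matrix.of p.2.2.2).adjugate) := by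
  rw [of_assemble, smul_one_sub_bordered, dotProduct, Fin.sum_univ_succ,
    adjugate_bordered_zero_zero]
  simp [adjugate_bordered_zero_succ, neg_vecMul, dotProduct, sq]

theorem integral_conjBy {n : ℕ} {τ : ℝ} {O : Matrix (Fin n) (Fin n) ℝ} (hO : O * Oᵀ = 1)
    {f : (Fin n → Fin n → ℝ) → ℝ} (hf : HasMoments (ellipticMeasure n τ) f) :
    ∫ X, f X ∂ellipticMeasure n τ = ∫ X, f (conjBy O X) ∂ellipticMeasure n τ := by
  have h := measurePreserving_conjBy_ellipticMeasure τ hO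
  have := hf.integrable.aestronglyMeasurable
  rw [← h.map_eq] at this
  nth_rewrite 1 [← h.map_eq]
  exact integral_map h.measurable.aemeasurable this

section

variable {n : ℕ} {τ : ℝ} (h0 : 0 ≤ τ) (h1 : τ < 1) {z : ℝ} (hF : MomentFormulas n τ z)
include h0 h1

theorem integral_ellipticMeasure_succ {f : (Fin (n + 1) → Fin (n + 1) → ℝ) → ℝ}
    (hf : HasMoments (ellipticMeasure (n + 1) τ) f) :
    ∫ X, f X ∂ellipticMeasure (n + 1) τ = ∫ p, f (assemble τ p)
      ∂((gaussianReal 0 (1 + τ).toNNReal).prod ((gaussVec n 1).prod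
        ((gaussVec n (1 - τ ^ 2)).prod (ellipticMeasure n τ)))) := by
  have := hf.integrable.aestronglyMeasurable
  rw [ellipticMeasure_succ n h0 h1] at this ⊢
  exact integral_map (measurePreserving_assemble τ).measurable.aemeasurable this

/-- A symmetric orthogonal matrix takes u to |u|e₀ and preserves the elliptic law, so a quadratic
form in the adjugate may be replaced by its (0,0) entry times |u|². The next two lemmas use the same
rotation. -/
theorem integral_det_mul_adjugate (u : Fin (n + 1) → ℝ) :
    ∫ Y, (z • 1 - Matrix.of Y).det * (u ⬝ᵥ ((z • 1 - Matrix.of Y).adjugate *ᵥ u))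
      ∂ellipticMeasure (n + 1) τ = (u ⬝ᵥ u) *
    ∫ Y, (z • 1 - Matrix.of Y).det * (z • 1 - Matrix.of Y).adjugate 0 0
      ∂ellipticMeasure (n + 1) τ := by
  obtain ⟨O, hO, hOt, hOu⟩ := exists_orthogonal_mulVec_eq u
  rw [integral_conjBy hO ((hasMoments_det h0 h1 z).mul
    (hasMoments_quadratic_adjugate h0 h1 z u u)), ← integral_const_mul]
  refine integral_congr_ae (ae_of_all _ fun Y => ?_)
  have e : Matrix.of (conjBy O Y) = O * Matrix.of Y * Oᵀ := by
    rw [← inv_eq_transpose_of_orthogonal hO]; rfl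
  have huu : 0 ≤ u ⬝ᵥ u := Finset.sum_nonneg fun i _ => mul_self_nonneg _
  simp only [e]
  rw [smul_one_sub_conj hO, det_conj_orthogonal hO, adjugate_conj_orthogonal hO,
    ← mulVec_mulVec, ← mulVec_mulVec, dotProduct_mulVec, ← mulVec_transpose, hOt, hOu]
  simp only [mulVec_smul, smul_dotProduct, dotProduct_smul, single_dotProduct, mulVec_single,
    smul_eq_mul]
  simp
  linear_combination ((z • 1 - Matrix.of Y).det * (z • 1 - Matrix.of Y).adjugate 0 0) *
    Real.mul_self_sqrt huu

theorem integral_quadratic_adjugate_sq (u : Fin (n + 1) → ℝ) :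
    ∫ Y, (u ⬝ᵥ ((z • 1 - Matrix.of Y).adjugate *ᵥ u)) ^ 2
      ∂ellipticMeasure (n + 1) τ = (u ⬝ᵥ u) ^ 2 *
    ∫ Y, (z • 1 - Matrix.of Y).adjugate 0 0 ^ 2 ∂ellipticMeasure (n + 1) τ := by
  have := isProbabilityMeasure_ellipticMeasure (n + 1) h0 h1
  obtain ⟨O, hO, hOt, hOu⟩ := exists_orthogonal_mulVec_eq u
  rw [integral_conjBy hO ((hasMoments_quadratic_adjugate h0 h1 z u u).pow 2),
    ← integral_const_mul]
  refine integral_congr_ae (ae_of_all _ fun Y => ?_)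
  have e : Matrix.of (conjBy O Y) = O * Matrix.of Y * Oᵀ := by
    rw [← inv_eq_transpose_of_orthogonal hO]; rfl
  have huu : 0 ≤ u ⬝ᵥ u := Finset.sum_nonneg fun i _ => mul_self_nonneg _
  simp only [e]
  rw [smul_one_sub_conj hO, adjugate_conj_orthogonal hO,
    ← mulVec_mulVec, ← mulVec_mulVec, dotProduct_mulVec, ← mulVec_transpose, hOt, hOu]
  simp only [mulVec_smul, smul_dotProduct, dotProduct_smul, single_dotProduct, mulVec_single,
    smul_eq_mul]
  simp
  have h := Real.mul_self_sqrt huu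
  linear_combination (z • 1 - Matrix.of Y).adjugate 0 0 ^ 2 *
    (√(u ⬝ᵥ u) * √(u ⬝ᵥ u) + u ⬝ᵥ u) * h

theorem integral_normSq_adjugate (u : Fin (n + 1) → ℝ) :
    ∫ Y, (u ᵥ* (z • 1 - Matrix.of Y).adjugate) ⬝ᵥ (u ᵥ* (z • 1 - Matrix.of Y).adjugate)
      ∂ellipticMeasure (n + 1) τ = (u ⬝ᵥ u) *
    ∫ Y, (z • 1 - Matrix.of Y).adjugate 0 ⬝ᵥ (z • 1 - Matrix.of Y).adjugate 0
      ∂ellipticMeasure (n + 1) τ := by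
  have := isProbabilityMeasure_ellipticMeasure (n + 1) h0 h1
  obtain ⟨O, hO, hOt, hOu⟩ := exists_orthogonal_mulVec_eq u
  have mv := hasMoments_vecMul_adjugate h0 h1 z u
  rw [integral_conjBy hO (HasMoments.dotProduct mv mv), ← integral_const_mul]
  refine integral_congr_ae (ae_of_all _ fun Y => ?_)
  have e : Matrix.of (conjBy O Y) = O * Matrix.of Y * Oᵀ := by
    rw [← inv_eq_transpose_of_orthogonal hO]; rfl
  have huu : 0 ≤ u ⬝ᵥ u := Finset.sum_nonneg fun i _ => mul_self_nonneg _
  have hrow : u ᵥ* O = √(u ⬝ᵥ u) • Pi.single 0 1 := by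
    rw [← hOu, ← mulVec_transpose, hOt]
  have hnorm : ∀ w : Fin (n + 1) → ℝ, (w ᵥ* Oᵀ) ⬝ᵥ (w ᵥ* Oᵀ) = w ⬝ᵥ w := fun w => by
    rw [← dotProduct_mulVec, vecMul_transpose, mulVec_mulVec, mul_eq_one_comm.mp hO, one_mulVec]
  simp only [e]
  rw [smul_one_sub_conj hO, adjugate_conj_orthogonal hO, ← vecMul_vecMul, hnorm, ← vecMul_vecMul,
    hrow, smul_vecMul, single_one_vecMul, smul_dotProduct, dotProduct_smul, smul_smul,
    Real.mul_self_sqrt huu, smul_eq_mul]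
  rfl

include hF

/-- The (0,0) entry of the adjugate is the determinant of the lower block. The terms odd in the
corner or in e average out, leaving z P_n - τ n R_(n-1), which is R_n by `polyR_add`. -/
theorem integral_det_mul_adjugate_zero :
    ∫ Y, (z • 1 - Matrix.of Y).det * (z • 1 - Matrix.of Y).adjugate 0 0
      ∂ellipticMeasure (n + 1) τ = polyR τ n z := by
  have := isProbabilityMeasure_ellipticMeasure n h0 h1
  rw [integral_ellipticMeasure_succ h0 h1
    ((hasMoments_det h0 h1 z).mul (hasMoments_adjugate h0 h1 z 0 0))]
  have md := hasMoments_det (n := n) h0 h1 z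
  have ma := hasMoments_adjugate (n := n) h0 h1 z
  have mb := hasMoments_gaussVec n 1
  have mz : HasMoments (gaussianReal 0 (1 + τ).toNNReal) fun a => z - a :=
    (HasMoments.const _).sub (hasMoments_gaussianReal _ _)
  have mvec : ∀ j, HasMoments ((gaussVec n 1).prod
      ((gaussVec n (1 - τ ^ 2)).prod (ellipticMeasure n τ))) fun p =>
      (p.1 ᵥ* (z • 1 - Matrix.of p.2.2).adjugate) j := fun j =>
    HasMoments.dotProduct (fun i => (mb i).comp_fst) (fun i => ((ma i j).comp_snd).comp_snd)
  have mquad : HasMoments ((gaussVec n 1).prod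
      ((gaussVec n (1 - τ ^ 2)).prod (ellipticMeasure n τ))) fun p =>
      p.1 ⬝ᵥ ((z • 1 - Matrix.of p.2.2).adjugate *ᵥ p.1) := by
    simp only [dotProduct_mulVec]
    exact HasMoments.dotProduct mvec (fun i => (mb i).comp_fst)
  have me : ∀ i, HasMoments ((gaussVec n 1).prod
      ((gaussVec n (1 - τ ^ 2)).prod (ellipticMeasure n τ))) fun p => p.2.1 i := fun i =>
    ((hasMoments_gaussVec n _ i).comp_fst).comp_snd
  simp only [det_sub_assemble, adjugate_sub_assemble_zero_zero]
  have mfull : ∀ α, HasMoments ((gaussVec n 1).prod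
      ((gaussVec n (1 - τ ^ 2)).prod (ellipticMeasure n τ))) fun p =>
      (α * (z • 1 - Matrix.of p.2.2).det -
        τ * (p.1 ⬝ᵥ ((z • 1 - Matrix.of p.2.2).adjugate *ᵥ p.1)) -
        (p.1 ᵥ* (z • 1 - Matrix.of p.2.2).adjugate) ⬝ᵥ p.2.1) *
          (z • 1 - Matrix.of p.2.2).det := fun α =>
    (((md.comp_snd.comp_snd.const_mul α).sub (mquad.const_mul τ)).sub
      (HasMoments.dotProduct mvec me)).mul md.comp_snd.comp_snd
  rw [integral_prod _ (((((mz.comp_fst.mul md.comp_snd.comp_snd.comp_snd).sub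
    (mquad.comp_snd.const_mul τ)).sub (HasMoments.dotProduct mvec me).comp_snd)).mul
    md.comp_snd.comp_snd.comp_snd).integrable]
  have mn : HasMoments (gaussVec n 1) fun b => b ⬝ᵥ b := HasMoments.dotProduct mb mb
  have inner : ∀ α : ℝ, ∫ p, (α * (z • 1 - Matrix.of p.2.2).det -
        τ * (p.1 ⬝ᵥ ((z • 1 - Matrix.of p.2.2).adjugate *ᵥ p.1)) -
        (p.1 ᵥ* (z • 1 - Matrix.of p.2.2).adjugate) ⬝ᵥ p.2.1) *
          (z • 1 - Matrix.of p.2.2).det ∂((gaussVec n 1).prod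
      ((gaussVec n (1 - τ ^ 2)).prod (ellipticMeasure n τ))) =
      α * polyP τ n z - τ * n * polyR τ (n - 1) z := by
    intro α
    rw [integral_prod _ (mfull α).integrable]
    simp only [integral_det_mul_det_inner h0 h1 hF]
    rw [integral_sub (HasMoments.const _).integrable ((mn.const_mul _).mul
      (HasMoments.const _)).integrable, integral_mul_const, integral_mul_const,
      integral_const_mul,
      integral_normSq_gaussVec n zero_le_one]
    simp
  simp only [inner]
  rw [integral_sub (mz.mul (HasMoments.const _)).integrable (HasMoments.const _).integrable,
    integral_mul_const, integral_sub (HasMoments.const _).integrable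
      (hasMoments_gaussianReal _ _).integrable, polyR_add z h0 n]
  simp

theorem integral_adjugate_zero_sq :
    ∫ Y, (z • 1 - Matrix.of Y).adjugate 0 0 ^ 2 ∂ellipticMeasure (n + 1) τ = polyP τ n z := by
  have := isProbabilityMeasure_ellipticMeasure n h0 h1
  have := isProbabilityMeasure_ellipticMeasure (n + 1) h0 h1
  rw [integral_ellipticMeasure_succ h0 h1 ((hasMoments_adjugate h0 h1 z 0 0).pow 2)]
  simp only [adjugate_sub_assemble_zero_zero]
  have md := (hasMoments_det (n := n) h0 h1 z).pow 2
  rw [integral_prod _ md.comp_snd.comp_snd.comp_snd.integrable]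
  simp only []
  rw [integral_prod _ md.comp_snd.comp_snd.integrable]
  simp only []
  rw [integral_prod _ md.comp_snd.integrable]
  simp [hF.det_sq]

/-- Row 0 of the adjugate consists of the determinant of the lower block and the entries of b adj(z
- D) up to sign. Its squared length has mean P_n + n S_(n-1), and this is the recursion defining
S_n. -/
theorem integral_normSq_adjugate_zero :
    ∫ Y, (z • 1 - Matrix.of Y).adjugate 0 ⬝ᵥ (z • 1 - Matrix.of Y).adjugate 0
      ∂ellipticMeasure (n + 1) τ = polyS τ n z := by
  have := isProbabilityMeasure_ellipticMeasure n h0 h1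
  have := isProbabilityMeasure_ellipticMeasure (n + 1) h0 h1
  rw [integral_ellipticMeasure_succ h0 h1 (HasMoments.dotProduct
    (fun j => hasMoments_adjugate h0 h1 z 0 j) (fun j => hasMoments_adjugate h0 h1 z 0 j))]
  simp only [normSq_adjugate_sub_assemble]
  have md := (hasMoments_det (n := n) h0 h1 z).pow 2
  have ma := hasMoments_adjugate (n := n) h0 h1 z
  have mb := hasMoments_gaussVec n 1
  have mvec : ∀ j, HasMoments ((gaussVec n 1).prod
      ((gaussVec n (1 - τ ^ 2)).prod (ellipticMeasure n τ))) fun p =>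
      (p.1 ᵥ* (z • 1 - Matrix.of p.2.2).adjugate) j := fun j =>
    HasMoments.dotProduct (fun i => (mb i).comp_fst) (fun i => ((ma i j).comp_snd).comp_snd)
  have mfull := md.comp_snd.comp_snd.add (HasMoments.dotProduct mvec mvec)
  rw [integral_prod _ mfull.comp_snd.integrable]
  simp only [integral_const, probReal_univ, one_smul]
  rw [integral_prod _ mfull.integrable]
  have inner : ∀ b : Fin n → ℝ, ∫ p, (z • 1 - Matrix.of p.2).det ^ 2 +
      (b ᵥ* (z • 1 - Matrix.of p.2).adjugate) ⬝ᵥ (b ᵥ* (z • 1 - Matrix.of p.2).adjugate)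
      ∂((gaussVec n (1 - τ ^ 2)).prod (ellipticMeasure n τ)) =
      polyP τ n z + (b ⬝ᵥ b) * polyS τ (n - 1) z := by
    intro b
    have mv := hasMoments_vecMul_adjugate h0 h1 z b
    have mw := HasMoments.dotProduct mv mv
    rw [integral_prod _ (md.add mw).comp_snd.integrable]
    simp only [integral_const, probReal_univ, one_smul]
    rw [integral_add md.integrable mw.integrable, hF.det_sq, hF.normSq]
  simp only [inner]
  have mn : HasMoments (gaussVec n 1) fun b => b ⬝ᵥ b := HasMoments.dotProduct mb mb
  rw [integral_add (HasMoments.const _).integrable (mn.mul (HasMoments.const _)).integrable,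
    integral_mul_const, integral_normSq_gaussVec n zero_le_one]
  -- At n = 0 the index n - 1 is truncated, but it is multiplied by n.
  cases n with
  | zero => simp [polyS_zero, polyP_zero]
  | succ n => simp [polyS_succ]

end

theorem integral_sub_gaussianReal (z m : ℝ) (v : NNReal) :
    ∫ a, (z - a) ∂gaussianReal m v = z - m := by
  rw [integral_sub (HasMoments.const _).integrable (hasMoments_gaussianReal _ _).integrable]
  simp

theorem integral_sub_sq_gaussianReal (z m : ℝ) (v : NNReal) :
    ∫ a, (z - a) ^ 2 ∂gaussianReal m v = (z - m) ^ 2 + v := by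
  have hv := variance_id_gaussianReal (μ := m) (v := v)
  rw [variance_eq_integral (by fun_prop)] at hv
  simp only [id, integral_id_gaussianReal] at hv
  have mi := hasMoments_gaussianReal m v
  have ms : HasMoments (gaussianReal m v) fun a => a - m := mi.sub (HasMoments.const _)
  have e : ∀ a, (z - a) ^ 2 = ((z - m) ^ 2 - 2 * (z - m) * (a - m)) + (a - m) ^ 2 :=
    fun a => by ring
  rw [funext e]
  rw [integral_add ((HasMoments.const _).sub (ms.const_mul _)).integrable (ms.pow 2).integrable,
    integral_sub (HasMoments.const _).integrable (ms.const_mul _).integrable, integral_const_mul,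
    integral_sub mi.integrable (HasMoments.const _).integrable, hv]
  simp

/-- Each of the four formulas in size n + 1 uses formulas in size n, so they are proved together.
The determinant formula closes by `polyP_recurrence`; the other three are first rotated to the entry
or row of index 0. -/
theorem momentFormulas (n : ℕ) {τ : ℝ} (h0 : 0 ≤ τ) (h1 : τ < 1) (z : ℝ) :
    MomentFormulas n τ z := by
  induction n with
  | zero =>
    constructor <;> simp [ellipticMeasure_zero, polyP_zero]
  | succ n ih =>
    have := isProbabilityMeasure_ellipticMeasure (n + 1) h0 h1
    constructor
    · rw [integral_ellipticMeasure_succ h0 h1 ((hasMoments_det h0 h1 z).pow 2),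
        integral_det_sq_assemble h0 h1 ih _ (hasMoments_gaussianReal _ _) one_pos,
        integral_sub_gaussianReal, integral_sub_sq_gaussianReal, polyP_recurrence z h0 n]
      have : (0 : ℝ) ≤ 1 + τ := by linarith
      simp [this]
      ring
    · intro b
      rw [integral_det_mul_adjugate h0 h1, integral_det_mul_adjugate_zero h0 h1 ih]
      rfl
    · intro b
      rw [integral_quadratic_adjugate_sq h0 h1, integral_adjugate_zero_sq h0 h1 ih]
      rfl
    · intro b
      rw [integral_normSq_adjugate h0 h1, integral_normSq_adjugate_zero h0 h1 ih]
      rfl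

/-! ### Exponential tilting of the corner and the first row -/

/-- Completing the square in a: a Gaussian of variance s times exp(-q(z - a)²/(2s)) is again
Gaussian, of precision (1 + q)/s and centre pulled towards z; the scalar is the mass lost. -/
theorem gaussianReal_withDensity_tilt {s q : ℝ} (hs : 0 < s) (hq : 0 ≤ q) (z : ℝ) :
    (gaussianReal 0 s.toNNReal).withDensity
        (fun a => ENNReal.ofReal (Real.exp (-(q / (2 * s) * (z - a) ^ 2)))) =
      ENNReal.ofReal ((√(1 + q))⁻¹ * Real.exp (-(z ^ 2 * q / (2 * s * (1 + q))))) •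
        gaussianReal (q * z / (1 + q)) (s / (1 + q)).toNNReal := by
  have hq1 : 0 < 1 + q := by linarith
  have hs1 : 0 < s / (1 + q) := by positivity
  rw [gaussianReal_eq_withDensity hs,
    gaussianReal_of_var_ne_zero _ (by simpa using hs1 : (s / (1 + q)).toNNReal ≠ 0),
    ← withDensity_mul _ (by fun_prop) (by fun_prop),
    ← withDensity_smul _ (measurable_gaussianPDF _ _)]
  congr 1
  funext a
  simp only [Pi.mul_apply, Pi.smul_apply, smul_eq_mul, gaussianPDF]
  rw [← ENNReal.ofReal_mul (by positivity), ← ENNReal.ofReal_mul (by positivity)]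
  congr 1
  simp only [gaussianPDFReal, Real.coe_toNNReal _ hs1.le]
  have e1 : √(2 * Real.pi * (s / (1 + q))) = √(2 * Real.pi * s) / √(1 + q) := by
    rw [← Real.sqrt_div (by positivity)]; congr 1; ring
  have e2 : Real.exp (-(a * a) / (2 * s)) * Real.exp (-(q / (2 * s) * (z - a) ^ 2)) =
      Real.exp (-(z ^ 2 * q / (2 * s * (1 + q)))) *
        Real.exp (-(a - q * z / (1 + q)) ^ 2 / (2 * (s / (1 + q)))) := by
    rw [← Real.exp_add, ← Real.exp_add]
    congr 1
    field_simp
    ring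
  have hsq : √(1 + q) ≠ 0 := by positivity
  have hss : √(2 * Real.pi * s) ≠ 0 := by positivity
  rw [mul_assoc, e2, e1]
  field_simp

theorem gaussVec_withDensity_tilt (n : ℕ) {t : ℝ} (ht : 0 ≤ t) :
    (gaussVec n 1).withDensity
        (fun b => ENNReal.ofReal (Real.exp (-(t / 2 * (b ⬝ᵥ b))))) =
      ENNReal.ofReal (√(1 / (1 + t)) ^ n) • gaussVec n (1 / (1 + t)) := by
  have ht1 : 0 < 1 + t := by linarith
  have hs1 : 0 < 1 / (1 + t) := by positivity
  have hg : ∀ (c v : ℝ), Measurable fun x : Fin n → ℝ =>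
      ENNReal.ofReal (c * Real.exp (-(x ⬝ᵥ x) / (2 * v))) := by
    intro c v
    simp only [dotProduct]
    fun_prop
  have hg' : Measurable fun b : Fin n → ℝ =>
      ENNReal.ofReal (Real.exp (-(t / 2 * (b ⬝ᵥ b)))) := by
    simp only [dotProduct]
    fun_prop
  rw [gaussVec_eq_withDensity n one_pos, gaussVec_eq_withDensity n hs1,
    ← withDensity_mul _ (hg _ _) hg', ← withDensity_smul _ (hg _ _)]
  congr 1
  funext b
  simp only [Pi.mul_apply, Pi.smul_apply, smul_eq_mul]
  rw [← ENNReal.ofReal_mul (by positivity), ← ENNReal.ofReal_mul (by positivity)]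
  congr 1
  have e2 : Real.exp (-(b ⬝ᵥ b) / (2 * 1)) * Real.exp (-(t / 2 * (b ⬝ᵥ b))) =
      Real.exp (-(b ⬝ᵥ b) / (2 * (1 / (1 + t)))) := by
    rw [← Real.exp_add]
    congr 1
    field_simp
    ring
  have hss : √(1 / (1 + t)) ≠ 0 := by positivity
  rw [mul_assoc, e2, mul_one, Real.sqrt_mul (by positivity) (1 / (1 + t)), mul_inv, mul_pow]
  field_simp
  rw [← mul_pow, mul_one_div_cancel hss, one_pow]

theorem hasMoments_det_assemble {m : ℕ} {τ : ℝ} (h0 : 0 ≤ τ) (h1 : τ < 1) (z : ℝ)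
    {ν : Measure ℝ} [IsProbabilityMeasure ν] (hν : HasMoments ν fun a => a) (v : ℝ) :
    HasMoments (ν.prod ((gaussVec m v).prod ((gaussVec m (1 - τ ^ 2)).prod (ellipticMeasure m τ))))
      fun p => (z • 1 - Matrix.of (assemble τ p)).det := by
  have := isProbabilityMeasure_ellipticMeasure m h0 h1
  refine HasMoments.det fun i j => (HasMoments.const _).sub ?_
  refine Fin.cases ?_ (fun i => ?_) i <;> refine Fin.cases ?_ (fun j => ?_) j
  · exact hν.comp_fst
  · exact ((hasMoments_gaussVec m v j).comp_fst).comp_snd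
  · exact (((hasMoments_gaussVec m v i).comp_fst).const_mul τ |>.add
      (((hasMoments_gaussVec m _ i).comp_fst).comp_snd)).comp_snd
  · exact ((hasMoments_ellipticMeasure m h0 h1 i j).comp_snd.comp_snd).comp_snd

/-- The bracket of the joint density, as the second moment of a bordered determinant. -/
noncomputable def momentBracket (m : ℕ) (τ z q : ℝ) : ℝ :=
  (z ^ 2 / (1 + q) ^ 2 + (1 + τ) / (1 + q)) * polyP τ m z -
    2 * τ * (z / (1 + q)) * (m * ((1 + τ) / (1 + τ + q))) * polyR τ (m - 1) z +
    τ ^ 2 * (m * (m + 2) * ((1 + τ) / (1 + τ + q)) ^ 2) * polyP τ (m - 1) z +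
    (1 - τ ^ 2) * (m * ((1 + τ) / (1 + τ + q))) * polyS τ (m - 1) z

section

variable {m : ℕ} {τ : ℝ} (h0 : 0 ≤ τ) (h1 : τ < 1) (z : ℝ) {q : ℝ} (hq : 0 ≤ q)
include h0 h1 hq

/-- The tilted corner satisfies z - E a = z/(1 + q). The general `integral_det_sq_assemble`, with
corner law and row variance left free, serves both here and in the induction for `momentFormulas`.
-/
theorem integral_det_sq_tilted :
    ∫ p, (z • 1 - Matrix.of (assemble τ p)).det ^ 2
      ∂((gaussianReal (q * z / (1 + q)) ((1 + τ) / (1 + q)).toNNReal).prod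
        ((gaussVec m (1 / (1 + q / (1 + τ)))).prod
          ((gaussVec m (1 - τ ^ 2)).prod (ellipticMeasure m τ)))) = momentBracket m τ z q := by
  have hq1 : 0 < 1 + q := by linarith
  have hτ1 : 0 < 1 + τ := by linarith
  have hv : 1 / (1 + q / (1 + τ)) = (1 + τ) / (1 + τ + q) := by
    have : 0 < 1 + τ + q := by linarith
    field_simp
  rw [integral_det_sq_assemble h0 h1 (momentFormulas m h0 h1 z) _ (hasMoments_gaussianReal _ _)
    (by positivity), integral_sub_gaussianReal, integral_sub_sq_gaussianReal, hv,
    Real.coe_toNNReal _ (by positivity), momentBracket]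
  have e : z - q * z / (1 + q) = z / (1 + q) := by field_simp; ring
  rw [e, div_pow]

/-- Not visible from the polynomial expression: the bracket is the mean of a square. The positivity
of the joint density rests on this. -/
theorem momentBracket_nonneg : 0 ≤ momentBracket m τ z q := by
  rw [← integral_det_sq_tilted h0 h1 z hq]
  exact integral_nonneg fun p => sq_nonneg _

/-- The first row of z - X has squared length (z - a)² + |b|², so the weight is a product of a
function of the corner and one of the row. It is absorbed into their Gaussian laws; e and the lower
block keep theirs. -/
theorem lintegral_det_sq_tilt :
    ∫⁻ X, ENNReal.ofReal ((z • 1 - Matrix.of X).det ^ 2 * Real.exp (-(q / (2 * (1 + τ)) *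
      ((z • 1 - Matrix.of X : Matrix _ _ ℝ) 0 ⬝ᵥ (z • 1 - Matrix.of X : Matrix _ _ ℝ) 0))))
        ∂ellipticMeasure (m + 1) τ =
    ENNReal.ofReal ((√(1 + q))⁻¹ * Real.exp (-(z ^ 2 * q / (2 * (1 + τ) * (1 + q)))) *
      √((1 + τ) / (1 + τ + q)) ^ m * momentBracket m τ z q) := by
  have := isProbabilityMeasure_ellipticMeasure m h0 h1
  have hq1 : 0 < 1 + q := by linarith
  have hτ1 : 0 < 1 + τ := by linarith
  have hv : 1 / (1 + q / (1 + τ)) = (1 + τ) / (1 + τ + q) := by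
    have : 0 < 1 + τ + q := by linarith
    field_simp
  have hcont : Continuous fun X : Fin (m + 1) → Fin (m + 1) → ℝ =>
      (z • 1 - Matrix.of X : Matrix _ _ ℝ) := continuous_const.sub continuous_id
  have hdet : Measurable fun X : Fin (m + 1) → Fin (m + 1) → ℝ =>
      (z • 1 - Matrix.of X).det ^ 2 := (hcont.matrix_det.pow 2).measurable
  have hrow : Continuous fun X : Fin (m + 1) → Fin (m + 1) → ℝ =>
      (z • 1 - Matrix.of X : Matrix _ _ ℝ) 0 ⬝ᵥ (z • 1 - Matrix.of X : Matrix _ _ ℝ) 0 := by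
    have : Continuous fun X : Fin (m + 1) → Fin (m + 1) → ℝ =>
      (z • 1 - Matrix.of X : Matrix _ _ ℝ) 0 := (continuous_apply 0).comp hcont
    exact this.dotProduct this
  have hA := (measurePreserving_assemble (n := m) τ).measurable
  have hfull : Measurable fun X : Fin (m + 1) → Fin (m + 1) → ℝ =>
      ENNReal.ofReal ((z • 1 - Matrix.of X).det ^ 2 * Real.exp (-(q / (2 * (1 + τ)) *
      ((z • 1 - Matrix.of X : Matrix _ _ ℝ) 0 ⬝ᵥ (z • 1 - Matrix.of X : Matrix _ _ ℝ) 0)))) :=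
    (hdet.mul (Real.measurable_exp.comp (hrow.measurable.const_mul _).neg)).ennreal_ofReal
  rw [ellipticMeasure_succ m h0 h1, lintegral_map hfull hA]
  have hrow' : ∀ p : ℝ × (Fin m → ℝ) × (Fin m → ℝ) × (Fin m → Fin m → ℝ),
      (z • 1 - Matrix.of (assemble τ p) : Matrix _ _ ℝ) 0 ⬝ᵥ
        (z • 1 - Matrix.of (assemble τ p) : Matrix _ _ ℝ) 0 =
      (z - p.1) ^ 2 + p.2.1 ⬝ᵥ p.2.1 := by
    intro p
    rw [of_assemble, smul_one_sub_bordered, dotProduct, Fin.sum_univ_succ]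
    simp [dotProduct, sq]
  have hsplit : ∀ p : ℝ × (Fin m → ℝ) × (Fin m → ℝ) × (Fin m → Fin m → ℝ),
      ENNReal.ofReal ((z • 1 - Matrix.of (assemble τ p)).det ^ 2 *
        Real.exp (-(q / (2 * (1 + τ)) * ((z • 1 - Matrix.of (assemble τ p) : Matrix _ _ ℝ) 0 ⬝ᵥ
        (z • 1 - Matrix.of (assemble τ p) : Matrix _ _ ℝ) 0)))) =
      (ENNReal.ofReal (Real.exp (-(q / (2 * (1 + τ)) * (z - p.1) ^ 2))) *
        ENNReal.ofReal (Real.exp (-(q / (1 + τ) / 2 * (p.2.1 ⬝ᵥ p.2.1))))) *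
        ENNReal.ofReal ((z • 1 - Matrix.of (assemble τ p)).det ^ 2) := by
    intro p
    rw [← ENNReal.ofReal_mul (by positivity), ← ENNReal.ofReal_mul (by positivity),
      ← Real.exp_add, hrow', mul_comm]
    congr 3
    field_simp
    ring
  simp only [hsplit]
  have mE1 : Measurable fun a : ℝ =>
    ENNReal.ofReal (Real.exp (-(q / (2 * (1 + τ)) * (z - a) ^ 2))) := by fun_prop
  have mE2 : Measurable fun b : Fin m → ℝ =>
      ENNReal.ofReal (Real.exp (-(q / (1 + τ) / 2 * (b ⬝ᵥ b)))) := by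
    simp only [dotProduct]; fun_prop
  have mE : Measurable fun p : ℝ × (Fin m → ℝ) × (Fin m → ℝ) × (Fin m → Fin m → ℝ) =>
      ENNReal.ofReal (Real.exp (-(q / (2 * (1 + τ)) * (z - p.1) ^ 2))) *
        ENNReal.ofReal (Real.exp (-(q / (1 + τ) / 2 * (p.2.1 ⬝ᵥ p.2.1)))) :=
    (mE1.comp measurable_fst).mul (mE2.comp (measurable_fst.comp measurable_snd))
  have mD : Measurable fun p => ENNReal.ofReal ((z • 1 - Matrix.of (assemble τ p)).det ^ 2) :=
    (hdet.comp hA).ennreal_ofReal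
  refine (lintegral_withDensity_eq_lintegral_mul _ mE mD).symm.trans ?_
  have hmeas : ((gaussianReal 0 (1 + τ).toNNReal).prod ((gaussVec m 1).prod
        ((gaussVec m (1 - τ ^ 2)).prod (ellipticMeasure m τ)))).withDensity
      (fun p => ENNReal.ofReal (Real.exp (-(q / (2 * (1 + τ)) * (z - p.1) ^ 2))) *
        ENNReal.ofReal (Real.exp (-(q / (1 + τ) / 2 * (p.2.1 ⬝ᵥ p.2.1))))) =
      (ENNReal.ofReal ((√(1 + q))⁻¹ * Real.exp (-(z ^ 2 * q / (2 * (1 + τ) * (1 + q))))) *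
        ENNReal.ofReal (√((1 + τ) / (1 + τ + q)) ^ m)) •
      ((gaussianReal (q * z / (1 + q)) ((1 + τ) / (1 + q)).toNNReal).prod
        ((gaussVec m (1 / (1 + q / (1 + τ)))).prod
          ((gaussVec m (1 - τ ^ 2)).prod (ellipticMeasure m τ)))) := by
    have hf1 : IsFiniteMeasure ((gaussVec m 1).withDensity fun b : Fin m → ℝ =>
        ENNReal.ofReal (Real.exp (-(q / (1 + τ) / 2 * (b ⬝ᵥ b))))) := by
      rw [gaussVec_withDensity_tilt m (by positivity)]
      exact Measure.smul_finite _ ENNReal.ofReal_ne_top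
    have e1 := prod_withDensity (μ := gaussianReal 0 (1 + τ).toNNReal)
      (ν := (gaussVec m 1).prod ((gaussVec m (1 - τ ^ 2)).prod (ellipticMeasure m τ))) mE1
      (mE2.comp measurable_fst)
    have e2 := prod_withDensity_left (μ := gaussVec m 1)
      (ν := (gaussVec m (1 - τ ^ 2)).prod (ellipticMeasure m τ)) mE2
    refine e1.symm.trans ?_
    rw [show ((fun b : Fin m → ℝ => ENNReal.ofReal (Real.exp (-(q / (1 + τ) / 2 * (b ⬝ᵥ b))))) ∘
      Prod.fst) = fun p : (Fin m → ℝ) × (Fin m → ℝ) × (Fin m → Fin m → ℝ) =>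
        ENNReal.ofReal (Real.exp (-(q / (1 + τ) / 2 * (p.1 ⬝ᵥ p.1)))) from rfl, ← e2,
      gaussVec_withDensity_tilt m (by positivity), gaussianReal_withDensity_tilt hτ1 hq,
      Measure.prod_smul_left, Measure.prod_smul_left, Measure.prod_smul_right, smul_smul, hv]
  rw [hmeas, lintegral_smul_measure, ← ofReal_integral_eq_lintegral_ofReal,
    integral_det_sq_tilted h0 h1 z hq, smul_eq_mul, ← ENNReal.ofReal_mul (by positivity),
    ← ENNReal.ofReal_mul (by positivity)]
  · exact ((hasMoments_det_assemble h0 h1 z (hasMoments_gaussianReal _ _) _).pow 2).integrable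
  · exact ae_of_all _ fun p => sq_nonneg _

end

/-! ### One-dimensional area formula with parameters -/

section area

variable {Θ : Type*} [TopologicalSpace Θ] [PolishSpace Θ] [MeasurableSpace Θ] [BorelSpace Θ]
  {μ : Measure Θ} [SigmaFinite μ] {Ω : Set (ℝ × Θ)} {h h' : ℝ × Θ → ℝ}

/-- The sum of `g` over the points of `A` in the fibre of `(z, θ) ↦ (h (z, θ), θ)`. -/
noncomputable def fiberSum (A : Set (ℝ × Θ)) (h : ℝ × Θ → ℝ) (g : ℝ × Θ → ℝ≥0∞) (p : ℝ × Θ) :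
    ℝ≥0∞ :=
  ∑' z : ℝ, {z | (z, p.2) ∈ A ∧ h (z, p.2) = p.1}.indicator (fun z => g (z, p.2)) z

omit [TopologicalSpace Θ] [PolishSpace Θ] [MeasurableSpace Θ] [BorelSpace Θ] in
theorem fiberSum_apply_of_injOn {A : Set (ℝ × Θ)} (hinj : A.InjOn fun p => (h p, p.2))
    (g : ℝ × Θ → ℝ≥0∞) {p : ℝ × Θ} (hp : p ∈ A) : fiberSum A h g (h p, p.2) = g p := by
  rw [fiberSum, tsum_eq_single p.1]
  · rw [Set.indicator_of_mem]
    exact ⟨hp, rfl⟩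
  · intro z hz
    rw [Set.indicator_of_notMem]
    rintro ⟨hA, hh⟩
    exact hz (congrArg Prod.fst (hinj hA hp (Prod.ext hh rfl)))

omit [TopologicalSpace Θ] [PolishSpace Θ] [MeasurableSpace Θ] [BorelSpace Θ] in
theorem fiberSum_eq_zero {A : Set (ℝ × Θ)} (g : ℝ × Θ → ℝ≥0∞) {p : ℝ × Θ}
    (hp : ∀ z, (z, p.2) ∈ A → h (z, p.2) ≠ p.1) : fiberSum A h g p = 0 := by
  rw [fiberSum, ENNReal.tsum_eq_zero]
  intro z
  rw [Set.indicator_of_notMem]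
  rintro ⟨hA, hh⟩
  exact hp z hA hh

/-- By Lusin–Souslin a continuous injective map on a Borel subset of a Polish space is a measurable
embedding, and the fibre sum is the extension of g by zero along it. -/
theorem measurable_fiberSum_of_injOn {A : Set (ℝ × Θ)} (hA : MeasurableSet A)
    (hc : ContinuousOn h A) (hinj : A.InjOn fun p => (h p, p.2)) {g : ℝ × Θ → ℝ≥0∞}
    (hg : Measurable g) : Measurable (fiberSum A h g) := by
  have he : MeasurableEmbedding (A.domRestrict fun p => (h p, p.2)) :=
    (hc.prodMk continuous_snd.continuousOn).measurableEmbedding hA hinj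
  have : fiberSum A h g =
      Function.extend (A.domRestrict fun p => (h p, p.2)) (fun p => g p) 0 := by
    funext p
    by_cases hp : ∃ x : A, A.domRestrict (fun p => (h p, p.2)) x = p
    · obtain ⟨x, rfl⟩ := hp
      rw [he.injective.extend_apply]
      exact fiberSum_apply_of_injOn hinj g x.2
    · rw [Function.extend_apply' _ _ _ hp]
      refine fiberSum_eq_zero g fun z hz hh => hp ⟨⟨_, hz⟩, ?_⟩
      exact Prod.ext hh rfl
  rw [this]
  exact he.measurable_extend (hg.comp measurable_subtype_coe) measurable_zero

/-- By Tonelli the parameter is frozen, and on each slice this is the change of variables for an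
injective differentiable function of one variable. Outside the image of the slice the fibre is
empty. -/
theorem lintegral_fiberSum_of_injOn {A : Set (ℝ × Θ)} (hA : MeasurableSet A)
    (hc : ContinuousOn h A) (hinj : A.InjOn fun p => (h p, p.2)) (hh' : Measurable h')
    (hd : ∀ p ∈ A, HasDerivAt (fun z => h (z, p.2)) (h' p) p.1) {g : ℝ × Θ → ℝ≥0∞}
    (hg : Measurable g) :
    ∫⁻ p, fiberSum A h g p ∂(volume.prod μ) =
      ∫⁻ p in A, ENNReal.ofReal |h' p| * g p ∂(volume.prod μ) := by
  have hmA := measurable_fiberSum_of_injOn hA hc hinj hg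
  have hF : Measurable (A.indicator fun p => ENNReal.ofReal |h' p| * g p) :=
    ((hh'.norm.ennreal_ofReal).mul hg).indicator hA
  rw [← lintegral_indicator hA, lintegral_prod_symm _ hmA.aemeasurable,
    lintegral_prod_symm _ hF.aemeasurable]
  refine lintegral_congr fun θ => ?_
  set S : Set ℝ := {z | (z, θ) ∈ A}
  have hS : MeasurableSet S := hA.preimage (measurable_id.prodMk measurable_const)
  have hcS : ContinuousOn (fun z => h (z, θ)) S :=
    hc.comp (continuous_id.prodMk continuous_const).continuousOn fun z hz => hz
  have hiS : S.InjOn fun z => h (z, θ) := fun z hz w hw hzw =>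
    congrArg Prod.fst (hinj hz hw (Prod.ext hzw rfl))
  have himg : MeasurableSet ((fun z => h (z, θ)) '' S) := hS.image_of_continuousOn_injOn hcS hiS
  calc ∫⁻ a, fiberSum A h g (a, θ) = ∫⁻ a in (fun z => h (z, θ)) '' S, fiberSum A h g (a, θ) := by
        rw [← lintegral_indicator himg]
        refine lintegral_congr fun a => ?_
        by_cases ha : a ∈ (fun z => h (z, θ)) '' S
        · rw [Set.indicator_of_mem ha]
        · rw [Set.indicator_of_notMem ha]
          exact fiberSum_eq_zero g fun z hz hh => ha ⟨z, hz, hh⟩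
    _ = ∫⁻ z in S, ENNReal.ofReal |h' (z, θ)| * fiberSum A h g (h (z, θ), θ) :=
        lintegral_image_eq_lintegral_abs_deriv_mul hS
          (fun z hz => (hd _ hz).hasDerivWithinAt) hiS fun a => fiberSum A h g (a, θ)
    _ = ∫⁻ z in S, ENNReal.ofReal |h' (z, θ)| * g (z, θ) := by
        refine setLIntegral_congr_fun hS fun z hz => ?_
        have := fiberSum_apply_of_injOn hinj g hz
        simp only at this
        simp only [this]
    _ = _ := by
        rw [← lintegral_indicator hS]
        rfl

-- On an interval times an open parameter set, two points of one fibre would by Rolle enclose a zero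
-- of the derivative. No continuity of the derivative is used.
omit [PolishSpace Θ] [MeasurableSpace Θ] [BorelSpace Θ] in
theorem exists_nhds_injOn (hΩ : IsOpen Ω)
    (hd : ∀ p ∈ Ω, HasDerivAt (fun z => h (z, p.2)) (h' p) p.1) (h0 : ∀ p ∈ Ω, h' p ≠ 0)
    {p : ℝ × Θ} (hp : p ∈ Ω) :
    ∃ U, IsOpen U ∧ p ∈ U ∧ U ⊆ Ω ∧ U.InjOn fun p => (h p, p.2) := by
  obtain ⟨u, v, hu, hv, hpu, hpv, huv⟩ := isOpen_prod_iff.mp hΩ p.1 p.2 hp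
  obtain ⟨ε, hε, hεu⟩ := Metric.isOpen_iff.mp hu p.1 hpu
  refine ⟨Metric.ball p.1 ε ×ˢ v, Metric.isOpen_ball.prod hv,
    ⟨Metric.mem_ball_self hε, hpv⟩, (Set.prod_mono hεu subset_rfl).trans huv, ?_⟩
  have key : ∀ θ ∈ v, ∀ x ∈ Metric.ball p.1 ε, ∀ y ∈ Metric.ball p.1 ε, x < y →
      h (x, θ) ≠ h (y, θ) := by
    intro θ hθ x hx y hy hxy heq
    have hmem : ∀ c ∈ Set.Icc x y, (c, θ) ∈ Ω := by
      intro c hc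
      refine huv ⟨hεu ?_, hθ⟩
      rw [Real.ball_eq_Ioo] at hx hy ⊢
      exact ⟨hx.1.trans_le hc.1, hc.2.trans_lt hy.2⟩
    obtain ⟨c, hc, hc0⟩ := exists_hasDerivAt_eq_zero (f := fun z => h (z, θ))
      (f' := fun z => h' (z, θ)) hxy
      (fun c hc => (hd _ (hmem c hc)).continuousAt.continuousWithinAt) heq
      (fun c hc => hd _ (hmem c (Set.Ioo_subset_Icc_self hc)))
    exact h0 _ (hmem c (Set.Ioo_subset_Icc_self hc)) hc0
  rintro ⟨x, θ⟩ hx ⟨y, θ'⟩ hy hxy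
  obtain ⟨hh, rfl⟩ := Prod.mk.inj hxy
  rcases lt_trichotomy x y with hlt | rfl | hlt
  · exact absurd hh (key θ hx.2 x hx.1 y hy.1 hlt)
  · rfl
  · exact absurd hh.symm (key θ hx.2 y hy.1 x hx.1 hlt)

/-- The one-dimensional area formula with parameters. -/
theorem lintegral_fiberSum [Nonempty Θ] (hΩ : IsOpen Ω) (hc : ContinuousOn h Ω)
    (hh' : Measurable h') (hd : ∀ p ∈ Ω, HasDerivAt (fun z => h (z, p.2)) (h' p) p.1)
    (h0 : ∀ p ∈ Ω, h' p ≠ 0) {g : ℝ × Θ → ℝ≥0∞} (hg : Measurable g) :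
    Measurable (fiberSum Ω h g) ∧ ∫⁻ p, fiberSum Ω h g p ∂(volume.prod μ) =
      ∫⁻ p in Ω, ENNReal.ofReal |h' p| * g p ∂(volume.prod μ) := by
  choose! U hUo hUm hUs hUi using fun p hp => exists_nhds_injOn (p := p) hΩ hd h0 hp
  obtain ⟨t, ht, htc, hcov⟩ := TopologicalSpace.countable_cover_nhdsWithin (f := U) (s := Ω)
    fun p hp => mem_nhdsWithin_of_mem_nhds ((hUo p hp).mem_nhds (hUm p hp))
  obtain ⟨e, he⟩ := Set.countable_iff_exists_subset_range.mp htc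
  classical
  -- The enumeration e need only cover the countable index set, so values outside Ω may occur; they
  -- receive the empty set.
  let B : ℕ → Set (ℝ × Θ) := fun k => if e k ∈ Ω then U (e k) else ∅
  have hBm : ∀ k, MeasurableSet (B k) := fun k => by
    by_cases hk : e k ∈ Ω
    · simp only [B, if_pos hk]; exact (hUo _ hk).measurableSet
    · simp only [B, if_neg hk]; exact MeasurableSet.empty
  have hBs : ∀ k, B k ⊆ Ω := fun k => by
    by_cases hk : e k ∈ Ω
    · simp only [B, if_pos hk]; exact hUs _ hk
    · simp only [B, if_neg hk]; exact Set.empty_subset _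
  have hBi : ∀ k, (B k).InjOn fun p => (h p, p.2) := fun k => by
    by_cases hk : e k ∈ Ω
    · simp only [B, if_pos hk]; exact hUi _ hk
    · simp only [B, if_neg hk]; exact Set.injOn_empty _
  have hBU : ⋃ k, B k = Ω := by
    refine subset_antisymm (Set.iUnion_subset hBs) fun p hp => ?_
    obtain ⟨x, hx, hpx⟩ := Set.mem_iUnion₂.mp (hcov hp)
    obtain ⟨k, rfl⟩ := he hx
    refine Set.mem_iUnion.mpr ⟨k, ?_⟩
    simp only [B, if_pos (ht hx)]
    exact hpx
  -- Disjoint pieces, so that each point of a fibre is counted once.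
  let A := disjointed B
  have hAm : ∀ k, MeasurableSet (A k) := fun k => .disjointed hBm k
  have hAs : ∀ k, A k ⊆ B k := fun k => disjointed_subset B k
  have hAd : Pairwise (Function.onFun Disjoint A) := disjoint_disjointed B
  have hAU : ⋃ k, A k = Ω := by rw [← hBU]; exact iUnion_disjointed
  have hsum : fiberSum Ω h g = fun p => ∑' k, fiberSum (A k) h g p := by
    funext p
    simp only [fiberSum]
    rw [ENNReal.tsum_comm]
    refine tsum_congr fun z => ?_
    by_cases hz : (z, p.2) ∈ Ω ∧ h (z, p.2) = p.1
    · rw [Set.indicator_of_mem (show z ∈ {z | (z, p.2) ∈ Ω ∧ h (z, p.2) = p.1} from hz)]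
      obtain ⟨k, hk⟩ := Set.mem_iUnion.mp (hAU.symm ▸ hz.1 : (z, p.2) ∈ ⋃ k, A k)
      rw [tsum_eq_single k, Set.indicator_of_mem]
      · exact ⟨hk, hz.2⟩
      · intro j hj
        rw [Set.indicator_of_notMem]
        rintro ⟨hj', -⟩
        exact Set.disjoint_left.mp (hAd hj) hj' hk
    · rw [Set.indicator_of_notMem (show z ∉ {z | (z, p.2) ∈ Ω ∧ h (z, p.2) = p.1} from hz), eq_comm,
        ENNReal.tsum_eq_zero]
      intro k
      rw [Set.indicator_of_notMem]
      rintro ⟨hk, hk'⟩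
      exact hz ⟨hBs k (hAs k hk), hk'⟩
  have hsub : ∀ k, A k ⊆ Ω := fun k => (hAs k).trans (hBs k)
  have hm : ∀ k, Measurable (fiberSum (A k) h g) := fun k =>
    measurable_fiberSum_of_injOn (hAm k) (hc.mono (hsub k)) ((hBi k).mono (hAs k)) hg
  rw [hsum]
  refine ⟨Measurable.tsum hm, ?_⟩
  rw [lintegral_tsum fun k => (hm k).aemeasurable]
  conv_rhs => rw [← hAU]
  rw [lintegral_iUnion hAm hAd]
  exact tsum_congr fun k => lintegral_fiberSum_of_injOn (hAm k) (hc.mono (hsub k))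
    ((hBi k).mono (hAs k)) hh' (fun p hp => hd p (hsub k hp)) hg

end area

/-! ### The corner as a function of the eigenvalue -/

/-- First row, first column and lower block of a matrix of size `n + 1`, without the corner. -/
abbrev Params (n : ℕ) : Type := (Fin n → ℝ) × (Fin n → ℝ) × (Fin n → Fin n → ℝ)

/-- `z - D`, where `D` is the lower block. -/
def lowerShift {n : ℕ} (p : ℝ × Params n) : Matrix (Fin n) (Fin n) ℝ :=
  p.1 • 1 - Matrix.of p.2.2.2

/-- The corner for which `z` is an eigenvalue of the matrix with the given remaining entries. -/
noncomputable def eigCorner {n : ℕ} (p : ℝ × Params n) : ℝ :=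
  p.1 - p.2.1 ⬝ᵥ ((lowerShift p)⁻¹ *ᵥ p.2.2.1)

/-- The derivative of `eigCorner` with respect to the eigenvalue. -/
noncomputable def eigCornerDeriv {n : ℕ} (p : ℝ × Params n) : ℝ :=
  1 + p.2.1 ⬝ᵥ ((lowerShift p)⁻¹ *ᵥ ((lowerShift p)⁻¹ *ᵥ p.2.2.1))

/-- The parameters at which the eigenvalue is regular. -/
def regularSet (n : ℕ) : Set (ℝ × Params n) :=
  {p | (lowerShift p).det ≠ 0 ∧ eigCornerDeriv p ≠ 0}

theorem nonsing_inv_eq_smul {n : ℕ} (W : Matrix (Fin n) (Fin n) ℝ) :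
    W⁻¹ = W.det⁻¹ • W.adjugate := by
  rw [Matrix.inv_def, Ring.inverse_eq_inv']

section

variable {n : ℕ}

theorem continuous_lowerShift : Continuous (lowerShift (n := n)) := by
  have : Continuous fun p : ℝ × Params n => Matrix.of p.2.2.2 :=
    continuous_snd.comp (continuous_snd.comp continuous_snd)
  exact (continuous_fst.smul continuous_const).sub this

theorem continuousOn_inv_lowerShift :
    ContinuousOn (fun p : ℝ × Params n => (lowerShift p)⁻¹) {p | (lowerShift p).det ≠ 0} := by
  simp only [nonsing_inv_eq_smul]
  exact (continuous_lowerShift.matrix_det.continuousOn.inv₀ fun p hp => hp).smul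
    continuous_lowerShift.matrix_adjugate.continuousOn

theorem continuousOn_eigCorner :
    ContinuousOn (eigCorner (n := n)) {p | (lowerShift p).det ≠ 0} := by
  have h := continuousOn_inv_lowerShift (n := n)
  rw [continuousOn_iff_continuous_domRestrict] at h ⊢
  have hp : Continuous fun p : {p : ℝ × Params n | (lowerShift p).det ≠ 0} =>
    (p : ℝ × Params n) := continuous_subtype_val
  exact (continuous_fst.comp hp).sub ((continuous_fst.comp (continuous_snd.comp hp)).dotProduct
    (h.matrix_mulVec (continuous_fst.comp (continuous_snd.comp (continuous_snd.comp hp)))))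

theorem continuousOn_eigCornerDeriv :
    ContinuousOn (eigCornerDeriv (n := n)) {p | (lowerShift p).det ≠ 0} := by
  have h := continuousOn_inv_lowerShift (n := n)
  rw [continuousOn_iff_continuous_domRestrict] at h ⊢
  have hp : Continuous fun p : {p : ℝ × Params n | (lowerShift p).det ≠ 0} =>
    (p : ℝ × Params n) := continuous_subtype_val
  exact continuous_const.add ((continuous_fst.comp (continuous_snd.comp hp)).dotProduct
    (h.matrix_mulVec (h.matrix_mulVec
      (continuous_fst.comp (continuous_snd.comp (continuous_snd.comp hp))))))

theorem isOpen_det_lowerShift : IsOpen {p : ℝ × Params n | (lowerShift p).det ≠ 0} :=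
  isOpen_ne.preimage continuous_lowerShift.matrix_det

theorem isOpen_regularSet : IsOpen (regularSet n) := by
  have := (continuousOn_eigCornerDeriv (n := n)).isOpen_inter_preimage isOpen_det_lowerShift
    (isOpen_ne (x := (0 : ℝ)))
  exact this

/-- The resolvent identity gives the difference quotient exactly, as 1 + b(w - D)⁻¹(z - D)⁻¹c, so
only continuity of the resolvent is needed for the limit. -/
theorem hasDerivAt_eigCorner {p : ℝ × Params n} (hp : (lowerShift p).det ≠ 0) :
    HasDerivAt (fun z => eigCorner (z, p.2)) (eigCornerDeriv p) p.1 := by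
  obtain ⟨z, θ⟩ := p
  have hU : ∀ᶠ w in nhds z, (lowerShift (w, θ)).det ≠ 0 :=
    (isOpen_det_lowerShift.preimage (continuous_id.prodMk continuous_const)).mem_nhds hp
  have hcont : ContinuousAt (fun w => θ.1 ⬝ᵥ ((lowerShift (w, θ))⁻¹ *ᵥ
      ((lowerShift (z, θ))⁻¹ *ᵥ θ.2.1))) z := by
    have h1 : ContinuousAt (fun w => (lowerShift (w, θ))⁻¹) z :=
      ContinuousAt.comp (f := fun w : ℝ => (w, θ))
        (continuousOn_inv_lowerShift.continuousAt (isOpen_det_lowerShift.mem_nhds hp))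
        (continuous_id.prodMk continuous_const).continuousAt
    have h2 : Continuous fun A : Matrix (Fin n) (Fin n) ℝ =>
        θ.1 ⬝ᵥ (A *ᵥ ((lowerShift (z, θ))⁻¹ *ᵥ θ.2.1)) :=
      continuous_const.dotProduct (continuous_id.matrix_mulVec continuous_const)
    exact h2.continuousAt.comp h1
  rw [hasDerivAt_iff_tendsto_slope]
  have hlim : Filter.Tendsto (fun w => 1 + θ.1 ⬝ᵥ ((lowerShift (w, θ))⁻¹ *ᵥ
      ((lowerShift (z, θ))⁻¹ *ᵥ θ.2.1))) (nhdsWithin z {z}ᶜ) (nhds (eigCornerDeriv (z, θ))) :=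
    (tendsto_const_nhds.add hcont.tendsto).mono_left nhdsWithin_le_nhds
  refine hlim.congr' ?_
  filter_upwards [nhdsWithin_le_nhds hU, self_mem_nhdsWithin] with w hw hwz
  have hwz' : w - z ≠ 0 := sub_ne_zero.mpr hwz
  have hres : (lowerShift (w, θ))⁻¹ - (lowerShift (z, θ))⁻¹ =
      (z - w) • ((lowerShift (w, θ))⁻¹ * (lowerShift (z, θ))⁻¹) := by
    have hd : lowerShift (z, θ) - lowerShift (w, θ) = (z - w) • 1 := by
      simp only [lowerShift]; rw [sub_smul]; abel
    have e1 : (lowerShift (w, θ))⁻¹ * lowerShift (w, θ) = 1 :=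
      nonsing_inv_mul _ (Ne.isUnit hw)
    have e2 : lowerShift (z, θ) * (lowerShift (z, θ))⁻¹ = 1 := mul_nonsing_inv _ (Ne.isUnit hp)
    calc (lowerShift (w, θ))⁻¹ - (lowerShift (z, θ))⁻¹
        = (lowerShift (w, θ))⁻¹ * (lowerShift (z, θ) - lowerShift (w, θ)) *
            (lowerShift (z, θ))⁻¹ := by
          rw [Matrix.mul_sub, Matrix.sub_mul, e1, Matrix.one_mul, Matrix.mul_assoc, e2,
            Matrix.mul_one]
      _ = _ := by rw [hd, Matrix.mul_smul, Matrix.mul_one, Matrix.smul_mul]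
  have hdiff : eigCorner (w, θ) - eigCorner (z, θ) = (w - z) * (1 + θ.1 ⬝ᵥ
      ((lowerShift (w, θ))⁻¹ *ᵥ ((lowerShift (z, θ))⁻¹ *ᵥ θ.2.1))) := by
    have : θ.1 ⬝ᵥ ((lowerShift (w, θ))⁻¹ *ᵥ θ.2.1) - θ.1 ⬝ᵥ ((lowerShift (z, θ))⁻¹ *ᵥ θ.2.1) =
        (z - w) * (θ.1 ⬝ᵥ ((lowerShift (w, θ))⁻¹ *ᵥ ((lowerShift (z, θ))⁻¹ *ᵥ θ.2.1))) := by
      rw [← dotProduct_sub, ← sub_mulVec, hres, smul_mulVec, dotProduct_smul, mulVec_mulVec,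
        smul_eq_mul]
    simp only [eigCorner]
    linear_combination -this
  rw [slope_def_field, hdiff, mul_div_cancel_left₀ _ hwz']

theorem det_sub_ofBlocks (z a : ℝ) (θ : Params n) :
    (z • 1 - Matrix.of (ofBlocks (a, θ))).det =
      (z - a) * (lowerShift (z, θ)).det - θ.1 ⬝ᵥ ((lowerShift (z, θ)).adjugate *ᵥ θ.2.1) := by
  have : Matrix.of (ofBlocks (a, θ)) = bordered a θ.1 θ.2.1 (Matrix.of θ.2.2) := rfl
  rw [this, smul_one_sub_bordered, det_bordered, mulVec_neg, neg_dotProduct_neg]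
  rfl

theorem det_sub_ofBlocks_eq (z a : ℝ) (θ : Params n) (hz : (lowerShift (z, θ)).det ≠ 0) :
    (z • 1 - Matrix.of (ofBlocks (a, θ))).det =
      (lowerShift (z, θ)).det * (eigCorner (z, θ) - a) := by
  rw [det_sub_ofBlocks, eigCorner, nonsing_inv_eq_smul, smul_mulVec, dotProduct_smul, smul_eq_mul]
  field_simp
  ring

/-- Clearing denominators gives an expression continuous also where z - D is singular; this is what
makes the set of bad points closed. -/
theorem det_sq_mul_eigCornerDeriv (p : ℝ × Params n) (hp : (lowerShift p).det ≠ 0) :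
    (lowerShift p).det ^ 2 * eigCornerDeriv p = (lowerShift p).det ^ 2 +
      p.2.1 ⬝ᵥ ((lowerShift p).adjugate *ᵥ ((lowerShift p).adjugate *ᵥ p.2.2.1)) := by
  rw [eigCornerDeriv, nonsing_inv_eq_smul]
  simp only [smul_mulVec, mulVec_smul, dotProduct_smul, smul_eq_mul]
  field_simp

theorem measurable_eigCornerDeriv : Measurable (eigCornerDeriv (n := n)) := by
  have : eigCornerDeriv (n := n) = fun p => 1 + (lowerShift p).det⁻¹ * ((lowerShift p).det⁻¹ *
      (p.2.1 ⬝ᵥ ((lowerShift p).adjugate *ᵥ ((lowerShift p).adjugate *ᵥ p.2.2.1)))) := by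
    funext p
    rw [eigCornerDeriv, nonsing_inv_eq_smul]
    simp only [smul_mulVec, mulVec_smul, dotProduct_smul, smul_eq_mul]
  rw [this]
  have hd := (continuous_lowerShift (n := n)).matrix_det.measurable.inv
  have hq : Continuous fun p : ℝ × Params n =>
      p.2.1 ⬝ᵥ ((lowerShift p).adjugate *ᵥ ((lowerShift p).adjugate *ᵥ p.2.2.1)) :=
    (continuous_fst.comp continuous_snd).dotProduct
      (continuous_lowerShift.matrix_adjugate.matrix_mulVec
        (continuous_lowerShift.matrix_adjugate.matrix_mulVec
          (continuous_fst.comp (continuous_snd.comp continuous_snd))))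
  exact (hd.mul (hd.mul hq.measurable)).const_add 1

theorem measurable_eigCorner : Measurable (eigCorner (n := n)) := by
  have : eigCorner (n := n) = fun p => p.1 - (lowerShift p).det⁻¹ *
      (p.2.1 ⬝ᵥ ((lowerShift p).adjugate *ᵥ p.2.2.1)) := by
    funext p
    rw [eigCorner, nonsing_inv_eq_smul]
    simp only [smul_mulVec, dotProduct_smul, smul_eq_mul]
  rw [this]
  have hd := (continuous_lowerShift (n := n)).matrix_det.measurable.inv
  have hq : Continuous fun p : ℝ × Params n =>
      p.2.1 ⬝ᵥ ((lowerShift p).adjugate *ᵥ p.2.2.1) :=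
    (continuous_fst.comp continuous_snd).dotProduct
      (continuous_lowerShift.matrix_adjugate.matrix_mulVec
          (continuous_fst.comp (continuous_snd.comp continuous_snd)))
  exact measurable_fst.sub (hd.mul hq.measurable)

end

/-! ### Almost every matrix has only regular real eigenvalues -/

/-- The projection of a closed set in a σ-compact space is a countable union of compact sets. This
handles the uncountable quantifier over z: properties of the form "no z is bad" are measurable, as
Fubini for null sets requires. -/
theorem measurableSet_forall_notMem_of_isClosed {Y Z : Type*} [TopologicalSpace Y] [T2Space Y]
    [SigmaCompactSpace Y] [MeasurableSpace Y] [BorelSpace Y] [TopologicalSpace Z]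
    [SigmaCompactSpace Z] {F : Set (Z × Y)} (hF : IsClosed F) :
    MeasurableSet {y | ∀ z, (z, y) ∉ F} := by
  have h1 : IsSigmaCompact (Prod.snd '' F) :=
    (isSigmaCompact_univ.of_isClosed_subset hF (Set.subset_univ _)).image continuous_snd
  have h2 : MeasurableSet (Prod.snd '' F) := by
    obtain ⟨K, hK, hU⟩ := h1
    rw [← hU]
    exact MeasurableSet.iUnion fun i => (hK i).isClosed.measurableSet
  convert h2.compl using 1
  ext y
  simp

theorem ae_prod_of_ae_ae_swap {α β : Type*} [MeasurableSpace α] [MeasurableSpace β]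
    {μ : Measure α} {ν : Measure β} [SFinite μ] [SFinite ν] {p : α × β → Prop}
    (hp : MeasurableSet {x | p x}) (h : ∀ᵐ y ∂ν, ∀ᵐ x ∂μ, p (x, y)) : ∀ᵐ x ∂μ.prod ν, p x := by
  rw [Measure.ae_prod_iff_ae_ae hp]
  rw [← Measure.ae_ae_comm] at h
  · exact h
  · exact hp

theorem ae_mulVec_ne_zero {m n : ℕ} {A : Matrix (Fin m) (Fin n) ℝ} (hA : A ≠ 0) :
    ∀ᵐ c : Fin n → ℝ, A *ᵥ c ≠ 0 := by
  have hk : LinearMap.ker A.mulVecLin ≠ ⊤ := by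
    rw [Ne, LinearMap.ker_eq_top]
    intro h
    apply hA
    ext i j
    have := congrFun (LinearMap.congr_fun h (Pi.single j 1)) i
    simpa using this
  have := Measure.addHaar_submodule (volume : Measure (Fin n → ℝ)) _ hk
  filter_upwards [measure_eq_zero_iff_ae_notMem.mp this] with c hc h
  exact hc (by simpa using h)

theorem ae_dotProduct_ne_zero {n : ℕ} {v : Fin n → ℝ} (hv : v ≠ 0) :
    ∀ᵐ b : Fin n → ℝ, b ⬝ᵥ v ≠ 0 := by
  have hA : (Matrix.of fun _ : Fin 1 => v) ≠ 0 := by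
    intro h
    exact hv (congrFun h 0)
  filter_upwards [ae_mulVec_ne_zero hA] with b hb h
  apply hb
  ext i
  simpa [Matrix.mulVec, dotProduct_comm] using h

theorem eval_charpoly_eq {n : ℕ} (X : Matrix (Fin n) (Fin n) ℝ) (z : ℝ) :
    X.charpoly.eval z = (z • 1 - X).det := by
  rw [eval_charpoly, smul_one_eq_diagonal]
  rfl

theorem countable_setOf_det_eq_zero {n : ℕ} (X : Matrix (Fin n) (Fin n) ℝ) :
    {z : ℝ | (z • 1 - X).det = 0}.Countable := by
  refine (X.charpoly.roots.toFinset.finite_toSet.subset fun z hz => ?_).countable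
  simp only [Finset.mem_coe, Multiset.mem_toFinset, Polynomial.mem_roots X.charpoly_monic.ne_zero,
    Polynomial.IsRoot.def, eval_charpoly_eq]
  exact hz

section

variable {n : ℕ}

/-- The lower block of almost every matrix is in general position with the first column. -/
theorem ae_adjugate_mulVec_ne_zero
    (hD : ∀ᵐ D : Fin n → Fin n → ℝ, ∀ z : ℝ, (z • 1 - Matrix.of D).det = 0 →
      (z • 1 - Matrix.of D).adjugate ≠ 0) :
    ∀ᵐ p : (Fin n → ℝ) × (Fin n → Fin n → ℝ), ∀ z : ℝ, (z • 1 - Matrix.of p.2).det = 0 →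
      (z • 1 - Matrix.of p.2).adjugate *ᵥ p.1 ≠ 0 := by
  refine ae_prod_of_ae_ae_swap ?_ ?_
  · have hW : Continuous fun x : ℝ × (Fin n → ℝ) × (Fin n → Fin n → ℝ) =>
        x.1 • (1 : Matrix (Fin n) (Fin n) ℝ) - Matrix.of x.2.2 :=
      (continuous_fst.smul continuous_const).sub (continuous_snd.comp continuous_snd)
    have hF : IsClosed {x : ℝ × (Fin n → ℝ) × (Fin n → Fin n → ℝ) |
        (x.1 • 1 - Matrix.of x.2.2).det = 0 ∧
          (x.1 • 1 - Matrix.of x.2.2).adjugate *ᵥ x.2.1 = 0} :=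
      (isClosed_eq hW.matrix_det continuous_const).inter (isClosed_eq
        (hW.matrix_adjugate.matrix_mulVec (continuous_fst.comp continuous_snd)) continuous_const)
    convert measurableSet_forall_notMem_of_isClosed hF using 1
    ext x
    simp
  · filter_upwards [hD] with D hD
    exact (ae_ball_iff (countable_setOf_det_eq_zero (Matrix.of D))).mpr
      fun z hz => ae_mulVec_ne_zero (hD z hz)

/-- For fixed c and D only countably many z make z - D singular, and for each of them the bad b form
a proper hyperplane. Hence generically no eigenvalue of D is an eigenvalue of the whole matrix. -/
theorem ae_dotProduct_adjugate_mulVec_ne_zero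
    (hD : ∀ᵐ D : Fin n → Fin n → ℝ, ∀ z : ℝ, (z • 1 - Matrix.of D).det = 0 →
      (z • 1 - Matrix.of D).adjugate ≠ 0) :
    ∀ᵐ θ : Params n, ∀ z : ℝ, (lowerShift (z, θ)).det = 0 →
      θ.1 ⬝ᵥ ((lowerShift (z, θ)).adjugate *ᵥ θ.2.1) ≠ 0 := by
  refine ae_prod_of_ae_ae_swap ?_ ?_
  · have hW := continuous_lowerShift (n := n)
    have hF : IsClosed {x : ℝ × Params n | (lowerShift x).det = 0 ∧
          x.2.1 ⬝ᵥ ((lowerShift x).adjugate *ᵥ x.2.2.1) = 0} :=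
      (isClosed_eq hW.matrix_det continuous_const).inter (isClosed_eq
        ((continuous_fst.comp continuous_snd).dotProduct (hW.matrix_adjugate.matrix_mulVec
          (continuous_fst.comp (continuous_snd.comp continuous_snd)))) continuous_const)
    convert measurableSet_forall_notMem_of_isClosed hF using 1
    ext x
    simp
  · filter_upwards [ae_adjugate_mulVec_ne_zero hD] with p hp
    exact (ae_ball_iff (countable_setOf_det_eq_zero (Matrix.of p.2))).mpr
      fun z hz => ae_dotProduct_ne_zero (hp z hz)

theorem notMem_regularSet_iff (p : ℝ × Params n) : p ∉ regularSet n ↔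
    (lowerShift p).det * ((lowerShift p).det ^ 2 +
      p.2.1 ⬝ᵥ ((lowerShift p).adjugate *ᵥ ((lowerShift p).adjugate *ᵥ p.2.2.1))) = 0 := by
  simp only [regularSet, Set.mem_ofPred_eq, not_and_or, not_not]
  by_cases h : (lowerShift p).det = 0
  · simp [h]
  · rw [← det_sq_mul_eigCornerDeriv p h]
    simp [h]

/-- For generic parameters there are two ways to fail. If det(z - D) = 0, then det(z - X) = -b adj(z
- D) c, which is nonzero, so z is no eigenvalue. If instead ∂h/∂z = 0, the corner is a critical
value of h, and by Sard's theorem the critical values form a null set. -/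
theorem ae_eigenvalue_mem_regularSet_of_adjugate_ne_zero
    (hD : ∀ᵐ D : Fin n → Fin n → ℝ, ∀ z : ℝ, (z • 1 - Matrix.of D).det = 0 →
      (z • 1 - Matrix.of D).adjugate ≠ 0) :
    ∀ᵐ x : ℝ × Params n, ∀ z : ℝ, (z • 1 - Matrix.of (ofBlocks x)).det = 0 →
      (z, x.2) ∈ regularSet n := by
  refine ae_prod_of_ae_ae_swap ?_ ?_
  · have hW : Continuous fun x : ℝ × ℝ × Params n => lowerShift (x.1, x.2.2) :=
      continuous_lowerShift.comp (continuous_fst.prodMk (continuous_snd.comp continuous_snd))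
    have hb : Continuous fun x : ℝ × ℝ × Params n => x.2.2.1 := by fun_prop
    have hc : Continuous fun x : ℝ × ℝ × Params n => x.2.2.2.1 := by fun_prop
    have hF : IsClosed {x : ℝ × ℝ × Params n | (x.1 - x.2.1) * (lowerShift (x.1, x.2.2)).det -
        x.2.2.1 ⬝ᵥ ((lowerShift (x.1, x.2.2)).adjugate *ᵥ x.2.2.2.1) = 0 ∧
        (lowerShift (x.1, x.2.2)).det * ((lowerShift (x.1, x.2.2)).det ^ 2 +
          x.2.2.1 ⬝ᵥ ((lowerShift (x.1, x.2.2)).adjugate *ᵥ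
            ((lowerShift (x.1, x.2.2)).adjugate *ᵥ x.2.2.2.1))) = 0} := by
      refine (isClosed_eq ?_ continuous_const).inter (isClosed_eq ?_ continuous_const)
      · exact ((continuous_fst.sub (continuous_fst.comp continuous_snd)).mul hW.matrix_det).sub
          (hb.dotProduct (hW.matrix_adjugate.matrix_mulVec hc))
      · exact hW.matrix_det.mul ((hW.matrix_det.pow 2).add (hb.dotProduct
          (hW.matrix_adjugate.matrix_mulVec (hW.matrix_adjugate.matrix_mulVec hc))))
    convert measurableSet_forall_notMem_of_isClosed hF using 1
    ext x
    simp only [Set.mem_ofPred_eq, not_and]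
    refine forall_congr' fun z => ?_
    rw [← det_sub_ofBlocks, ← not_iff_not.mpr (notMem_regularSet_iff (z, x.2)), not_not]
  · filter_upwards [ae_dotProduct_adjugate_mulVec_ne_zero hD] with θ hθ
    have hs : volume ((fun z => eigCorner (z, θ)) '' {z | (lowerShift (z, θ)).det ≠ 0 ∧
        eigCornerDeriv (z, θ) = 0}) = 0 := by
      refine addHaar_image_eq_zero_of_det_fderivWithin_eq_zero volume (f' := fun _ => 0)
        (fun z hz => ?_) fun z _ => by simp [ContinuousLinearMap.det]
      have h := (hasDerivAt_eigCorner (p := (z, θ)) hz.1).hasFDerivAt.hasFDerivWithinAt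
        (s := {z | (lowerShift (z, θ)).det ≠ 0 ∧ eigCornerDeriv (z, θ) = 0})
      rw [hz.2] at h
      simpa using h
    filter_upwards [measure_eq_zero_iff_ae_notMem.mp hs] with a ha z hz
    have hdet : (lowerShift (z, θ)).det ≠ 0 := by
      intro h0
      rw [det_sub_ofBlocks, h0] at hz
      exact hθ z h0 (by linarith)
    refine ⟨hdet, fun h => ha ⟨z, ⟨hdet, h⟩, ?_⟩⟩
    rw [det_sub_ofBlocks_eq z a θ hdet] at hz
    have := (mul_eq_zero.mp hz).resolve_left hdet
    simp only
    linarith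

/-- The induction that feeds the genericity hypothesis: regularity of the eigenvalue with respect to
the block of size n makes the (0,0) entry of the adjugate, det(z - D), nonzero in size n + 1. -/
theorem ae_adjugate_ne_zero (n : ℕ) :
    ∀ᵐ D : Fin n → Fin n → ℝ, ∀ z : ℝ, (z • 1 - Matrix.of D).det = 0 →
      (z • 1 - Matrix.of D).adjugate ≠ 0 := by
  induction n with
  | zero => exact ae_of_all _ fun D z hz => absurd hz (by simp)
  | succ n ih =>
    have h := ae_eigenvalue_mem_regularSet_of_adjugate_ne_zero ih
    rw [← (measurePreserving_ofBlocks n).map_eq]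
    have hm : MeasurableSet {D : Fin (n + 1) → Fin (n + 1) → ℝ | ∀ z : ℝ,
        (z • 1 - Matrix.of D).det = 0 → (z • 1 - Matrix.of D).adjugate ≠ 0} := by
      have hW : Continuous fun x : ℝ × (Fin (n + 1) → Fin (n + 1) → ℝ) =>
          x.1 • (1 : Matrix (Fin (n + 1)) (Fin (n + 1)) ℝ) - Matrix.of x.2 :=
        (continuous_fst.smul continuous_const).sub continuous_snd
      have hF : IsClosed {x : ℝ × (Fin (n + 1) → Fin (n + 1) → ℝ) |
          (x.1 • 1 - Matrix.of x.2).det = 0 ∧ (x.1 • 1 - Matrix.of x.2).adjugate = 0} :=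
        (isClosed_eq hW.matrix_det continuous_const).inter
          (isClosed_eq hW.matrix_adjugate continuous_const)
      convert measurableSet_forall_notMem_of_isClosed hF using 1
      ext x
      simp
    rw [ae_map_iff (measurePreserving_ofBlocks n).measurable.aemeasurable hm]
    filter_upwards [h] with x hx z hz hadj
    refine (hx z hz).1 ?_
    have h0 := congrFun (congrFun hadj 0) 0
    have : Matrix.of (ofBlocks x) = bordered x.1 x.2.1 x.2.2.1 (Matrix.of x.2.2.2) := rfl
    rw [this, smul_one_sub_bordered, adjugate_bordered_zero_zero] at h0
    exact h0

theorem ae_eigenvalue_mem_regularSet (n : ℕ) :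
    ∀ᵐ x : ℝ × Params n, ∀ z : ℝ, (z • 1 - Matrix.of (ofBlocks x)).det = 0 →
      (z, x.2) ∈ regularSet n :=
  ae_eigenvalue_mem_regularSet_of_adjugate_ne_zero (ae_adjugate_ne_zero n)

end

/-! ### Condition numbers and the sum over real eigenvalues -/

/-- The squared condition number of the eigenvalue `z` of `X`, in terms of `A = z - X`. -/
noncomputable def overlapSq {n : ℕ} (A : Matrix (Fin n) (Fin n) ℝ) : ℝ :=
  (A.adjugate * A.adjugateᵀ).trace / A.adjugate.trace ^ 2

/-- The value of `f` at an eigenvalue and its rescaled overlap, times the matrix density. -/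
noncomputable def weight {n : ℕ} (τ : ℝ) (f : ℝ × ℝ → ℝ≥0∞) (z : ℝ)
    (X : Matrix (Fin n) (Fin n) ℝ) : ℝ≥0∞ :=
  f (z, (overlapSq (z • 1 - X) - 1) / (1 - τ)) * ENNReal.ofReal (ellipticPDF n τ X)

section

variable {n : ℕ}

theorem continuous_smul_one_sub :
    Continuous fun p : ℝ × (Fin n → Fin n → ℝ) =>
      p.1 • (1 : Matrix (Fin n) (Fin n) ℝ) - Matrix.of p.2 :=
  (continuous_fst.smul continuous_const).sub continuous_snd

theorem measurable_overlapSq :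
    Measurable fun p : ℝ × (Fin n → Fin n → ℝ) =>
      overlapSq (p.1 • (1 : Matrix (Fin n) (Fin n) ℝ) - Matrix.of p.2) := by
  have h := (continuous_smul_one_sub (n := n)).matrix_adjugate
  exact (h.matrix_mul h.matrix_transpose).matrix_trace.measurable.div
    (h.matrix_trace.pow 2).measurable

theorem measurable_weight (τ : ℝ) {f : ℝ × ℝ → ℝ≥0∞} (hf : Measurable f) :
    Measurable fun p : ℝ × (Fin n → Fin n → ℝ) => weight τ f p.1 (Matrix.of p.2) :=
  (hf.comp (measurable_fst.prodMk ((measurable_overlapSq.sub_const 1).div_const _))).mul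
    ((continuous_ellipticPDF n τ).measurable.comp measurable_snd).ennreal_ofReal

theorem overlapSq_conj {O : Matrix (Fin n) (Fin n) ℝ} (hO : O * Oᵀ = 1)
    (A : Matrix (Fin n) (Fin n) ℝ) : overlapSq (O * A * Oᵀ) = overlapSq A := by
  have hO' : Oᵀ * O = 1 := mul_eq_one_comm.mp hO
  have h1 : (O * A.adjugate * Oᵀ).trace = A.adjugate.trace := by
    rw [Matrix.trace_mul_comm, ← Matrix.mul_assoc, hO', Matrix.one_mul]
  have h2 : (O * A.adjugate * Oᵀ * (O * A.adjugate * Oᵀ)ᵀ).trace =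
      (A.adjugate * A.adjugateᵀ).trace := by
    have : O * A.adjugate * Oᵀ * (O * A.adjugate * Oᵀ)ᵀ =
        O * (A.adjugate * A.adjugateᵀ) * Oᵀ := by
      simp only [transpose_mul, transpose_transpose, Matrix.mul_assoc]
      rw [← Matrix.mul_assoc Oᵀ O, hO', Matrix.one_mul]
    rw [this, Matrix.trace_mul_comm, ← Matrix.mul_assoc, hO', Matrix.one_mul]
  rw [overlapSq, adjugate_conj_orthogonal hO, h1, h2, overlapSq]

theorem weight_conj {τ : ℝ} (f : ℝ × ℝ → ℝ≥0∞) (z : ℝ) {O : Matrix (Fin n) (Fin n) ℝ}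
    (hO : O * Oᵀ = 1) (X : Matrix (Fin n) (Fin n) ℝ) :
    weight τ f z (O * X * Oᵀ) = weight τ f z X := by
  rw [weight, smul_one_sub_conj hO, overlapSq_conj hO, ellipticPDF_conj τ hO, weight]

/-- With one-dimensional left and right eigenspaces the normalisation l·r = 1 leaves only reciprocal
rescalings, which do not change (l·l)(r·r). The set under the infimum is therefore a singleton. -/
theorem condNumber_eq {X : Matrix (Fin n) (Fin n) ℝ} {z : ℝ} {l r : Fin n → ℝ}
    (hr : X *ᵥ r = z • r) (hl : Xᵀ *ᵥ l = z • l) (hlr : l ⬝ᵥ r ≠ 0)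
    (hr' : ∀ v, X *ᵥ v = z • v → ∃ t : ℝ, v = t • r)
    (hl' : ∀ v, Xᵀ *ᵥ v = z • v → ∃ t : ℝ, v = t • l) :
    condNumber X z ^ 2 = (l ⬝ᵥ l) * (r ⬝ᵥ r) / (l ⬝ᵥ r) ^ 2 := by
  have hset : {κ : ℝ | ∃ l r : Fin n → ℝ, X.mulVec r = z • r ∧ X.transpose.mulVec l = z • l ∧
      l ⬝ᵥ r = 1 ∧ κ = √((l ⬝ᵥ l) * (r ⬝ᵥ r))} =
      {√((l ⬝ᵥ l) * (r ⬝ᵥ r) / (l ⬝ᵥ r) ^ 2)} := by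
    ext κ
    simp only [Set.mem_ofPred_eq, Set.mem_singleton_iff]
    constructor
    · rintro ⟨l₁, r₁, h1, h2, h3, rfl⟩
      obtain ⟨s, rfl⟩ := hr' _ h1
      obtain ⟨t, rfl⟩ := hl' _ h2
      simp only [smul_dotProduct, dotProduct_smul, smul_eq_mul] at h3 ⊢
      congr 1
      rw [eq_div_iff (pow_ne_zero 2 hlr)]
      linear_combination (l ⬝ᵥ l) * (r ⬝ᵥ r) * (t * (s * l ⬝ᵥ r) + 1) * h3
    · rintro rfl
      refine ⟨(l ⬝ᵥ r)⁻¹ • l, r, hr, ?_, ?_, ?_⟩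
      · rw [mulVec_smul, hl, smul_comm]
      · rw [smul_dotProduct, smul_eq_mul, inv_mul_cancel₀ hlr]
      · simp only [smul_dotProduct, dotProduct_smul, smul_eq_mul]
        congr 1
        field_simp
  have h0 : ∀ v : Fin n → ℝ, 0 ≤ v ⬝ᵥ v := fun v =>
    Finset.sum_nonneg fun i _ => mul_self_nonneg _
  rw [condNumber, hset, csInf_singleton, Real.sq_sqrt]
  exact div_nonneg (mul_nonneg (h0 l) (h0 r)) (sq_nonneg _)

theorem overlapSq_eq_of_adjugate {A : Matrix (Fin n) (Fin n) ℝ} {l r : Fin n → ℝ} {s : ℝ}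
    (hs : s ≠ 0) (hA : A.adjugate = s • vecMulVec r l) :
    overlapSq A = (l ⬝ᵥ l) * (r ⬝ᵥ r) / (l ⬝ᵥ r) ^ 2 := by
  have h1 : (vecMulVec r l).trace = l ⬝ᵥ r := by
    rw [trace_vecMulVec, dotProduct_comm]
  have h2 : (vecMulVec r l * (vecMulVec r l)ᵀ).trace = (l ⬝ᵥ l) * (r ⬝ᵥ r) := by
    rw [transpose_vecMulVec, vecMulVec_mul_vecMulVec, trace_vecMulVec, dotProduct_smul,
      smul_eq_mul]
  rw [overlapSq, hA, transpose_smul, Matrix.smul_mul, Matrix.mul_smul, trace_smul, trace_smul,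
    trace_smul, h1, h2]
  simp only [smul_eq_mul]
  field_simp

end

section

variable {n : ℕ}

theorem of_ofBlocks (a : ℝ) (θ : Params n) :
    Matrix.of (ofBlocks (a, θ)) = bordered a θ.1 θ.2.1 (Matrix.of θ.2.2) := rfl

/-- The lower rows of the eigenvector equation determine the remaining coordinates from the first
one, and the value chosen for the corner makes the top row hold automatically. -/
theorem bordered_mulVec_eq_smul_iff {a z : ℝ} {b c : Fin n → ℝ} {D : Matrix (Fin n) (Fin n) ℝ}
    (hW : (z • 1 - D).det ≠ 0) (ha : a = z - b ⬝ᵥ ((z • 1 - D)⁻¹ *ᵥ c)) (v : Fin (n + 1) → ℝ) :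
    bordered a b c D *ᵥ v = z • v ↔
      v = v 0 • (Fin.cons 1 ((z • 1 - D)⁻¹ *ᵥ c) : Fin (n + 1) → ℝ) := by
  have hu : IsUnit (z • 1 - D).det := Ne.isUnit hW
  obtain ⟨x, y, rfl⟩ : ∃ x y, v = (Fin.cons x y : Fin (n + 1) → ℝ) := ⟨v 0, Fin.tail v, by simp⟩
  have hy : x • c + D *ᵥ y = z • y ↔ y = x • ((z • 1 - D)⁻¹ *ᵥ c) := by
    have : x • c + D *ᵥ y = z • y ↔ (z • 1 - D) *ᵥ y = x • c := by
      rw [sub_mulVec, smul_mulVec, one_mulVec, sub_eq_iff_eq_add, eq_comm]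
    rw [this]
    constructor
    · intro h
      rw [← mulVec_smul, ← h, mulVec_mulVec, nonsing_inv_mul _ hu, one_mulVec]
    · intro h
      rw [h, mulVec_smul, mulVec_mulVec, mul_nonsing_inv _ hu, one_mulVec]
  have e1 : z • (Fin.cons x y : Fin (n + 1) → ℝ) = Fin.cons (z * x) (z • y) := by
    ext i; refine Fin.cases ?_ (fun i => ?_) i <;> simp
  have e2 : ∀ w : Fin n → ℝ, (Fin.cons x y : Fin (n + 1) → ℝ) 0 •
      (Fin.cons 1 w : Fin (n + 1) → ℝ) = Fin.cons x (x • w) := by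
    intro w; ext i; refine Fin.cases ?_ (fun i => ?_) i <;> simp
  rw [bordered_mulVec_cons, e1, e2, Fin.cons_inj, Fin.cons_inj, hy]
  refine ⟨fun h => ⟨rfl, h.2⟩, fun h => ⟨?_, h.2⟩⟩
  rw [h.2, dotProduct_smul, smul_eq_mul, ha]
  ring

theorem dotProduct_cons_cons (x x' : ℝ) (y y' : Fin n → ℝ) :
    (Fin.cons x y : Fin (n + 1) → ℝ) ⬝ᵥ (Fin.cons x' y' : Fin (n + 1) → ℝ) =
      x * x' + y ⬝ᵥ y' := by
  simp [dotProduct, Fin.sum_univ_succ]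

/-- At a regular eigenvalue both eigenspaces are lines, spanned by r and l with first coordinate 1,
and l·r = ∂h/∂z ≠ 0. Columns of the adjugate are right eigenvectors and its rows left ones, so the
adjugate is det(z - D) r lᵀ. The infimum is thereby replaced by a rational, hence measurable,
function of z and X. -/
theorem condNumber_sq_eq_overlapSq {z : ℝ} {θ : Params n} (h : (z, θ) ∈ regularSet n) :
    condNumber (Matrix.of (ofBlocks (eigCorner (z, θ), θ))) z ^ 2 =
      overlapSq (z • 1 - Matrix.of (ofBlocks (eigCorner (z, θ), θ))) := by
  obtain ⟨b, c, D⟩ := θ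
  obtain ⟨hW, hd⟩ := h
  rw [of_ofBlocks]
  set a := eigCorner (z, b, c, D) with ha
  set X := bordered a b c (Matrix.of D) with hX
  have hW' : (z • 1 - Matrix.of D).det ≠ 0 := hW
  have ha' : a = z - b ⬝ᵥ ((z • 1 - Matrix.of D)⁻¹ *ᵥ c) := rfl
  have hWt : (z • 1 - (Matrix.of D)ᵀ) = (z • 1 - Matrix.of D)ᵀ := by simp
  have hWt' : (z • 1 - (Matrix.of D)ᵀ).det ≠ 0 := by rwa [hWt, det_transpose]
  have hat : a = z - c ⬝ᵥ ((z • 1 - (Matrix.of D)ᵀ)⁻¹ *ᵥ b) := by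
    rw [ha', hWt, ← transpose_nonsing_inv, mulVec_transpose, dotProduct_comm c,
      ← dotProduct_mulVec]
  have hXt : Xᵀ = bordered a c b (Matrix.of D)ᵀ := transpose_bordered a b c _
  set r : Fin (n + 1) → ℝ := Fin.cons 1 ((z • 1 - Matrix.of D)⁻¹ *ᵥ c) with hr
  set l : Fin (n + 1) → ℝ := Fin.cons 1 ((z • 1 - (Matrix.of D)ᵀ)⁻¹ *ᵥ b) with hl
  have hker : ∀ v, X *ᵥ v = z • v ↔ v = v 0 • r := bordered_mulVec_eq_smul_iff hW' ha'
  have hkert : ∀ v, Xᵀ *ᵥ v = z • v ↔ v = v 0 • l := by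
    rw [hXt]; exact bordered_mulVec_eq_smul_iff hWt' hat
  have hlr : l ⬝ᵥ r ≠ 0 := by
    have : l ⬝ᵥ r = eigCornerDeriv (z, b, c, D) := by
      rw [hl, hr, dotProduct_cons_cons, eigCornerDeriv, hWt, ← transpose_nonsing_inv,
        mulVec_transpose, ← dotProduct_mulVec, one_mul]
      rfl
    rwa [this]
  have hdet : (z • 1 - X).det = 0 := by
    have := det_sub_ofBlocks_eq z a (b, c, D) hW
    rw [of_ofBlocks] at this
    rw [hX, this, ha, sub_self, mul_zero]
  have h00 : (z • 1 - X).adjugate 0 0 = (z • 1 - Matrix.of D).det := by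
    rw [hX, smul_one_sub_bordered, adjugate_bordered_zero_zero]
  have hadj : (z • 1 - X).adjugate = (z • 1 - Matrix.of D).det • vecMulVec r l := by
    have hcol : ∀ j, (fun i => (z • 1 - X).adjugate i j) = (z • 1 - X).adjugate 0 j • r := by
      intro j
      refine (hker _).mp ?_
      have := congrArg (fun M => Mᵀ j) (mul_adjugate (z • 1 - X))
      rw [hdet, zero_smul] at this
      have h1 : (z • 1 - X) *ᵥ (fun i => (z • 1 - X).adjugate i j) = 0 := by
        ext i
        exact congrFun this i
      rw [sub_mulVec, smul_mulVec, one_mulVec, sub_eq_zero] at h1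
      exact h1.symm
    have hrow : (z • 1 - X).adjugate 0 = (z • 1 - X).adjugate 0 0 • l := by
      refine (hkert _).mp ?_
      have := congrArg (fun M => M 0) (adjugate_mul (z • 1 - X))
      rw [hdet, zero_smul] at this
      have h1 : (z • 1 - X)ᵀ *ᵥ (z • 1 - X).adjugate 0 = 0 := by
        rw [mulVec_transpose]
        exact this
      rw [transpose_sub, transpose_smul, transpose_one, sub_mulVec, smul_mulVec, one_mulVec,
        sub_eq_zero] at h1
      exact h1.symm
    ext i j
    have e1 := congrFun (hcol j) i
    have e2 := congrFun hrow j
    simp only [Pi.smul_apply, smul_eq_mul] at e1 e2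
    rw [e1, e2, h00, Matrix.smul_apply, vecMulVec_apply, smul_eq_mul]
    ring
  rw [condNumber_eq ((hker r).mpr (by simp [hr])) ((hkert l).mpr (by simp [hl])) hlr
    (fun v hv => ⟨_, (hker v).mp hv⟩) (fun v hv => ⟨_, (hkert v).mp hv⟩),
    overlapSq_eq_of_adjugate hW' hadj]

/-- Near a root z the characteristic polynomial is det(w - D)(h(w) - a), so its derivative at z is
det(z - D) ∂h/∂z ≠ 0. -/
theorem nodup_roots_charpoly {x : ℝ × Params n}
    (hx : ∀ z : ℝ, (z • 1 - Matrix.of (ofBlocks x)).det = 0 → (z, x.2) ∈ regularSet n) :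
    (Matrix.of (ofBlocks x)).charpoly.roots.Nodup := by
  set p := (Matrix.of (ofBlocks x)).charpoly with hp
  have hp0 : p ≠ 0 := (Matrix.of (ofBlocks x)).charpoly_monic.ne_zero
  rw [Multiset.nodup_iff_count_le_one]
  intro z
  rw [Polynomial.count_roots]
  by_contra! h
  obtain ⟨hr, hd⟩ := (Polynomial.one_lt_rootMultiplicity_iff_isRoot hp0).mp h
  have hz : (z • 1 - Matrix.of (ofBlocks x)).det = 0 := by rw [← eval_charpoly_eq]; exact hr
  obtain ⟨hW, hD⟩ := hx z hz
  have ha : eigCorner (z, x.2) - x.1 = 0 := by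
    have := det_sub_ofBlocks_eq z x.1 x.2 hW
    rw [hz] at this
    exact (mul_eq_zero.mp this.symm).resolve_left hW
  have hU : ∀ᶠ w in nhds z, (lowerShift (w, x.2)).det ≠ 0 :=
    (isOpen_det_lowerShift.preimage (continuous_id.prodMk continuous_const)).mem_nhds hW
  have hev : (fun w => p.eval w) =ᶠ[nhds z]
      fun w => (lowerShift (w, x.2)).det * (eigCorner (w, x.2) - x.1) := by
    filter_upwards [hU] with w hw
    rw [hp, eval_charpoly_eq, ← det_sub_ofBlocks_eq w x.1 x.2 hw]
  have hdet : DifferentiableAt ℝ (fun w => (lowerShift (w, x.2)).det) z := by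
    have : (fun w => (lowerShift (w, x.2)).det) =
        fun w => (Matrix.of x.2.2.2).charpoly.eval w := by
      funext w; rw [eval_charpoly_eq]; rfl
    rw [this]
    exact Polynomial.differentiableAt _
  have h1 := (hdet.hasDerivAt.mul ((hasDerivAt_eigCorner (p := (z, x.2)) hW).sub_const x.1))
  have h2 := (p.hasDerivAt z).congr_of_eventuallyEq hev.symm
  have h3 := h1.unique h2
  rw [ha, mul_zero, zero_add, hd.eq_zero] at h3
  exact (mul_ne_zero hW hD) h3

theorem realEigenvalueSum_ofBlocks {x : ℝ × Params n}
    (hx : ∀ z : ℝ, (z • 1 - Matrix.of (ofBlocks x)).det = 0 → (z, x.2) ∈ regularSet n)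
    (τ : ℝ) (f : ℝ × ℝ → ℝ≥0∞) :
    realEigenvalueSum τ f (Matrix.of (ofBlocks x)) *
      ENNReal.ofReal (ellipticPDF (n + 1) τ (Matrix.of (ofBlocks x))) =
      fiberSum (regularSet n) eigCorner
        (fun p => weight τ f p.1 (Matrix.of (ofBlocks (eigCorner p, p.2)))) x := by
  have hnd := nodup_roots_charpoly hx
  have hmem : ∀ z, z ∈ (Matrix.of (ofBlocks x)).charpoly.roots ↔
      (z, x.2) ∈ regularSet n ∧ eigCorner (z, x.2) = x.1 := by
    intro z
    rw [Polynomial.mem_roots (Matrix.of (ofBlocks x)).charpoly_monic.ne_zero,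
      Polynomial.IsRoot.def, eval_charpoly_eq]
    constructor
    · intro h
      have hr := hx z h
      refine ⟨hr, ?_⟩
      have := det_sub_ofBlocks_eq z x.1 x.2 hr.1
      rw [h] at this
      exact sub_eq_zero.mp ((mul_eq_zero.mp this.symm).resolve_left hr.1)
    · rintro ⟨h1, h2⟩
      have := det_sub_ofBlocks_eq z x.1 x.2 h1.1
      rwa [h2, sub_self, mul_zero] at this
  have hsum : realEigenvalueSum τ f (Matrix.of (ofBlocks x)) =
      ∑ z ∈ (Matrix.of (ofBlocks x)).charpoly.roots.toFinset,
        f (z, rescaledOverlap τ (Matrix.of (ofBlocks x)) z) := by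
    rw [realEigenvalueSum, Finset.sum_eq_multiset_sum, Multiset.toFinset_val, hnd.dedup]
  rw [hsum, Finset.sum_mul, fiberSum,
    tsum_eq_sum (s := (Matrix.of (ofBlocks x)).charpoly.roots.toFinset)]
  · refine Finset.sum_congr rfl fun z hz => ?_
    obtain ⟨h1, h2⟩ := (hmem z).mp (Multiset.mem_toFinset.mp hz)
    rw [Set.indicator_of_mem (show z ∈ {z | (z, x.2) ∈ regularSet n ∧ eigCorner (z, x.2) = x.1}
      from ⟨h1, h2⟩)]
    have h3 := condNumber_sq_eq_overlapSq h1
    rw [h2] at h3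
    simp only [weight, rescaledOverlap]
    rw [h2, ← h3]
  · intro z hz
    refine Set.indicator_of_notMem (fun h => hz ?_) _
    exact Multiset.mem_toFinset.mpr ((hmem z).mpr h)

theorem measurableEmbedding_ofBlocks : MeasurableEmbedding (ofBlocks (n := n)) := by
  refine (measurePreserving_ofBlocks n).measurable.measurableEmbedding ?_
  rintro ⟨a, b, c, D⟩ ⟨a', b', c', D'⟩ h
  have h' : ∀ i j, bordered a b c (Matrix.of D) i j = bordered a' b' c' (Matrix.of D') i j :=
    fun i j => congrFun (congrFun h i) j
  have e1 : a = a' := h' 0 0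
  have e2 : b = b' := funext fun j => h' 0 j.succ
  have e3 : c = c' := funext fun i => h' i.succ 0
  have e4 : D = D' := funext fun i => funext fun j => h' i.succ j.succ
  rw [e1, e2, e3, e4]

theorem ellipticPDF_pos (n : ℕ) {τ : ℝ} (h0 : 0 ≤ τ) (h1 : τ < 1)
    (X : Matrix (Fin n) (Fin n) ℝ) : 0 < ellipticPDF n τ X := by
  have : 0 < 1 - τ ^ 2 := by nlinarith
  unfold ellipticPDF
  positivity

/-- The sum over real eigenvalues as an integral over eigenvalues and the entries different from
the corner. -/
theorem lintegral_realEigenvalueSum {τ : ℝ} (h0 : 0 ≤ τ) (h1 : τ < 1) {f : ℝ × ℝ → ℝ≥0∞}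
    (hf : Measurable f) :
    AEMeasurable (fun X : Fin (n + 1) → Fin (n + 1) → ℝ => realEigenvalueSum τ f (Matrix.of X))
        (ellipticMeasure (n + 1) τ) ∧
      ∫⁻ X, realEigenvalueSum τ f (Matrix.of X) ∂(ellipticMeasure (n + 1) τ) =
        ∫⁻ p in regularSet n, ENNReal.ofReal |eigCornerDeriv p| *
          weight τ f p.1 (Matrix.of (ofBlocks (eigCorner p, p.2))) := by
  set g : ℝ × Params n → ℝ≥0∞ :=
    fun p => weight τ f p.1 (Matrix.of (ofBlocks (eigCorner p, p.2))) with hg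
  have hgm : Measurable g := (measurable_weight τ hf).comp (measurable_fst.prodMk
    ((measurePreserving_ofBlocks n).measurable.comp (measurable_eigCorner.prodMk measurable_snd)))
  obtain ⟨hm, hint⟩ := lintegral_fiberSum (μ := (volume : Measure (Params n)))
    isOpen_regularSet (continuousOn_eigCorner.mono fun p hp => hp.1) measurable_eigCornerDeriv
    (fun p hp => hasDerivAt_eigCorner hp.1) (fun p hp => hp.2) hgm
  have hpdf : Measurable fun X : Fin (n + 1) → Fin (n + 1) → ℝ =>
      ENNReal.ofReal (ellipticPDF (n + 1) τ (Matrix.of X)) :=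
    (continuous_ellipticPDF (n + 1) τ).measurable.ennreal_ofReal
  have hpos : ∀ X : Fin (n + 1) → Fin (n + 1) → ℝ,
      ENNReal.ofReal (ellipticPDF (n + 1) τ (Matrix.of X)) ≠ 0 := fun X => by
    simpa using ellipticPDF_pos (n + 1) h0 h1 (Matrix.of X)
  have hae : (fun x : ℝ × Params n => realEigenvalueSum τ f (Matrix.of (ofBlocks x)) *
      ENNReal.ofReal (ellipticPDF (n + 1) τ (Matrix.of (ofBlocks x)))) =ᵐ[volume]
      fiberSum (regularSet n) eigCorner g := by
    filter_upwards [ae_eigenvalue_mem_regularSet n] with x hx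
    exact realEigenvalueSum_ofBlocks hx τ f
  have hprod : AEMeasurable (fun X : Fin (n + 1) → Fin (n + 1) → ℝ =>
      realEigenvalueSum τ f (Matrix.of X) *
        ENNReal.ofReal (ellipticPDF (n + 1) τ (Matrix.of X))) volume := by
    rw [← (measurePreserving_ofBlocks n).map_eq, measurableEmbedding_ofBlocks.aemeasurable_map_iff]
    exact hm.aemeasurable.congr hae.symm
  -- The fibre sum controls only the product with the density; since the density is positive and
  -- finite it can be divided out.
  have hS : AEMeasurable (fun X : Fin (n + 1) → Fin (n + 1) → ℝ =>
      realEigenvalueSum τ f (Matrix.of X)) volume := by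
    refine (hprod.div hpdf.aemeasurable).congr (ae_of_all _ fun X => ?_)
    exact ENNReal.mul_div_cancel_right (hpos X) ENNReal.ofReal_ne_top
  refine ⟨hS.mono_ac (withDensity_absolutelyContinuous _ _), ?_⟩
  rw [ellipticMeasure, lintegral_withDensity_eq_lintegral_mul₀ hpdf.aemeasurable hS]
  simp only [Pi.mul_apply, mul_comm (ENNReal.ofReal (ellipticPDF _ _ _))]
  rw [← (measurePreserving_ofBlocks n).lintegral_comp_emb measurableEmbedding_ofBlocks,
    lintegral_congr_ae hae]
  exact hint

end

/-! ### Eigenvector coordinates and reduction to block triangular form -/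

theorem lintegral_rotate {α β γ : Type*} [MeasureSpace α] [MeasureSpace β] [MeasureSpace γ]
    [SFinite (volume : Measure α)] [SFinite (volume : Measure β)] [SFinite (volume : Measure γ)]
    {K : α × β × γ → ℝ≥0∞} (hK : Measurable K) :
    ∫⁻ a, ∫⁻ b, ∫⁻ c, K (a, b, c) = ∫⁻ c, ∫⁻ a, ∫⁻ b, K (a, b, c) := by
  have h1 : ∀ a, ∫⁻ b, ∫⁻ c, K (a, b, c) = ∫⁻ c, ∫⁻ b, K (a, b, c) := fun a =>
    lintegral_lintegral_swap (hK.comp (measurable_const.prodMk measurable_id)).aemeasurable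
  simp only [h1]
  refine lintegral_lintegral_swap (Measurable.aemeasurable ?_)
  refine Measurable.lintegral_prod_right' (f := fun x : (α × γ) × β => K (x.1.1, x.2, x.1.2)) ?_
  exact hK.comp ((measurable_fst.comp measurable_fst).prodMk
    (measurable_snd.prodMk (measurable_snd.comp measurable_fst)))

section

variable {n : ℕ}

theorem lintegral_eq_abs_det_mul_lintegral_mulVec {A : Matrix (Fin n) (Fin n) ℝ} (hA : A.det ≠ 0)
    {F : (Fin n → ℝ) → ℝ≥0∞} (hF : Measurable F) :
    ∫⁻ x, F x = ENNReal.ofReal |A.det| * ∫⁻ y, F (A *ᵥ y) := by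
  have hm : Measurable (Matrix.toLin' A) :=
    (LinearMap.continuous_of_finiteDimensional (Matrix.toLin' A)).measurable
  have h1 : ∫⁻ y, F (A *ᵥ y) = ∫⁻ x, F x ∂(volume.map (Matrix.toLin' A)) := by
    rw [lintegral_map hF hm]
    simp only [Matrix.toLin'_apply]
  rw [h1, Real.map_matrix_volume_pi_eq_smul_volume_pi hA, lintegral_smul_measure, smul_eq_mul,
    ← mul_assoc, ← ENNReal.ofReal_mul (abs_nonneg _), ← abs_mul, mul_inv_cancel₀ hA, abs_one,
    ENNReal.ofReal_one, one_mul]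

theorem ae_det_lowerShift_ne_zero : ∀ᵐ p : ℝ × Params n, (lowerShift p).det ≠ 0 := by
  refine ae_prod_of_ae_ae_swap isOpen_det_lowerShift.measurableSet (ae_of_all _ fun θ => ?_)
  exact measure_eq_zero_iff_ae_notMem.mp
    ((countable_setOf_det_eq_zero (Matrix.of θ.2.2)).measure_zero volume)

theorem ae_ae_det_ne_zero (n : ℕ) :
    ∀ᵐ z : ℝ, ∀ᵐ D : Fin n → Fin n → ℝ, (z • 1 - Matrix.of D).det ≠ 0 := by
  refine Measure.ae_ae_of_ae_prod (p := fun x : ℝ × (Fin n → Fin n → ℝ) =>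
    (x.1 • 1 - Matrix.of x.2).det ≠ 0) (ae_prod_of_ae_ae_swap ?_ (ae_of_all _ fun D => ?_))
  · exact (isOpen_ne.preimage continuous_smul_one_sub.matrix_det).measurableSet
  · exact measure_eq_zero_iff_ae_notMem.mp
      ((countable_setOf_det_eq_zero (Matrix.of D)).measure_zero volume)

/-- For c = (z - D)y the derivative simplifies to 1 + b(z - D)⁻¹y, and the matrix determinant lemma
applies to z - D + y bᵀ. -/
theorem abs_det_mul_abs_eigCornerDeriv {z : ℝ} {b y : Fin n → ℝ} {D : Fin n → Fin n → ℝ}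
    (hD : (z • 1 - Matrix.of D).det ≠ 0) :
    |(z • 1 - Matrix.of D).det| *
        |eigCornerDeriv (z, b, (z • 1 - Matrix.of D) *ᵥ y, D)| =
      |(z • 1 - Matrix.of (D - fun i j => y i * b j)).det| := by
  have hu : IsUnit (z • 1 - Matrix.of D).det := Ne.isUnit hD
  have e1 : z • 1 - Matrix.of (D - fun i j => y i * b j) =
      (z • 1 - Matrix.of D) + replicateCol Unit y * replicateRow Unit b := by
    ext i j
    simp [Matrix.mul_apply, Matrix.sub_apply]
    ring
  have e2 : eigCornerDeriv (z, b, (z • 1 - Matrix.of D) *ᵥ y, D) =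
      1 + b ⬝ᵥ ((z • 1 - Matrix.of D)⁻¹ *ᵥ y) := by
    simp only [eigCornerDeriv, lowerShift]
    rw [mulVec_mulVec _ _ (z • 1 - Matrix.of D), nonsing_inv_mul _ hu, one_mulVec]
  rw [← abs_mul, e1, det_add_replicateCol_mul_replicateRow hu, e2]
  congr 2
  rw [det_unique]
  simp [Matrix.mul_apply, dotProduct, mulVec, Finset.mul_sum, Finset.sum_mul, mul_assoc]
  rw [Finset.sum_comm]

theorem eigCorner_mulVec {z : ℝ} {b y : Fin n → ℝ} {D : Fin n → Fin n → ℝ}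
    (hD : (z • 1 - Matrix.of D).det ≠ 0) :
    eigCorner (z, b, (z • 1 - Matrix.of D) *ᵥ y, D) = z - b ⬝ᵥ y := by
  simp only [eigCorner, lowerShift]
  rw [mulVec_mulVec, nonsing_inv_mul _ (Ne.isUnit hD), one_mulVec]

variable {G : ℝ → Matrix (Fin (n + 1)) (Fin (n + 1)) ℝ → ℝ≥0∞}

/-- The column c is replaced by y = (z - D)⁻¹c, so that (1, y) is the eigenvector, and D is then
translated by y bᵀ. The two Jacobian factors merge into the single determinant |det(z - D)| of the
translated block. -/
theorem setLIntegral_regularSet (hG : Measurable fun p : ℝ × (Fin (n + 1) → Fin (n + 1) → ℝ) =>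
      G p.1 (Matrix.of p.2)) :
    ∫⁻ p in regularSet n, ENNReal.ofReal |eigCornerDeriv p| *
        G p.1 (Matrix.of (ofBlocks (eigCorner p, p.2))) =
      ∫⁻ z : ℝ, ∫⁻ y : Fin n → ℝ, ∫⁻ b : Fin n → ℝ, ∫⁻ D : Fin n → Fin n → ℝ,
        ENNReal.ofReal |(z • 1 - Matrix.of D).det| *
          G z (Matrix.of (ofBlocks (z - b ⬝ᵥ y, b,
            (z • 1 - Matrix.of (D + fun i j => y i * b j)) *ᵥ y, D + fun i j => y i * b j))) := by
  -- Up to a null set, a point outside the regular set has vanishing derivative, so the restriction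
  -- may be dropped.
  have hA : ∫⁻ p in regularSet n, ENNReal.ofReal |eigCornerDeriv p| *
        G p.1 (Matrix.of (ofBlocks (eigCorner p, p.2))) =
      ∫⁻ p : ℝ × Params n, ENNReal.ofReal |eigCornerDeriv p| *
        G p.1 (Matrix.of (ofBlocks (eigCorner p, p.2))) := by
    rw [← lintegral_indicator isOpen_regularSet.measurableSet]
    refine lintegral_congr_ae ?_
    filter_upwards [ae_det_lowerShift_ne_zero] with p hp
    by_cases h : p ∈ regularSet n
    · rw [Set.indicator_of_mem h]
    · rw [Set.indicator_of_notMem h]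
      have : eigCornerDeriv p = 0 := by
        by_contra h'
        exact h ⟨hp, h'⟩
      simp [this]
  have hm : Measurable fun p : ℝ × Params n => ENNReal.ofReal |eigCornerDeriv p| *
      G p.1 (Matrix.of (ofBlocks (eigCorner p, p.2))) :=
    (continuous_abs.measurable.comp measurable_eigCornerDeriv).ennreal_ofReal.mul
      (hG.comp (measurable_fst.prodMk ((measurePreserving_ofBlocks n).measurable.comp
        (measurable_eigCorner.prodMk measurable_snd))))
  rw [hA, Measure.volume_eq_prod, lintegral_prod _ hm.aemeasurable]
  refine lintegral_congr_ae ?_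
  filter_upwards [ae_ae_det_ne_zero n] with z hz
  have hmz : Measurable fun θ : Params n => ENNReal.ofReal |eigCornerDeriv (z, θ)| *
      G z (Matrix.of (ofBlocks (eigCorner (z, θ), θ))) :=
    hm.comp (measurable_const.prodMk measurable_id)
  have hK : Measurable fun x : (Fin n → ℝ) × (Fin n → Fin n → ℝ) × (Fin n → ℝ) =>
      ENNReal.ofReal |(z • 1 - Matrix.of (x.2.1 - fun i j => x.2.2 i * x.1 j)).det| *
        G z (Matrix.of (ofBlocks (z - x.1 ⬝ᵥ x.2.2, x.1,
          (z • 1 - Matrix.of x.2.1) *ᵥ x.2.2, x.2.1))) := by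
    have c1 : Continuous fun x : (Fin n → ℝ) × (Fin n → Fin n → ℝ) × (Fin n → ℝ) =>
        z • (1 : Matrix (Fin n) (Fin n) ℝ) - Matrix.of (x.2.1 - fun i j => x.2.2 i * x.1 j) := by
      refine continuous_const.sub ?_
      show Continuous fun x : (Fin n → ℝ) × (Fin n → Fin n → ℝ) × (Fin n → ℝ) =>
        (x.2.1 - fun i j => x.2.2 i * x.1 j)
      fun_prop
    have c2 : Continuous fun x : (Fin n → ℝ) × (Fin n → Fin n → ℝ) × (Fin n → ℝ) =>
        (z • 1 - Matrix.of x.2.1) *ᵥ x.2.2 := by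
      refine Continuous.matrix_mulVec (continuous_const.sub ?_) (by fun_prop)
      exact continuous_fst.comp continuous_snd
    refine (continuous_abs.comp c1.matrix_det).measurable.ennreal_ofReal.mul
      (hG.comp (measurable_const.prodMk ((measurePreserving_ofBlocks n).measurable.comp ?_)))
    refine Continuous.measurable ?_
    refine Continuous.prodMk (continuous_const.sub ?_) (continuous_fst.prodMk (c2.prodMk
      (continuous_fst.comp continuous_snd)))
    exact continuous_fst.dotProduct (continuous_snd.comp continuous_snd)
  calc ∫⁻ θ : Params n, ENNReal.ofReal |eigCornerDeriv (z, θ)| *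
        G z (Matrix.of (ofBlocks (eigCorner (z, θ), θ)))
      = ∫⁻ b : Fin n → ℝ, ∫⁻ D : Fin n → Fin n → ℝ, ∫⁻ c : Fin n → ℝ,
          ENNReal.ofReal |eigCornerDeriv (z, b, c, D)| *
            G z (Matrix.of (ofBlocks (eigCorner (z, b, c, D), b, c, D))) := by
        rw [Measure.volume_eq_prod, lintegral_prod _ hmz.aemeasurable]
        refine lintegral_congr fun b => ?_
        rw [Measure.volume_eq_prod, lintegral_prod_symm]
        exact (hmz.comp (measurable_const.prodMk measurable_id)).aemeasurable
    _ = ∫⁻ b : Fin n → ℝ, ∫⁻ D : Fin n → Fin n → ℝ, ∫⁻ y : Fin n → ℝ,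
          ENNReal.ofReal |(z • 1 - Matrix.of (D - fun i j => y i * b j)).det| *
            G z (Matrix.of (ofBlocks (z - b ⬝ᵥ y, b, (z • 1 - Matrix.of D) *ᵥ y, D))) := by
        refine lintegral_congr fun b => lintegral_congr_ae ?_
        filter_upwards [hz] with D hD
        rw [lintegral_eq_abs_det_mul_lintegral_mulVec hD, ← lintegral_const_mul']
        · refine lintegral_congr fun y => ?_
          rw [← mul_assoc, ← ENNReal.ofReal_mul (abs_nonneg _),
            abs_det_mul_abs_eigCornerDeriv hD, eigCorner_mulVec hD]
        · exact ENNReal.ofReal_ne_top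
        · exact hmz.comp (measurable_const.prodMk (measurable_id.prodMk measurable_const))
    _ = ∫⁻ y : Fin n → ℝ, ∫⁻ b : Fin n → ℝ, ∫⁻ D : Fin n → Fin n → ℝ,
          ENNReal.ofReal |(z • 1 - Matrix.of (D - fun i j => y i * b j)).det| *
            G z (Matrix.of (ofBlocks (z - b ⬝ᵥ y, b, (z • 1 - Matrix.of D) *ᵥ y, D))) :=
        lintegral_rotate hK
    _ = _ := by
        refine lintegral_congr fun y => lintegral_congr fun b => ?_
        rw [← lintegral_add_right_eq_self _ (fun i j => y i * b j : Fin n → Fin n → ℝ)]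
        simp only [add_sub_cancel_right]

end

section

variable {n : ℕ}

/-- A matrix with eigenvector `(1, y)` is orthogonally conjugate to a block triangular one. -/
theorem exists_orthogonal_conj_eq_bordered (y : Fin n → ℝ) :
    ∃ (O : Matrix (Fin (n + 1)) (Fin (n + 1)) ℝ) (s : Fin n → ℝ) (K : Matrix (Fin n) (Fin n) ℝ),
      O * Oᵀ = 1 ∧ K.det ≠ 0 ∧ √(1 + y ⬝ᵥ y) * |K.det| = 1 ∧
      ∀ (z : ℝ) (b : Fin n → ℝ) (D : Matrix (Fin n) (Fin n) ℝ),
        O * bordered (z - b ⬝ᵥ y) b ((z • 1 - (D + vecMulVec y b)) *ᵥ y) (D + vecMulVec y b) * Oᵀ =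
          bordered z ((√(1 + y ⬝ᵥ y) • b + (s ᵥ* D - z • s)) ᵥ* K⁻¹) 0 (K * D * K⁻¹) := by
  obtain ⟨O, hO, -, hOu⟩ := exists_orthogonal_mulVec_eq (Fin.cons 1 y : Fin (n + 1) → ℝ)
  rw [dotProduct_cons_cons, one_mul] at hOu
  -- L is unimodular with first column (1, y) and satisfies XL = L·T, where T has corner z, row b,
  -- zero column and block D. As O sends (1, y) to ρe₀, the product R = OL is upper block
  -- triangular, and OXOᵀ = RTR⁻¹. Comparing determinants gives ρ|det K| = 1.
  set ρ := √(1 + y ⬝ᵥ y)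
  set L : Matrix (Fin (n + 1)) (Fin (n + 1)) ℝ := bordered 1 0 y 1 with hL
  have hLcol : ∀ i, (O * L) i 0 = (O *ᵥ (Fin.cons 1 y : Fin (n + 1) → ℝ)) i := by
    intro i
    simp only [Matrix.mul_apply, mulVec, dotProduct]
    refine Finset.sum_congr rfl fun k _ => ?_
    refine Fin.cases ?_ (fun k => ?_) k <;> simp [hL]
  have hR : O * L = bordered ρ (fun j => (O * L) 0 j.succ) 0
      ((O * L).submatrix Fin.succ Fin.succ) := by
    conv_lhs => rw [eq_bordered (O * L)]
    rw [hLcol, hOu]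
    congr 1
    · simp
    · ext i
      rw [hLcol, hOu]
      simp
  set s : Fin n → ℝ := fun j => (O * L) 0 j.succ
  set K : Matrix (Fin n) (Fin n) ℝ := (O * L).submatrix Fin.succ Fin.succ
  have hdetL : L.det = 1 := by rw [hL, det_bordered]; simp
  have hdetR : |(O * L).det| = 1 := by
    rw [det_mul, hdetL, mul_one, abs_det_of_orthogonal hO]
  have hρK : ρ * |K.det| = 1 := by
    rw [hR, det_bordered, mulVec_zero, dotProduct_zero, sub_zero, abs_mul,
      abs_of_nonneg (Real.sqrt_nonneg _)] at hdetR
    exact hdetR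
  have hK : K.det ≠ 0 := by
    intro h
    simp [h] at hρK
  refine ⟨O, s, K, hO, hK, hρK, fun z b D => ?_⟩
  have hu : IsUnit K.det := Ne.isUnit hK
  set X := bordered (z - b ⬝ᵥ y) b ((z • 1 - (D + vecMulVec y b)) *ᵥ y) (D + vecMulVec y b)
    with hX
  have hXL : X * L = L * bordered z b 0 D := by
    rw [hX, hL, bordered_mul, bordered_mul]
    congr 1
    · simp
    · simp
    · simp [sub_mulVec, add_mulVec, smul_mulVec]
    · simp [add_comm]
  have hO' : Oᵀ * O = 1 := mul_eq_one_comm.mp hO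
  have hRu : IsUnit (O * L).det := by
    refine Ne.isUnit fun h => ?_
    simp [h] at hdetR
  have h1 : O * X * Oᵀ * (O * L) = O * L * bordered z b 0 D := by
    calc O * X * Oᵀ * (O * L) = O * X * (Oᵀ * O) * L := by simp only [Matrix.mul_assoc]
      _ = _ := by rw [hO', Matrix.mul_one, Matrix.mul_assoc, hXL, ← Matrix.mul_assoc]
  have h2 : bordered z ((ρ • b + (s ᵥ* D - z • s)) ᵥ* K⁻¹) 0 (K * D * K⁻¹) * (O * L) =
      O * L * bordered z b 0 D := by
    rw [hR, bordered_mul, bordered_mul]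
    congr 1
    · simp [mul_comm]
    · rw [vecMul_vecMul, nonsing_inv_mul _ hu, vecMul_one]
      abel
    · simp
    · rw [Matrix.mul_assoc (K * D), nonsing_inv_mul _ hu, Matrix.mul_one]
      ext; simp
  rw [← mul_nonsing_inv_cancel_right _ (O * X * Oᵀ) hRu, h1, ← h2,
    mul_nonsing_inv_cancel_right _ _ hRu]

/-- The linear part ρK⁻ᵀ has determinant of modulus ρⁿ/|det K| = ρⁿ⁺¹, by ρ|det K| = 1; the
translation costs nothing. -/
theorem lintegral_smul_vecMul_add {K : Matrix (Fin n) (Fin n) ℝ} (hK : K.det ≠ 0) {ρ : ℝ}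
    (hρ : 0 < ρ) (hρK : ρ * |K.det| = 1) (v : Fin n → ℝ) {F : (Fin n → ℝ) → ℝ≥0∞}
    (hF : Measurable F) :
    ∫⁻ b, F ((ρ • b + v) ᵥ* K⁻¹) = ENNReal.ofReal (ρ⁻¹ ^ (n + 1)) * ∫⁻ w, F w := by
  have hdet : (ρ • K⁻¹ᵀ).det = ρ ^ n * K.det⁻¹ := by
    rw [det_smul, det_transpose, det_nonsing_inv, Ring.inverse_eq_inv', Fintype.card_fin]
  have hA : (ρ • K⁻¹ᵀ).det ≠ 0 := by
    rw [hdet]; exact mul_ne_zero (pow_ne_zero _ hρ.ne') (inv_ne_zero hK)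
  have hKi : |K.det|⁻¹ = ρ := inv_eq_of_mul_eq_one_left hρK
  have habs : |(ρ • K⁻¹ᵀ).det| = ρ ^ (n + 1) := by
    rw [hdet, abs_mul, abs_inv, hKi, abs_of_pos (pow_pos hρ n), pow_succ]
  have hv : ∀ b : Fin n → ℝ, (ρ • b + v) ᵥ* K⁻¹ = (ρ • K⁻¹ᵀ) *ᵥ b + v ᵥ* K⁻¹ := by
    intro b
    rw [add_vecMul, smul_vecMul, smul_mulVec, mulVec_transpose]
  simp only [hv]
  rw [← lintegral_add_right_eq_self F (v ᵥ* K⁻¹),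
    lintegral_eq_abs_det_mul_lintegral_mulVec hA (F := fun x => F (x + v ᵥ* K⁻¹))
      (hF.comp (measurable_add_const _)), habs,
    ← mul_assoc, ← ENNReal.ofReal_mul (by positivity), ← mul_pow, inv_mul_cancel₀ hρ.ne', one_pow,
    ENNReal.ofReal_one, one_mul]

theorem of_conjBy (K : Matrix (Fin n) (Fin n) ℝ) (D : Fin n → Fin n → ℝ) :
    Matrix.of (conjBy K D) = K * Matrix.of D * K⁻¹ := rfl

variable {G : ℝ → Matrix (Fin (n + 1)) (Fin (n + 1)) ℝ → ℝ≥0∞}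

/-- After the rotation b occurs only in the new row, so the integral over b becomes one over w with
factor ρ^(-(n+1)). Conjugation by K preserves both Lebesgue measure and det(z - D), so K and the
auxiliary vector s disappear. -/
theorem lintegral_eigenvector_fiber
    (hG : Measurable fun p : ℝ × (Fin (n + 1) → Fin (n + 1) → ℝ) => G p.1 (Matrix.of p.2))
    (hGO : ∀ (z : ℝ) (O X : Matrix (Fin (n + 1)) (Fin (n + 1)) ℝ), O * Oᵀ = 1 →
      G z (O * X * Oᵀ) = G z X) (z : ℝ) (y : Fin n → ℝ) :
    ∫⁻ b : Fin n → ℝ, ∫⁻ D : Fin n → Fin n → ℝ, ENNReal.ofReal |(z • 1 - Matrix.of D).det| *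
        G z (Matrix.of (ofBlocks (z - b ⬝ᵥ y, b,
          (z • 1 - Matrix.of (D + fun i j => y i * b j)) *ᵥ y, D + fun i j => y i * b j))) =
      ENNReal.ofReal ((√(1 + y ⬝ᵥ y))⁻¹ ^ (n + 1)) *
        ∫⁻ D : Fin n → Fin n → ℝ, ENNReal.ofReal |(z • 1 - Matrix.of D).det| *
          ∫⁻ w : Fin n → ℝ, G z (Matrix.of (ofBlocks (z, w, 0, D))) := by
  obtain ⟨O, s, K, hO, hK, hρK, hconj⟩ := exists_orthogonal_conj_eq_bordered y
  have hρ : 0 < √(1 + y ⬝ᵥ y) := by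
    rcases (Real.sqrt_nonneg (1 + y ⬝ᵥ y)).eq_or_lt with h | h
    · rw [← h, zero_mul] at hρK; exact absurd hρK zero_ne_one
    · exact h
  set ρ := √(1 + y ⬝ᵥ y)
  have hw : Measurable fun x : (Fin n → ℝ) × (Fin n → Fin n → ℝ) =>
      G z (Matrix.of (ofBlocks (z, x.1, 0, x.2))) :=
    hG.comp (measurable_const.prodMk ((measurePreserving_ofBlocks n).measurable.comp
      (measurable_const.prodMk (measurable_fst.prodMk (measurable_const.prodMk measurable_snd)))))
  have hdet : Measurable fun D : Fin n → Fin n → ℝ =>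
      ENNReal.ofReal |(z • 1 - Matrix.of D).det| := by
    have := (continuous_smul_one_sub (n := n)).matrix_det.comp
      (continuous_const (y := z).prodMk continuous_id)
    exact (continuous_abs.comp this).measurable.ennreal_ofReal
  have hvec : Continuous fun x : (Fin n → ℝ) × (Fin n → Fin n → ℝ) =>
      (ρ • x.1 + (s ᵥ* Matrix.of x.2 - z • s)) ᵥ* K⁻¹ := by
    have h1 : Continuous fun x : (Fin n → ℝ) × (Fin n → Fin n → ℝ) => Matrix.of x.2 :=
      continuous_snd
    have h2 : Continuous fun x : (Fin n → ℝ) × (Fin n → Fin n → ℝ) => s ᵥ* Matrix.of x.2 :=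
      continuous_const.matrix_vecMul h1
    exact ((continuous_fst.const_smul ρ).add (h2.sub continuous_const)).matrix_vecMul
      continuous_const
  have hcm := (measurePreserving_conjBy hK).measurable
  calc _ = ∫⁻ b : Fin n → ℝ, ∫⁻ D : Fin n → Fin n → ℝ,
        ENNReal.ofReal |(z • 1 - Matrix.of D).det| * G z (Matrix.of (ofBlocks
          (z, (ρ • b + (s ᵥ* Matrix.of D - z • s)) ᵥ* K⁻¹, 0, conjBy K D))) := by
        refine lintegral_congr fun b => lintegral_congr fun D => ?_
        congr 1
        rw [← hGO z O _ hO, of_ofBlocks, of_ofBlocks, of_conjBy]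
        exact congrArg (G z) (hconj z b (Matrix.of D))
    _ = ∫⁻ D : Fin n → Fin n → ℝ, ∫⁻ b : Fin n → ℝ,
        ENNReal.ofReal |(z • 1 - Matrix.of D).det| * G z (Matrix.of (ofBlocks
          (z, (ρ • b + (s ᵥ* Matrix.of D - z • s)) ᵥ* K⁻¹, 0, conjBy K D))) := by
        refine lintegral_lintegral_swap (Measurable.aemeasurable ?_)
        exact (hdet.comp measurable_snd).mul
          (hw.comp (hvec.measurable.prodMk (hcm.comp measurable_snd)))
    _ = ∫⁻ D : Fin n → Fin n → ℝ, ENNReal.ofReal (ρ⁻¹ ^ (n + 1)) *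
        (ENNReal.ofReal |(z • 1 - Matrix.of (conjBy K D)).det| *
          ∫⁻ w : Fin n → ℝ, G z (Matrix.of (ofBlocks (z, w, 0, conjBy K D)))) := by
        refine lintegral_congr fun D => ?_
        rw [lintegral_const_mul' _ _ ENNReal.ofReal_ne_top,
          lintegral_smul_vecMul_add hK hρ hρK (s ᵥ* Matrix.of D - z • s)
            (F := fun w => G z (Matrix.of (ofBlocks (z, w, 0, conjBy K D))))
            (hw.comp (measurable_id.prodMk measurable_const))]
        have : z • 1 - Matrix.of (conjBy K D) = K * (z • 1 - Matrix.of D) * K⁻¹ := by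
          rw [of_conjBy, Matrix.mul_sub, Matrix.sub_mul, Matrix.mul_smul, Matrix.mul_one,
            Matrix.smul_mul, mul_nonsing_inv _ (Ne.isUnit hK)]
        rw [this, det_conj ((Matrix.isUnit_iff_isUnit_det K).mpr (Ne.isUnit hK))]
        ring
    _ = _ := by
        rw [lintegral_const_mul' _ _ ENNReal.ofReal_ne_top]
        congr 1
        refine (measurePreserving_conjBy hK).lintegral_comp
          (f := fun D => ENNReal.ofReal |(z • 1 - Matrix.of D).det| *
            ∫⁻ w : Fin n → ℝ, G z (Matrix.of (ofBlocks (z, w, 0, D)))) ?_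
        refine hdet.mul (Measurable.lintegral_prod_right'
          (f := fun x : (Fin n → Fin n → ℝ) × (Fin n → ℝ) =>
            G z (Matrix.of (ofBlocks (z, x.2, 0, x.1)))) ?_)
        exact hw.comp measurable_swap

theorem lintegral_row_substitution
    (hG : Measurable fun p : ℝ × (Fin (n + 1) → Fin (n + 1) → ℝ) => G p.1 (Matrix.of p.2))
    {z : ℝ} {D : Fin n → Fin n → ℝ} (hD : (z • 1 - Matrix.of D).det ≠ 0) :
    ENNReal.ofReal |(z • 1 - Matrix.of D).det| *
        ∫⁻ w : Fin n → ℝ, G z (Matrix.of (ofBlocks (z, w, 0, D))) =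
      ∫⁻ u : Fin n → ℝ, ENNReal.ofReal ((z • 1 - Matrix.of D).det ^ 2) *
        G z (Matrix.of (ofBlocks (z, u ᵥ* (z • 1 - Matrix.of D), 0, D))) := by
  have hDt : (z • 1 - Matrix.of D)ᵀ.det ≠ 0 := by rwa [det_transpose]
  have hw : Measurable fun w : Fin n → ℝ => G z (Matrix.of (ofBlocks (z, w, 0, D))) :=
    hG.comp (measurable_const.prodMk ((measurePreserving_ofBlocks n).measurable.comp
      (measurable_const.prodMk (measurable_id.prodMk measurable_const))))
  rw [lintegral_eq_abs_det_mul_lintegral_mulVec hDt hw, det_transpose, ← mul_assoc,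
    ← ENNReal.ofReal_mul (abs_nonneg _), abs_mul_abs_self, ← sq,
    lintegral_const_mul' _ _ ENNReal.ofReal_ne_top]
  simp only [mulVec_transpose]

end

/-! ### Density and overlap of block triangular matrices -/

section

variable {n : ℕ}

/-- The factor by which the density of a block triangular matrix with corner `z` and vanishing row
differs from the density of its lower block. -/
noncomputable def cornerFactor (n : ℕ) (τ z : ℝ) : ℝ :=
  (√(2 * Real.pi * (1 + τ)))⁻¹ * Real.exp (-(z * z) / (2 * (1 + τ))) *
    ((√(2 * Real.pi * 1))⁻¹ ^ n * (√(2 * Real.pi * (1 - τ ^ 2)))⁻¹ ^ n)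

theorem cornerFactor_nonneg (n : ℕ) (τ z : ℝ) : 0 ≤ cornerFactor n τ z := by
  unfold cornerFactor
  positivity

/-- A vanishing column means e = -τw in `ellipticPDF_assemble`, and 1/2 + τ²/(2(1 - τ²)) = 1/(2(1 -
τ²)). -/
theorem ellipticPDF_triangular {τ : ℝ} (h0 : 0 ≤ τ) (h1 : τ < 1) (z : ℝ) (w : Fin n → ℝ)
    (D : Matrix (Fin n) (Fin n) ℝ) :
    ellipticPDF (n + 1) τ (bordered z w 0 D) = cornerFactor n τ z *
      Real.exp (-((w ⬝ᵥ w) / (2 * (1 - τ ^ 2)))) * ellipticPDF n τ D := by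
  have hp : 0 < 1 - τ ^ 2 := by nlinarith
  have h := ellipticPDF_assemble h0 h1 z w (-(τ • w)) D
  rw [add_neg_cancel] at h
  rw [h, cornerFactor]
  have he : Real.exp (-((w ⬝ᵥ w) / (2 * (1 - τ ^ 2)))) = Real.exp (-(w ⬝ᵥ w) / (2 * 1)) *
      Real.exp (-((-(τ • w)) ⬝ᵥ (-(τ • w))) / (2 * (1 - τ ^ 2))) := by
    rw [← Real.exp_add]
    congr 1
    simp only [neg_dotProduct_neg, smul_dotProduct, dotProduct_smul, smul_eq_mul]
    field_simp
    ring
  rw [he]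
  ring

/-- The right and left eigenvectors for z are e₀ and (1, u), with product 1. This is what the row
substitution w = u(z - D) is designed for: the overlap depends on |u| alone. -/
theorem overlapSq_triangular (z : ℝ) (u : Fin n → ℝ) {D : Matrix (Fin n) (Fin n) ℝ}
    (hD : (z • 1 - D).det ≠ 0) :
    overlapSq (z • 1 - bordered z (u ᵥ* (z • 1 - D)) 0 D) = 1 + u ⬝ᵥ u := by
  have hA : (z • 1 - bordered z (u ᵥ* (z • 1 - D)) 0 D).adjugate = (z • 1 - D).det •
      vecMulVec (Pi.single 0 1 : Fin (n + 1) → ℝ) (Fin.cons 1 u : Fin (n + 1) → ℝ) := by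
    set A := z • 1 - bordered z (u ᵥ* (z • 1 - D)) 0 D with hAdef
    have hAb : A = bordered 0 (-(u ᵥ* (z • 1 - D))) 0 (z • 1 - D) := by
      rw [hAdef, smul_one_sub_bordered, sub_self, neg_zero]
    have hdet : A.det = 0 := by rw [hAb, det_bordered]; simp
    have hrow : ∀ (i : Fin n) j, A.adjugate i.succ j = 0 := by
      intro i j
      have h := mul_adjugate A
      rw [hdet, zero_smul] at h
      have hv : (z • 1 - D) *ᵥ (fun k => A.adjugate k.succ j) = 0 := by
        ext k
        have := congrFun (congrFun h k.succ) j
        rw [Matrix.mul_apply, Fin.sum_univ_succ] at this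
        simpa [hAb, mulVec, dotProduct] using this
      have := eq_zero_of_mulVec_eq_zero hD hv
      exact congrFun this i
    ext i j
    refine Fin.cases ?_ (fun i => ?_) i
    · refine Fin.cases ?_ (fun j => ?_) j
      · rw [hAb, adjugate_bordered_zero_zero]
        simp [vecMulVec_apply]
      · rw [hAb, adjugate_bordered_zero_succ, neg_vecMul, vecMul_vecMul, mul_adjugate]
        simp [vecMulVec_apply, vecMul_smul]
    · rw [hrow]
      simp [vecMulVec_apply]
  rw [overlapSq_eq_of_adjugate hD hA, dotProduct_cons_cons]
  simp

theorem det_sq_mul_weight_triangular {τ : ℝ} (h0 : 0 ≤ τ) (h1 : τ < 1) (f : ℝ × ℝ → ℝ≥0∞) (z : ℝ)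
    (u : Fin n → ℝ) (D : Fin n → Fin n → ℝ) :
    ENNReal.ofReal ((z • 1 - Matrix.of D).det ^ 2) *
        weight τ f z (Matrix.of (ofBlocks (z, u ᵥ* (z • 1 - Matrix.of D), 0, D))) =
      f (z, (u ⬝ᵥ u) / (1 - τ)) * ENNReal.ofReal (cornerFactor n τ z) *
        (ENNReal.ofReal (ellipticPDF n τ (Matrix.of D)) *
          ENNReal.ofReal ((z • 1 - Matrix.of D).det ^ 2 *
            Real.exp (-((u ᵥ* (z • 1 - Matrix.of D)) ⬝ᵥ (u ᵥ* (z • 1 - Matrix.of D)) /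
              (2 * (1 - τ ^ 2)))))) := by
  by_cases hD : (z • 1 - Matrix.of D).det = 0
  · simp [hD]
  rw [weight, of_ofBlocks, overlapSq_triangular z u hD, ellipticPDF_triangular h0 h1,
    add_sub_cancel_left, ENNReal.ofReal_mul (mul_nonneg (cornerFactor_nonneg _ _ _) (by positivity)),
    ENNReal.ofReal_mul (cornerFactor_nonneg _ _ _), ENNReal.ofReal_mul (sq_nonneg _)]
  ring

theorem lintegral_det_sq_mul_weight {m : ℕ} {τ : ℝ} (h0 : 0 ≤ τ) (h1 : τ < 1)
    (f : ℝ × ℝ → ℝ≥0∞) (z : ℝ) (u : Fin (m + 1) → ℝ) :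
    ∫⁻ D : Fin (m + 1) → Fin (m + 1) → ℝ, ENNReal.ofReal ((z • 1 - Matrix.of D).det ^ 2) *
        weight τ f z (Matrix.of (ofBlocks (z, u ᵥ* (z • 1 - Matrix.of D), 0, D))) =
      f (z, (u ⬝ᵥ u) / (1 - τ)) * ENNReal.ofReal (cornerFactor (m + 1) τ z) *
        ENNReal.ofReal ((√(1 + u ⬝ᵥ u / (1 - τ)))⁻¹ * Real.exp (-(z ^ 2 * (u ⬝ᵥ u / (1 - τ)) /
          (2 * (1 + τ) * (1 + u ⬝ᵥ u / (1 - τ))))) *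
          √((1 + τ) / (1 + τ + u ⬝ᵥ u / (1 - τ))) ^ m * momentBracket m τ z (u ⬝ᵥ u / (1 - τ))) := by
  have huu : 0 ≤ u ⬝ᵥ u := Finset.sum_nonneg fun i _ => mul_self_nonneg _
  have h1' : 0 < 1 - τ := by linarith
  have h2' : 0 < 1 + τ := by linarith
  have hq : 0 ≤ u ⬝ᵥ u / (1 - τ) := div_nonneg huu h1'.le
  have hW : Continuous fun D : Fin (m + 1) → Fin (m + 1) → ℝ =>
      z • (1 : Matrix (Fin (m + 1)) (Fin (m + 1)) ℝ) - Matrix.of D :=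
    continuous_smul_one_sub.comp (continuous_const (y := z).prodMk continuous_id)
  have hv : Continuous fun D : Fin (m + 1) → Fin (m + 1) → ℝ => u ᵥ* (z • 1 - Matrix.of D) :=
    continuous_const.matrix_vecMul hW
  have hΦ : Measurable fun D : Fin (m + 1) → Fin (m + 1) → ℝ =>
      ENNReal.ofReal ((z • 1 - Matrix.of D).det ^ 2 *
        Real.exp (-((u ᵥ* (z • 1 - Matrix.of D)) ⬝ᵥ (u ᵥ* (z • 1 - Matrix.of D)) /
          (2 * (1 - τ ^ 2))))) :=
    ((hW.matrix_det.pow 2).mul (((hv.dotProduct hv).div_const _).neg.rexp)).measurable.ennreal_ofReal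
  have hpdf : Measurable fun X : Fin (m + 1) → Fin (m + 1) → ℝ =>
      ENNReal.ofReal (ellipticPDF (m + 1) τ (Matrix.of X)) :=
    (continuous_ellipticPDF (m + 1) τ).measurable.ennreal_ofReal
  simp only [det_sq_mul_weight_triangular h0 h1]
  have hmul : Measurable fun D : Fin (m + 1) → Fin (m + 1) → ℝ =>
      ENNReal.ofReal (ellipticPDF (m + 1) τ (Matrix.of D)) *
        ENNReal.ofReal ((z • 1 - Matrix.of D).det ^ 2 *
          Real.exp (-((u ᵥ* (z • 1 - Matrix.of D)) ⬝ᵥ (u ᵥ* (z • 1 - Matrix.of D)) /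
            (2 * (1 - τ ^ 2))))) := hpdf.mul hΦ
  rw [lintegral_const_mul _ hmul, ← lintegral_det_sq_tilt h0 h1 z hq]
  congr 1
  have hwd := lintegral_withDensity_eq_lintegral_mul (volume) hpdf hΦ
  simp only [Pi.mul_apply] at hwd
  rw [← hwd]
  -- Rotating u to |u|e₀ turns |u(z - D)|² into |u|² times the squared length of row 0 of z - D.
  -- With q = |u|²/(1 - τ) and 1 - τ² = (1 - τ)(1 + τ), the exponent becomes the tilt of
  -- `lintegral_det_sq_tilt`.
  obtain ⟨O, hO, hOs, hOu⟩ := exists_orthogonal_mulVec_eq u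
  change ∫⁻ D, _ ∂(ellipticMeasure (m + 1) τ) = _
  rw [← (measurePreserving_conjBy_ellipticMeasure τ hO).lintegral_comp hΦ]
  refine lintegral_congr fun D => ?_
  have e1 : z • 1 - Matrix.of (conjBy O D) = O * (z • 1 - Matrix.of D) * Oᵀ := by
    rw [of_conjBy, inv_eq_transpose_of_orthogonal hO, smul_one_sub_conj hO]
  have hO' : Oᵀ * O = 1 := mul_eq_one_comm.mp hO
  have e2 : u ᵥ* (O * (z • 1 - Matrix.of D) * Oᵀ) =
      √(u ⬝ᵥ u) • ((z • 1 - Matrix.of D : Matrix _ _ ℝ) 0 ᵥ* Oᵀ) := by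
    rw [← vecMul_vecMul, ← vecMul_vecMul, ← mulVec_transpose O, hOs, hOu, smul_vecMul,
      smul_vecMul, single_one_vecMul]
    rfl
  have e3 : ∀ v : Fin (m + 1) → ℝ, (v ᵥ* Oᵀ) ⬝ᵥ (v ᵥ* Oᵀ) = v ⬝ᵥ v := by
    intro v
    rw [vecMul_transpose, dotProduct_mulVec, ← vecMul_transpose, vecMul_vecMul, hO', vecMul_one]
  rw [e1, det_conj_orthogonal hO, e2, smul_dotProduct, dotProduct_smul, e3, smul_eq_mul,
    smul_eq_mul, ← mul_assoc, Real.mul_self_sqrt huu]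
  congr 4
  have : 1 - τ ^ 2 = (1 - τ) * (1 + τ) := by ring
  rw [this]
  field_simp

end

/-! ### Radial integrals -/

theorem volume_dotProduct_self_le {n : ℕ} (hn : 0 < n) {t : ℝ} (ht : 0 ≤ t) :
    volume {u : Fin n → ℝ | u ⬝ᵥ u ≤ t} =
      ENNReal.ofReal (√t ^ n * (√Real.pi ^ n / Real.Gamma (n / 2 + 1))) := by
  have : Nonempty (Fin n) := ⟨⟨0, hn⟩⟩
  have h := EuclideanSpace.volume_closedBall (Fin n) (0 : EuclideanSpace ℝ (Fin n)) (√t)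
  rw [← (PiLp.volume_preserving_toLp (Fin n)).measure_preimage
    Metric.isClosed_closedBall.measurableSet.nullMeasurableSet, Fintype.card_fin,
    ← ENNReal.ofReal_pow (Real.sqrt_nonneg t), ← ENNReal.ofReal_mul (by positivity)] at h
  rw [← h]
  congr 1
  ext u
  simp only [Set.mem_ofPred_eq, Set.mem_preimage, mem_closedBall_zero_iff]
  rw [EuclideanSpace.norm_eq, Real.sqrt_le_sqrt_iff ht]
  simp [dotProduct, sq]

theorem setLIntegral_Ioc_rpow {a C t : ℝ} (ha : 0 < a) (hC : 0 ≤ C) (ht : 0 ≤ t) :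
    ∫⁻ s in Set.Ioc 0 t, ENNReal.ofReal (C * s ^ (a - 1)) = ENNReal.ofReal (C * (t ^ a / a)) := by
  have hi : IntervalIntegrable (fun s : ℝ => C * s ^ (a - 1)) volume 0 t :=
    (intervalIntegral.intervalIntegrable_rpow' (by linarith)).const_mul C
  rw [← ofReal_integral_eq_lintegral_ofReal, ← intervalIntegral.integral_of_le ht,
    intervalIntegral.integral_const_mul, integral_rpow (Or.inl (by linarith))]
  · simp [Real.zero_rpow ha.ne']
  · exact (intervalIntegrable_iff_integrableOn_Ioc_of_le ht).mp hi
  · filter_upwards [ae_restrict_mem measurableSet_Ioc] with s hs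
    exact mul_nonneg hC (Real.rpow_nonneg hs.1.le _)

/-- The law of the squared Euclidean length under Lebesgue measure. -/
theorem map_dotProduct_self {n : ℕ} (hn : 0 < n) :
    (volume : Measure (Fin n → ℝ)).map (fun u => u ⬝ᵥ u) =
      (volume.restrict (Set.Ioi 0)).withDensity fun t =>
        ENNReal.ofReal (√Real.pi ^ n / Real.Gamma (n / 2) * t ^ ((n : ℝ) / 2 - 1)) := by
  have hn' : (0 : ℝ) < (n : ℝ) / 2 := by positivity
  have hΓ : 0 < Real.Gamma ((n : ℝ) / 2) := Real.Gamma_pos_of_pos hn'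
  have hm : Measurable fun u : Fin n → ℝ => u ⬝ᵥ u :=
    (continuous_id.dotProduct continuous_id).measurable
  set μ := (volume : Measure (Fin n → ℝ)).map (fun u => u ⬝ᵥ u) with hμ
  set ν := (volume.restrict (Set.Ioi (0 : ℝ))).withDensity fun t =>
        ENNReal.ofReal (√Real.pi ^ n / Real.Gamma (n / 2) * t ^ ((n : ℝ) / 2 - 1)) with hν
  have h1 : ∀ t, μ (Set.Iic t) = ν (Set.Iic t) ∧ μ (Set.Iic t) ≠ ∞ := by
    intro t
    rw [hμ, Measure.map_apply hm measurableSet_Iic, hν, withDensity_apply _ measurableSet_Iic,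
      Measure.restrict_restrict measurableSet_Iic, Set.inter_comm, Set.Ioi_inter_Iic]
    rcases lt_or_ge t 0 with ht | ht
    · have : (fun u : Fin n → ℝ => u ⬝ᵥ u) ⁻¹' Set.Iic t = ∅ := by
        ext u
        have : 0 ≤ u ⬝ᵥ u := Finset.sum_nonneg fun i _ => mul_self_nonneg _
        simp only [Set.mem_preimage, Set.mem_Iic, Set.mem_empty_iff_false, iff_false, not_le]
        linarith
      rw [this, Set.Ioc_eq_empty (by linarith)]
      simp
    · have := volume_dotProduct_self_le hn ht
      rw [setLIntegral_Ioc_rpow hn' (by positivity) ht]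
      refine ⟨?_, ?_⟩
      · change volume {u : Fin n → ℝ | u ⬝ᵥ u ≤ t} = _
        rw [this, Real.Gamma_add_one hn'.ne', Real.sqrt_eq_rpow t, ← Real.rpow_natCast,
          ← Real.rpow_mul ht]
        congr 1
        have : (1 : ℝ) / 2 * n = n / 2 := by ring
        rw [this]
        field_simp
      · change volume {u : Fin n → ℝ | u ⬝ᵥ u ≤ t} ≠ _
        rw [this]
        exact ENNReal.ofReal_ne_top
  -- Both measures are infinite but finite on left half-lines, so values on half-open intervals are
  -- obtained by subtraction and determine the measure.
  have h2 : ∀ {a b : ℝ}, a < b → ∀ κ : Measure ℝ, κ (Set.Iic a) ≠ ∞ →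
      κ (Set.Ioc a b) = κ (Set.Iic b) - κ (Set.Iic a) := by
    intro a b hab κ ha
    rw [show Set.Ioc a b = Set.Iic b \ Set.Iic a by ext; simp [and_comm], measure_sdiff (Set.Iic_subset_Iic.mpr hab.le)
      measurableSet_Iic.nullMeasurableSet ha]
  refine Measure.ext_of_Ioc' _ _ (fun a b hab => ?_) fun a b hab => ?_
  · exact measure_ne_top_of_subset Set.Ioc_subset_Iic_self (h1 b).2
  · rw [h2 hab μ (h1 a).2, h2 hab ν ((h1 a).1 ▸ (h1 a).2), (h1 a).1, (h1 b).1]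

theorem lintegral_dotProduct_self {n : ℕ} (hn : 0 < n) {F : ℝ → ℝ≥0∞} (hF : Measurable F) :
    ∫⁻ u : Fin n → ℝ, F (u ⬝ᵥ u) = ∫⁻ t in Set.Ioi 0,
      ENNReal.ofReal (√Real.pi ^ n / Real.Gamma (n / 2) * t ^ ((n : ℝ) / 2 - 1)) * F t := by
  have hm : Measurable fun u : Fin n → ℝ => u ⬝ᵥ u :=
    (continuous_id.dotProduct continuous_id).measurable
  rw [← lintegral_map hF hm, map_dotProduct_self hn, lintegral_withDensity_eq_lintegral_mul _
    (by fun_prop) hF]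
  rfl

theorem lintegral_dotProduct_self_div {n : ℕ} (hn : 0 < n) {c : ℝ} (hc : 0 < c) {F : ℝ → ℝ≥0∞}
    (hF : Measurable F) :
    ∫⁻ u : Fin n → ℝ, F (u ⬝ᵥ u / c) = ∫⁻ q in Set.Ioi 0,
      ENNReal.ofReal (√Real.pi ^ n / Real.Gamma (n / 2) * √c ^ n * q ^ ((n : ℝ) / 2 - 1)) *
        F q := by
  rw [lintegral_dotProduct_self hn (F := fun t => F (t / c)) (hF.comp (measurable_id.div_const c))]
  have himg : Set.Ioi (0 : ℝ) = (fun q => c * q) '' Set.Ioi 0 :=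
    (Set.image_const_mul_Ioi_zero hc).symm
  conv_lhs => rw [himg]
  rw [lintegral_image_eq_lintegral_abs_deriv_mul measurableSet_Ioi (f' := fun _ => c)
    (fun x _ => by simpa using ((hasDerivAt_id x).const_mul c).hasDerivWithinAt)
    (fun x _ y _ h => mul_left_cancel₀ hc.ne' h)]
  refine setLIntegral_congr_fun measurableSet_Ioi fun q hq => ?_
  have hq' : (0 : ℝ) < q := hq
  rw [mul_div_cancel_left₀ _ hc.ne', ← mul_assoc, ← ENNReal.ofReal_mul (abs_nonneg _),
    abs_of_pos hc, Real.mul_rpow hc.le hq'.le]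
  congr 2
  have : √c ^ n = c * c ^ ((n : ℝ) / 2 - 1) := by
    rw [Real.sqrt_eq_rpow, ← Real.rpow_natCast, ← Real.rpow_mul hc.le]
    nth_rewrite 2 [← Real.rpow_one c]
    rw [← Real.rpow_add hc]
    congr 1
    ring
  rw [this]
  ring

theorem lintegral_rpow_mul_exp_neg {a r : ℝ} (ha : 0 < a) (hr : 0 < r) :
    ∫⁻ x in Set.Ioi 0, ENNReal.ofReal (x ^ (a - 1) * Real.exp (-(r * x))) =
      ENNReal.ofReal ((1 / r) ^ a * Real.Gamma a) := by
  have h := Real.integral_rpow_mul_exp_neg_mul_Ioi ha hr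
  have hpos : 0 < (1 / r) ^ a * Real.Gamma a :=
    mul_pos (by positivity) (Real.Gamma_pos_of_pos ha)
  rw [← h, ofReal_integral_eq_lintegral_ofReal]
  -- The integral of a non-integrable function is 0 by convention, whereas the known value is
  -- positive.
  · by_contra hni
    rw [integral_undef hni] at h
    exact hpos.ne h
  · filter_upwards [ae_restrict_mem measurableSet_Ioi] with s hs
    exact mul_nonneg (Real.rpow_nonneg (le_of_lt hs) _) (Real.exp_pos _).le

theorem lintegral_exp_neg_mul_dotProduct_self (n : ℕ) {x : ℝ} (hx : 0 < x) :
    ∫⁻ y : Fin n → ℝ, ENNReal.ofReal (Real.exp (-(x * (y ⬝ᵥ y)))) =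
      ENNReal.ofReal (√(Real.pi / x) ^ n) := by
  have hv : (0 : ℝ) < 1 / (2 * x) := by positivity
  have h : gaussVec n (1 / (2 * x)) Set.univ = 1 := measure_univ
  rw [gaussVec_eq_withDensity n hv, withDensity_apply _ MeasurableSet.univ,
    Measure.restrict_univ] at h
  have e : 2 * Real.pi * (1 / (2 * x)) = Real.pi / x := by field_simp
  have e' : ∀ y : Fin n → ℝ, -(y ⬝ᵥ y) / (2 * (1 / (2 * x))) = -(x * (y ⬝ᵥ y)) := by
    intro y; field_simp
  have hs : 0 < √(Real.pi / x) := Real.sqrt_pos.mpr (by positivity)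
  simp only [e, e'] at h
  simp only [ENNReal.ofReal_mul (show 0 ≤ (√(Real.pi / x))⁻¹ ^ n by positivity)] at h
  rw [lintegral_const_mul' _ _ ENNReal.ofReal_ne_top] at h
  rw [← one_mul (∫⁻ y : Fin n → ℝ, _), ← ENNReal.ofReal_one,
    ← one_pow (M := ℝ) n, ← mul_inv_cancel₀ hs.ne', mul_pow, ENNReal.ofReal_mul (by positivity),
    mul_assoc, h, mul_one]

/-- Half the area of the unit sphere in dimension n + 1, since (1, y) meets each generic line once.
The power of 1 + |y|² is written as a Γ-integral; after exchanging the integrals the Gaussian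
integral over y leaves Γ(1/2) = √π. -/
theorem lintegral_inv_sqrt_one_add (n : ℕ) :
    ∫⁻ y : Fin n → ℝ, ENNReal.ofReal ((√(1 + y ⬝ᵥ y))⁻¹ ^ (n + 1)) =
      ENNReal.ofReal (√Real.pi ^ (n + 1) / Real.Gamma (((n : ℝ) + 1) / 2)) := by
  have hs : (0 : ℝ) < ((n : ℝ) + 1) / 2 := by positivity
  have hΓ : 0 < Real.Gamma (((n : ℝ) + 1) / 2) := Real.Gamma_pos_of_pos hs
  have hyy : ∀ y : Fin n → ℝ, 0 < 1 + y ⬝ᵥ y := fun y => by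
    have : 0 ≤ y ⬝ᵥ y := Finset.sum_nonneg fun i _ => mul_self_nonneg _
    linarith
  have hpt : ∀ y : Fin n → ℝ, ENNReal.ofReal (Real.Gamma (((n : ℝ) + 1) / 2)) *
      ENNReal.ofReal ((√(1 + y ⬝ᵥ y))⁻¹ ^ (n + 1)) =
      ∫⁻ x in Set.Ioi 0, ENNReal.ofReal (x ^ (((n : ℝ) + 1) / 2 - 1) *
        Real.exp (-((1 + y ⬝ᵥ y) * x))) := by
    intro y
    rw [lintegral_rpow_mul_exp_neg hs (hyy y), ← ENNReal.ofReal_mul hΓ.le, mul_comm]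
    congr 2
    rw [← Real.sqrt_inv, Real.sqrt_eq_rpow, ← Real.rpow_natCast,
      ← Real.rpow_mul (inv_nonneg.mpr (hyy y).le), one_div (1 + y ⬝ᵥ y)]
    congr 1
    push_cast
    ring
  have hcont : Measurable fun p : (Fin n → ℝ) × ℝ => ENNReal.ofReal
      (p.2 ^ (((n : ℝ) + 1) / 2 - 1) * Real.exp (-((1 + p.1 ⬝ᵥ p.1) * p.2))) := by
    have : Continuous fun p : (Fin n → ℝ) × ℝ => p.1 ⬝ᵥ p.1 :=
      continuous_fst.dotProduct continuous_fst
    have := this.measurable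
    fun_prop
  have hmain : ENNReal.ofReal (Real.Gamma (((n : ℝ) + 1) / 2)) *
      ∫⁻ y : Fin n → ℝ, ENNReal.ofReal ((√(1 + y ⬝ᵥ y))⁻¹ ^ (n + 1)) =
      ENNReal.ofReal (√Real.pi ^ (n + 1)) := by
    rw [← lintegral_const_mul' _ _ ENNReal.ofReal_ne_top]
    simp only [hpt]
    rw [lintegral_lintegral_swap hcont.aemeasurable]
    have hx : ∀ x ∈ Set.Ioi (0 : ℝ), ∫⁻ y : Fin n → ℝ, ENNReal.ofReal
        (x ^ (((n : ℝ) + 1) / 2 - 1) * Real.exp (-((1 + y ⬝ᵥ y) * x))) =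
        ENNReal.ofReal (√Real.pi ^ n) *
          ENNReal.ofReal (x ^ ((1 : ℝ) / 2 - 1) * Real.exp (-(1 * x))) := by
      intro x hx
      have hx' : (0 : ℝ) < x := hx
      have e : ∀ y : Fin n → ℝ, ENNReal.ofReal
          (x ^ (((n : ℝ) + 1) / 2 - 1) * Real.exp (-((1 + y ⬝ᵥ y) * x))) =
          ENNReal.ofReal (x ^ (((n : ℝ) + 1) / 2 - 1) * Real.exp (-(1 * x))) *
            ENNReal.ofReal (Real.exp (-(x * (y ⬝ᵥ y)))) := by
        intro y
        rw [← ENNReal.ofReal_mul (by positivity), mul_assoc, ← Real.exp_add]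
        congr 3
        ring
      simp only [e]
      rw [lintegral_const_mul' _ _ ENNReal.ofReal_ne_top,
        lintegral_exp_neg_mul_dotProduct_self n hx', ← ENNReal.ofReal_mul (by positivity),
        ← ENNReal.ofReal_mul (by positivity)]
      congr 1
      have e2 : √(Real.pi / x) ^ n = √Real.pi ^ n * x ^ (-((n : ℝ) / 2)) := by
        rw [Real.sqrt_div Real.pi_pos.le, div_pow, Real.rpow_neg hx'.le, Real.sqrt_eq_rpow x,
          ← Real.rpow_natCast (x ^ _), ← Real.rpow_mul hx'.le, div_eq_mul_inv]
        congr 3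
        ring
      have e3 : x ^ ((1 : ℝ) / 2 - 1) = x ^ (((n : ℝ) + 1) / 2 - 1) * x ^ (-((n : ℝ) / 2)) := by
        rw [← Real.rpow_add hx']
        congr 1
        ring
      rw [e2, e3]
      ring
    rw [setLIntegral_congr_fun measurableSet_Ioi hx, lintegral_const_mul' _ _ ENNReal.ofReal_ne_top,
      lintegral_rpow_mul_exp_neg (by norm_num) one_pos, ← ENNReal.ofReal_mul (by positivity),
      Real.Gamma_one_half_eq]
    congr 1
    simp [pow_succ]
  rw [ENNReal.ofReal_div_of_pos hΓ, ← hmain, mul_comm,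
    ENNReal.mul_div_cancel_right (by simpa using hΓ) ENNReal.ofReal_ne_top]

/-! ### Constants and the final formula -/

section

variable {m : ℕ} {τ : ℝ} (h0 : 0 ≤ τ) (h1 : τ < 1) (z : ℝ) {q : ℝ}
include h0

/-- Two identities reconcile the stated bracket with the computed moment: R_m + τ m R_(m-1) = z P_m,
which cancels the -2z² P_m term, and m S_(m-1) = m(m P_(m-1) - T_(m-1)), which holds also at m = 0.
-/
theorem jointDensity_eq_momentBracket (hq : 0 < q) :
    jointDensity (m + 2) τ z q =
      1 / (2 * (1 + τ) * √(2 * Real.pi) * Real.Gamma ((m : ℝ) + 1)) *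
        (Real.exp (-(z ^ 2 / (2 * (1 + τ))) * (1 + q / (1 + q))) / (√q * √(1 + q))) *
        (√q / √(1 + τ + q)) ^ m * momentBracket m τ z q := by
  have hbr : momentBracket m τ z q =
      ((1 + τ - 2 * z ^ 2) * polyP τ m z +
          2 * z * (polyR τ m z + τ * m * polyR τ (m - 1) z)) / (1 + q) +
      polyP τ m z * z ^ 2 / (1 + q) ^ 2 +
      τ ^ 2 * (1 + τ) ^ 2 * ((m : ℝ) + 2) * m * polyP τ (m - 1) z / (1 + τ + q) ^ 2 +
      (1 + τ) * (1 - τ ^ 2) * m *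
          (m * polyP τ (m - 1) z - polyT τ (m - 1) z) / (1 + τ + q) -
      2 * τ * (1 + τ) * m * z * polyR τ (m - 1) z / ((1 + q) * (1 + τ + q)) := by
    have hS : (m : ℝ) * polyS τ (m - 1) z =
        m * (m * polyP τ (m - 1) z - polyT τ (m - 1) z) := by
      rcases m with _ | k
      · simp
      · simp [polyS]
    have hR : polyR τ m z + τ * m * polyR τ (m - 1) z = z * polyP τ m z := by
      rw [polyR_add z h0 m]; ring
    have hq1 : 1 + q ≠ 0 := by positivity
    have hq2 : 1 + τ + q ≠ 0 := by positivity
    rw [hR, momentBracket]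
    have e : (1 - τ ^ 2) * (m * ((1 + τ) / (1 + τ + q))) * polyS τ (m - 1) z =
        (1 - τ ^ 2) * ((1 + τ) / (1 + τ + q)) * ((m : ℝ) * polyS τ (m - 1) z) := by ring
    rw [e, hS]
    field_simp
    ring
  have hpow : (q / (q + 1 + τ)) ^ (((m + 2 : ℕ) : ℝ) / 2 - 1) = (√q / √(1 + τ + q)) ^ m := by
    rw [← Real.sqrt_div hq.le, Real.sqrt_eq_rpow, ← Real.rpow_natCast,
      ← Real.rpow_mul (by positivity)]
    congr 1
    · congr 1; ring
    · push_cast; ring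
  rw [jointDensity, hpow, hbr, Real.sqrt_mul hq.le]
  have e1 : ((m + 2 : ℕ) : ℝ) - 2 = m := by push_cast; ring
  have e2 : ((m + 2 : ℕ) : ℝ) - 1 = (m : ℝ) + 1 := by push_cast; ring
  have e3 : ((m + 2 : ℕ) : ℝ) = (m : ℝ) + 2 := by push_cast; ring
  have e4 : m + 2 - 2 = m := rfl
  have e5 : m + 2 - 3 = m - 1 := rfl
  rw [e1, e2, e3, e4, e5]

include h1

theorem jointDensity_nonneg (hq : 0 < q) : 0 ≤ jointDensity (m + 2) τ z q := by
  rw [jointDensity_eq_momentBracket h0 z hq]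
  have h2 := momentBracket_nonneg (m := m) h0 h1 z hq.le
  have h3 : 0 < Real.Gamma ((m : ℝ) + 1) := Real.Gamma_pos_of_pos (by positivity)
  positivity

theorem constants_mul_eq_jointDensity (hq : 0 < q) :
    √Real.pi ^ (m + 1 + 1) / Real.Gamma (((m + 1 : ℕ) + 1) / 2) *
        (√Real.pi ^ (m + 1) / Real.Gamma ((m + 1 : ℕ) / 2) * √(1 - τ) ^ (m + 1) *
          q ^ (((m + 1 : ℕ) : ℝ) / 2 - 1)) * cornerFactor (m + 1) τ z *
        ((√(1 + q))⁻¹ * Real.exp (-(z ^ 2 * q / (2 * (1 + τ) * (1 + q)))) *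
          √((1 + τ) / (1 + τ + q)) ^ m * momentBracket m τ z q) =
      jointDensity (m + 2) τ z q := by
  have hΓ0 : Real.Gamma ((m + 1 : ℕ) / 2) ≠ 0 := (Real.Gamma_pos_of_pos (by positivity)).ne'
  have hΓ1 : Real.Gamma (((m + 1 : ℕ) + 1) / 2) ≠ 0 := (Real.Gamma_pos_of_pos (by positivity)).ne'
  have hΓ2 : Real.Gamma ((m : ℝ) + 1) ≠ 0 := (Real.Gamma_pos_of_pos (by positivity)).ne'
  have hπ : 0 < √Real.pi := Real.sqrt_pos.mpr Real.pi_pos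
  have hπ2 : √Real.pi ^ 2 = Real.pi := Real.sq_sqrt Real.pi_pos.le
  have ht : 0 < √(1 - τ) := Real.sqrt_pos.mpr (by linarith)
  have hs : 0 < √(1 + τ) := Real.sqrt_pos.mpr (by linarith)
  have hs2 : √(1 + τ) ^ 2 = 1 + τ := Real.sq_sqrt (by linarith)
  have h2π : 0 < √(2 * Real.pi) := Real.sqrt_pos.mpr (by positivity)
  have h2π2 : √(2 * Real.pi) ^ 2 = 2 * √Real.pi ^ 2 := by
    rw [hπ2, Real.sq_sqrt (by positivity)]
  have hr : 0 < √q := Real.sqrt_pos.mpr hq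
  have hk : 0 < √(1 + q) := Real.sqrt_pos.mpr (by linarith)
  have hg : 0 < √(1 + τ + q) := Real.sqrt_pos.mpr (by linarith)
  -- Legendre's duplication formula joins the Γ-factor of the eigenvector sphere with that of the
  -- polar coordinates in u.
  have hleg : Real.Gamma ((m + 1 : ℕ) / 2) * Real.Gamma (((m + 1 : ℕ) + 1) / 2) =
      Real.Gamma ((m : ℝ) + 1) * (2 ^ m)⁻¹ * √Real.pi := by
    have := Real.Gamma_mul_Gamma_add_half (((m + 1 : ℕ) : ℝ) / 2)
    rw [show ((m + 1 : ℕ) : ℝ) / 2 + 1 / 2 = ((m + 1 : ℕ) + 1) / 2 by ring,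
      show 2 * (((m + 1 : ℕ) : ℝ) / 2) = (m : ℝ) + 1 by push_cast; ring,
      show (1 : ℝ) - ((m : ℝ) + 1) = -(m : ℝ) by ring, Real.rpow_neg zero_le_two,
      Real.rpow_natCast] at this
    exact this
  have hqp : q ^ (((m + 1 : ℕ) : ℝ) / 2 - 1) = √q ^ m * (√q)⁻¹ := by
    rw [← Real.sqrt_inv, Real.sqrt_eq_rpow, Real.sqrt_eq_rpow, ← Real.rpow_natCast,
      ← Real.rpow_mul hq.le, Real.inv_rpow hq.le, ← Real.rpow_neg hq.le, ← Real.rpow_add hq]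
    congr 1
    push_cast
    ring
  have hsq1 : √(2 * Real.pi * (1 + τ)) = √(2 * Real.pi) * √(1 + τ) :=
    Real.sqrt_mul (by positivity) _
  have hsq2 : √(2 * Real.pi * (1 - τ ^ 2)) = √(2 * Real.pi) * (√(1 + τ) * √(1 - τ)) := by
    rw [Real.sqrt_mul (by positivity), ← Real.sqrt_mul (show 0 ≤ 1 + τ by linarith)]
    congr 2
    ring
  have hsq3 : √((1 + τ) / (1 + τ + q)) = √(1 + τ) / √(1 + τ + q) := Real.sqrt_div (by linarith) _
  have hexp : Real.exp (-(z ^ 2 / (2 * (1 + τ))) * (1 + q / (1 + q))) =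
      Real.exp (-(z * z) / (2 * (1 + τ))) *
        Real.exp (-(z ^ 2 * q / (2 * (1 + τ) * (1 + q)))) := by
    rw [← Real.exp_add]
    congr 1
    have : 1 + τ ≠ 0 := by positivity
    have : 1 + q ≠ 0 := by positivity
    field_simp
    ring
  rw [jointDensity_eq_momentBracket h0 z hq, cornerFactor, hqp, hsq1, hsq2, hsq3, hexp, mul_one]
  -- All constants independent of z and q. The powers of 1 - τ from rescaling |u|² to q cancel those
  -- in the density of the row.
  have key : √Real.pi ^ (m + 1 + 1) / Real.Gamma (((m + 1 : ℕ) + 1) / 2) *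
      (√Real.pi ^ (m + 1) / Real.Gamma ((m + 1 : ℕ) / 2)) * √(1 - τ) ^ (m + 1) *
      ((√(2 * Real.pi))⁻¹ ^ (m + 1) *
        (√(2 * Real.pi) * (√(1 + τ) * √(1 - τ)))⁻¹ ^ (m + 1)) * (√(1 + τ))⁻¹ * √(1 + τ) ^ m =
      1 / (2 * (1 + τ) * Real.Gamma ((m : ℝ) + 1)) := by
    have e1 : √Real.pi ^ (m + 1 + 1) / Real.Gamma (((m + 1 : ℕ) + 1) / 2) *
        (√Real.pi ^ (m + 1) / Real.Gamma ((m + 1 : ℕ) / 2)) =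
        (√Real.pi ^ 2) ^ (m + 1) * 2 ^ m / Real.Gamma ((m : ℝ) + 1) := by
      rw [div_mul_div_comm, mul_comm (Real.Gamma (((m + 1 : ℕ) + 1) / 2)), hleg]
      field_simp
      ring
    have e2 : √(1 - τ) ^ (m + 1) * ((√(2 * Real.pi))⁻¹ ^ (m + 1) *
        (√(2 * Real.pi) * (√(1 + τ) * √(1 - τ)))⁻¹ ^ (m + 1)) =
        ((2 * √Real.pi ^ 2)⁻¹ * (√(1 + τ))⁻¹) ^ (m + 1) := by
      rw [← h2π2, ← mul_pow, ← mul_pow]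
      congr 1
      field_simp
    have e3 : 2 * (1 + τ) * Real.Gamma ((m : ℝ) + 1) =
        2 * √(1 + τ) ^ 2 * Real.Gamma ((m : ℝ) + 1) := by rw [hs2]
    rw [e1, mul_assoc (_ / _), e2, e3]
    simp only [mul_pow, inv_pow, mul_inv, pow_succ]
    field_simp
  calc _ = (√Real.pi ^ (m + 1 + 1) / Real.Gamma (((m + 1 : ℕ) + 1) / 2) *
      (√Real.pi ^ (m + 1) / Real.Gamma ((m + 1 : ℕ) / 2)) * √(1 - τ) ^ (m + 1) *
      ((√(2 * Real.pi))⁻¹ ^ (m + 1) *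
        (√(2 * Real.pi) * (√(1 + τ) * √(1 - τ)))⁻¹ ^ (m + 1)) * (√(1 + τ))⁻¹ * √(1 + τ) ^ m) *
      ((√(2 * Real.pi))⁻¹ * (Real.exp (-(z * z) / (2 * (1 + τ))) *
        Real.exp (-(z ^ 2 * q / (2 * (1 + τ) * (1 + q))))) * ((√q)⁻¹ * (√(1 + q))⁻¹) *
        (√q / √(1 + τ + q)) ^ m * momentBracket m τ z q) := by
        rw [div_pow, div_pow]; ring
    _ = _ := by
        rw [key]
        field_simp

end

theorem measurable_momentBracket (m : ℕ) (τ z : ℝ) : Measurable (momentBracket m τ z) := by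
  unfold momentBracket
  fun_prop

/-- For almost every z the matrix z - D is invertible for almost every D, so the row substitution
may be made under the integral; thereafter u and D are exchanged and only |u| survives. -/
theorem lintegral_realEigenvalueSum_eq (m : ℕ) {τ : ℝ} (h0 : 0 ≤ τ) (h1 : τ < 1)
    {f : ℝ × ℝ → ℝ≥0∞} (hf : Measurable f) :
    ∫⁻ X, realEigenvalueSum τ f (Matrix.of X) ∂(ellipticMeasure (m + 2) τ) =
      ∫⁻ z : ℝ, ∫⁻ q in Set.Ioi (0 : ℝ),
        f (z, q) * ENNReal.ofReal (jointDensity (m + 2) τ z q) := by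
  have hG := measurable_weight (n := m + 2) τ hf
  rw [(lintegral_realEigenvalueSum (n := m + 1) h0 h1 hf).2,
    setLIntegral_regularSet (G := fun z X => weight τ f z X) hG]
  refine lintegral_congr_ae ?_
  filter_upwards [ae_ae_det_ne_zero (m + 1)] with z hz
  have h1' : 0 < 1 - τ := by linarith
  simp only [lintegral_eigenvector_fiber (G := fun z X => weight τ f z X) hG
    (fun z O X hO => weight_conj f z hO X) z]
  have hρ : Measurable fun y : Fin (m + 1) → ℝ =>
      ENNReal.ofReal ((√(1 + y ⬝ᵥ y))⁻¹ ^ (m + 1 + 1)) := by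
    have : Measurable fun y : Fin (m + 1) → ℝ => y ⬝ᵥ y :=
      (continuous_id.dotProduct continuous_id).measurable
    fun_prop
  rw [lintegral_mul_const _ hρ, lintegral_inv_sqrt_one_add]
  have hW : Continuous fun D : Fin (m + 1) → Fin (m + 1) → ℝ =>
      z • (1 : Matrix (Fin (m + 1)) (Fin (m + 1)) ℝ) - Matrix.of D :=
    continuous_smul_one_sub.comp (continuous_const (y := z).prodMk continuous_id)
  have hswap : Measurable fun x : (Fin (m + 1) → Fin (m + 1) → ℝ) × (Fin (m + 1) → ℝ) =>
      ENNReal.ofReal ((z • 1 - Matrix.of x.1).det ^ 2) *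
        weight τ f z (Matrix.of (ofBlocks (z, x.2 ᵥ* (z • 1 - Matrix.of x.1), 0, x.1))) := by
    have hv : Continuous fun x : (Fin (m + 1) → Fin (m + 1) → ℝ) × (Fin (m + 1) → ℝ) =>
        x.2 ᵥ* (z • 1 - Matrix.of x.1) :=
      continuous_snd.matrix_vecMul (hW.comp continuous_fst)
    exact ((hW.matrix_det.pow 2).measurable.ennreal_ofReal.comp measurable_fst).mul
      (hG.comp (measurable_const.prodMk ((measurePreserving_ofBlocks (m + 1)).measurable.comp
        (measurable_const.prodMk
          (hv.measurable.prodMk (measurable_const.prodMk measurable_fst))))))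
  have hJ : ∫⁻ D : Fin (m + 1) → Fin (m + 1) → ℝ, ENNReal.ofReal |(z • 1 - Matrix.of D).det| *
        ∫⁻ w : Fin (m + 1) → ℝ, weight τ f z (Matrix.of (ofBlocks (z, w, 0, D))) =
      ∫⁻ u : Fin (m + 1) → ℝ, ∫⁻ D : Fin (m + 1) → Fin (m + 1) → ℝ,
        ENNReal.ofReal ((z • 1 - Matrix.of D).det ^ 2) *
          weight τ f z (Matrix.of (ofBlocks (z, u ᵥ* (z • 1 - Matrix.of D), 0, D))) := by
    rw [← lintegral_lintegral_swap hswap.aemeasurable]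
    refine lintegral_congr_ae ?_
    filter_upwards [hz] with D hD
    exact lintegral_row_substitution (G := fun z X => weight τ f z X) hG hD
  rw [hJ]
  simp only [lintegral_det_sq_mul_weight h0 h1]
  have hF : Measurable fun q : ℝ => f (z, q) * ENNReal.ofReal (cornerFactor (m + 1) τ z) *
      ENNReal.ofReal ((√(1 + q))⁻¹ * Real.exp (-(z ^ 2 * q / (2 * (1 + τ) * (1 + q)))) *
        √((1 + τ) / (1 + τ + q)) ^ m * momentBracket m τ z q) := by
    have := measurable_momentBracket m τ z
    fun_prop
  rw [lintegral_dotProduct_self_div (show 0 < m + 1 by omega) h1' hF,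
    ← lintegral_const_mul' _ _ ENNReal.ofReal_ne_top]
  refine setLIntegral_congr_fun measurableSet_Ioi fun q hq => ?_
  have hq' : (0 : ℝ) < q := hq
  have hΓ0 : 0 < Real.Gamma ((m + 1 : ℕ) / 2) := Real.Gamma_pos_of_pos (by positivity)
  have hΓ1 : 0 < Real.Gamma (((m + 1 : ℕ) + 1) / 2) := Real.Gamma_pos_of_pos (by positivity)
  have hsplit : ∀ {a b d : ℝ}, 0 ≤ a → 0 ≤ b →
      ENNReal.ofReal (a * b * cornerFactor (m + 1) τ z * d) = ENNReal.ofReal a * ENNReal.ofReal b *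
        ENNReal.ofReal (cornerFactor (m + 1) τ z) * ENNReal.ofReal d := by
    intro a b d ha hb
    have hc := cornerFactor_nonneg (m + 1) τ z
    rw [ENNReal.ofReal_mul (by positivity), ENNReal.ofReal_mul (by positivity),
      ENNReal.ofReal_mul ha]
  rw [← constants_mul_eq_jointDensity h0 h1 z hq', hsplit (by positivity) (by positivity)]
  ring

end EllipticEnsemble

theorem theorem1 (N : ℕ) (hN : 2 ≤ N) (τ : ℝ) (hτ0 : 0 ≤ τ) (hτ1 : τ < 1) :
    (∀ z q : ℝ, 0 < q → 0 ≤ EllipticEnsemble.jointDensity N τ z q) ∧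
    ∀ f : ℝ × ℝ → ℝ≥0∞, Measurable f →
      AEMeasurable
        (fun X : Fin N → Fin N → ℝ => EllipticEnsemble.realEigenvalueSum τ f (Matrix.of X))
        (EllipticEnsemble.ellipticMeasure N τ) ∧
      ∫⁻ X, EllipticEnsemble.realEigenvalueSum τ f (Matrix.of X)
          ∂(EllipticEnsemble.ellipticMeasure N τ) =
        ∫⁻ z : ℝ, ∫⁻ q in Set.Ioi (0 : ℝ),
          f (z, q) * ENNReal.ofReal (EllipticEnsemble.jointDensity N τ z q) := by
  obtain ⟨m, rfl⟩ : ∃ m, N = m + 2 := ⟨N - 2, by omega⟩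
  refine ⟨fun z q hq => EllipticEnsemble.jointDensity_nonneg hτ0 hτ1 z hq, fun f hf => ⟨?_, ?_⟩⟩
  · exact (EllipticEnsemble.lintegral_realEigenvalueSum (n := m + 1) hτ0 hτ1 hf).1
  · exact EllipticEnsemble.lintegral_realEigenvalueSum_eq m hτ0 hτ1 hf
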